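/- Let $d\ge 1$ and let $A$ be a real $d\times d$ matrix that is expanding: there is $q>1$ with $\|Ax\|_2\ge q\|x\|_2$ for all $x\in\mathbb R^d$. Let $f:\mathbb R^d\to\mathbb R$ be $\mathbb Z^d$-periodic ($f(x+e_i)=f(x)$ for all $x$ and $i=1,\dots,d$), square integrable on $[0,1)^d$, with $\int_{[0,1)^d}f(x)\,dx=0$. For a row vector $\xi\in\mathbb Z^d$ put $\widehat f(\xi)=\int_{[0,1)^d}f(x)e^{-2\pi i\,\xi x}\,dx$, and for $a>0$ put $$f_a(x)=\sum_{\xi\in\mathbb Z^d\setminus\{0\},\ |\xi_1|,\dots,|\xi_d|\le a}\widehat f(\xi)e^{2\pi i\,\xi x}.$$ Assume that $\sum_{m=1}^\infty\|f-f_{2^m}\|_{L^2([0,1)^d)}<\infty$. Then the series $$\sigma^2(f)=\sum_{l\ge 0}(2-\delta_{0,l})\sum_{\xi,\xi'\in\mathbb Z^d}\widehat f(\xi)\widehat f(\xi')\,\mathbf 1(\xi+\xi'A^l=0)$$ (where $\delta_{0,0}=1$ and $\delta_{0,l}=0$ for $l\ge 1$) converges absolutely, its sum is a nonnegative real number, and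 for every bounded measurable set $\Gamma\subset\mathbb R^d$, with $\operatorname{Leb}$ the Lebesgue measure, $$\lim_{N\to\infty}\int_\Gamma\Bigl(\frac1{\sqrt N}\sum_{k=1}^N f(A^kx)\Bigr)^2dx=\operatorname{Leb}(\Gamma)\,\sigma^2(f),$$ where all these integrals are finite, and $$\lim_{N\to\infty}\operatorname{Leb}\Bigl\{x\in\Gamma\ \Big|\ \frac1{\sqrt N}\sum_{k=1}^N f(A^kx)\le t\Bigr\}=\operatorname{Leb}(\Gamma)\,\Phi_{\sigma^2(f)}(t)$$ for every real $t\ne 0$, where $\Phi_{\sigma^2(f)}$ is the distribution function of the normal law $N(0,\sigma^2(f))$ (the point mass at $0$ if $\sigma^2(f)=0$). If $\sigma^2(f)>0$, the last limit relation also holds for $t=0$. -/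

import Mathlib

open MeasureTheory ProbabilityTheory Filter Topology
open scoped Matrix NNReal ENNReal

namespace RieszRaikov

noncomputable section

/-- `A` is expanding: `‖A x‖₂ ≥ q ‖x‖₂` for all `x`, for some `q > 1` (Euclidean norm). -/
def IsExpanding {d : ℕ} (A : Matrix (Fin d) (Fin d) ℝ) : Prop :=
  ∃ q : ℝ, 1 < q ∧ ∀ x : Fin d → ℝ, q * ‖WithLp.toLp 2 x‖ ≤ ‖WithLp.toLp 2 (A *ᵥ x)‖

/-- The unit cube `[0,1)^d`. -/
def unitCube (d : ℕ) : Set (Fin d → ℝ) :=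
  Set.univ.pi fun _ => Set.Ico (0 : ℝ) 1

/-- An integer row vector regarded as a real row vector. -/
def toRow {d : ℕ} (ξ : Fin d → ℤ) : Fin d → ℝ := fun i => (ξ i : ℝ)

/-- The character `x ↦ exp(2π√-1 ξx)`. -/
def character {d : ℕ} (ξ : Fin d → ℤ) (x : Fin d → ℝ) : ℂ :=
  Complex.exp (2 * Real.pi * Complex.I * ((toRow ξ ⬝ᵥ x : ℝ) : ℂ))

/-- The Fourier coefficient of `f` at the frequency `ξ`. -/
def fourierCoef {d : ℕ} (f : (Fin d → ℝ) → ℝ) (ξ : Fin d → ℤ) : ℂ :=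
  ∫ x in unitCube d, (f x : ℂ) * character (-ξ) x

/-- The nonzero integer frequencies all of whose coordinates are at most `a` in modulus. -/
def freqBox (d a : ℕ) : Finset (Fin d → ℤ) :=
  (Fintype.piFinset fun _ => Finset.Icc (-(a : ℤ)) (a : ℤ)).erase 0

/-- The Fourier partial sum `f_a`. -/
def partialSum {d : ℕ} (f : (Fin d → ℝ) → ℝ) (a : ℕ) (x : Fin d → ℝ) : ℂ :=
  ∑ ξ ∈ freqBox d a, fourierCoef f ξ * character ξ x

/-- The norm `‖f - f_a‖` in `L²([0,1)^d)`. -/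
def partialSumError {d : ℕ} (f : (Fin d → ℝ) → ℝ) (a : ℕ) : ℝ≥0∞ :=
  eLpNorm (fun x => (f x : ℂ) - partialSum f a x) 2 (volume.restrict (unitCube d))

open Classical in
/-- The term of the series for the limiting variance at `(l, ξ, ξ')`. -/
def varianceTerm {d : ℕ} (A : Matrix (Fin d) (Fin d) ℝ) (f : (Fin d → ℝ) → ℝ)
    (p : ℕ × (Fin d → ℤ) × (Fin d → ℤ)) : ℂ :=
  (if p.1 = 0 then 1 else 2) *
    if toRow p.2.1 + toRow p.2.2 ᵥ* A ^ p.1 = 0 then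
      fourierCoef f p.2.1 * fourierCoef f p.2.2
    else 0

/-- The limiting variance `σ²(f)`, as the sum of a complex series. -/
def limitVariance {d : ℕ} (A : Matrix (Fin d) (Fin d) ℝ) (f : (Fin d → ℝ) → ℝ) : ℂ :=
  ∑' p : ℕ × (Fin d → ℤ) × (Fin d → ℤ), varianceTerm A f p

/-- The normalized Riesz-Raikov sum `N^{-1/2} ∑_{k=1}^N f(A^k x)`. -/
def normalizedSum {d : ℕ} (A : Matrix (Fin d) (Fin d) ℝ) (f : (Fin d → ℝ) → ℝ)
    (N : ℕ) (x : Fin d → ℝ) : ℝ :=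
  (1 / √(N : ℝ)) * ∑ k ∈ Finset.Icc 1 N, f ((A ^ k) *ᵥ x)

end

end RieszRaikov

namespace RieszRaikov

/-! The function `f` is replaced by trigonometric polynomials, whose sums behave almost like
martingale sums because the frequencies `ξ A^k` grow geometrically.

Lebesgue measure on `Γ` is dominated by a finite measure `μ` that annihilates every exponential with
frequency of norm at least `1/2` (`exists_bandLimited`): its density is a multiple of `|𝓕 ψ|²` with
`ψ` a bump of small support. Against `μ`, well separated frequencies are therefore exactly
orthogonal.

For a trigonometric polynomial, the indices are cut into blocks of length `n` separated by gaps of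
length `g`. If `Y_j` are the block sums, expanding `∏ (1 + i s Y_j)` gives `1` plus high frequencies
(`prod_block_sub_one_mem_highSpan`), so its integral against any fixed `expo ζ` equals `∫ expo ζ`
once the blocks start late enough. Since `e^{iy}` is `(1 + iy) e^{-y²/2}` up to order three and `∑
Y_j²` obeys an `L²` law of large numbers, the characteristic functions converge to Gaussian ones
(`tendsto_integral_exp_sum`). The gaps cost `O(g/(n+g))` in the square of the `L²` norm and
disappear as `n → ∞` (`tendsto_charFun_trigPoly`).

The presence of `expo ζ` makes the convergence mixing: the limit law is the same under every measure
`ν ≤ μ`, in particular under Lebesgue measure on `Γ` (`tendsto_integral_of_le`). Second moments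
follow by applying a Fatou bound to both `ν` and `μ - ν` (`tendsto_integral_sq_of_le`).

The passage to `f` needs a bound for the sums of `f - f_{2^m}` that is uniform in `N`. At lag `l`
only pairs with `‖ξ ± ξ' A^l‖ < 1/2` correlate. By integrality and expansion they form a partial
matching, so Cauchy–Schwarz applies, and its first members satisfy `‖ξ‖ ≥ q^l - 1/2`
(`sum_coupled_le`). Their coefficient tails are summable in `l` because the dyadic errors are
(`exists_tail_bound`). The same estimate makes the variance series absolutely convergent. -/

/-! ### Iterated limits and double sums arranged by lag -/

theorem tendsto_of_approx {E : Type*} [PseudoMetricSpace E] {a : ℕ → E} {l : E}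
    (h : ∀ ε > 0, ∃ (a' : ℕ → E) (l' : E), Tendsto a' atTop (𝓝 l') ∧ dist l' l ≤ ε ∧
      ∀ᶠ N in atTop, dist (a N) (a' N) ≤ ε) : Tendsto a atTop (𝓝 l) := by
  rw [Metric.tendsto_nhds]
  intro ε hε
  obtain ⟨a', l', h1, h2, h3⟩ := h (ε / 4) (by positivity)
  filter_upwards [h3, Metric.tendsto_nhds.1 h1 (ε / 4) (by positivity)] with N h4 h5
  linarith [dist_triangle4 (a N) (a' N) l' l]

theorem sum_range_symm {M : Type*} [CommSemiring M] (H : ℕ → ℕ → M) (hH : ∀ a b, H a b = H b a)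
    (N : ℕ) : ∑ a ∈ Finset.range N, ∑ b ∈ Finset.range N, H a b =
      ∑ l ∈ Finset.range N, (if l = 0 then 1 else 2) * ∑ k ∈ Finset.range (N - l), H k (k + l) := by
  induction N with
  | zero => simp
  | succ N ih =>
    have h1 : ∑ a ∈ Finset.range (N + 1), ∑ b ∈ Finset.range (N + 1), H a b =
        ∑ a ∈ Finset.range N, ∑ b ∈ Finset.range N, H a b
          + (2 * ∑ a ∈ Finset.range N, H a N + H N N) := by
      simp only [Finset.sum_range_succ, Finset.sum_add_distrib]
      rw [Finset.sum_congr rfl fun b _ => hH N b]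
      ring
    have h2 : ∑ l ∈ Finset.range (N + 1), (if l = 0 then (1 : M) else 2) * H (N - l) N =
        2 * ∑ a ∈ Finset.range N, H a N + H N N := by
      rw [Finset.sum_range_succ']
      simp only [Nat.add_eq_zero_iff, one_ne_zero, and_false, if_false, if_true, Nat.sub_zero,
        one_mul, ← Finset.mul_sum]
      rw [← Finset.sum_range_reflect]
      congr 2
      refine Finset.sum_congr rfl fun a ha => ?_
      rw [Finset.mem_range] at ha
      congr 1
      omega
    rw [h1, ih, ← h2]
    have h3 : ∑ l ∈ Finset.range N, (if l = 0 then (1 : M) else 2) *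
          ∑ k ∈ Finset.range (N - l), H k (k + l) =
        ∑ l ∈ Finset.range (N + 1), (if l = 0 then (1 : M) else 2) *
          ∑ k ∈ Finset.range (N - l), H k (k + l) := by
      simp [Finset.sum_range_succ]
    rw [h3, ← Finset.sum_add_distrib]
    refine Finset.sum_congr rfl fun l hl => ?_
    rw [Finset.mem_range] at hl
    rw [← mul_add, show N + 1 - l = (N - l) + 1 by omega, Finset.sum_range_succ,
      show N - l + l = N by omega]

/-- After regrouping by lag, each lag contributes a Cesàro mean times `(N - l)/N → 1`, and `u`
dominates the series over lags. The two orders of a pair at positive lag produce the factor `2`. -/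
theorem tendsto_cesaro_double {H : ℕ → ℕ → ℂ} (hH : ∀ a b, H a b = H b a) {u : ℕ → ℝ} {g : ℕ → ℂ}
    (hu : Summable u) (hb : ∀ k l, ‖H k (k + l)‖ ≤ u l)
    (hl : ∀ l, Tendsto (fun k => H k (k + l)) atTop (𝓝 (g l))) :
    Tendsto (fun N : ℕ => (N : ℂ)⁻¹ * ∑ a ∈ Finset.range N, ∑ b ∈ Finset.range N, H a b) atTop
      (𝓝 (∑' l, (if l = 0 then 1 else 2) * g l)) := by
  have h0 : ∀ N : ℕ, (N : ℂ)⁻¹ * ∑ a ∈ Finset.range N, ∑ b ∈ Finset.range N, H a b =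
      ∑' l, if l < N then (if l = 0 then 1 else 2) *
        ((N : ℂ)⁻¹ * ∑ k ∈ Finset.range (N - l), H k (k + l)) else 0 := by
    intro N
    rw [tsum_eq_sum (s := Finset.range N) (by simp +contextual), sum_range_symm H hH,
      Finset.mul_sum]
    refine Finset.sum_congr rfl fun l hl => ?_
    rw [if_pos (Finset.mem_range.1 hl)]
    ring
  simp_rw [h0]
  have hu0 : ∀ l, 0 ≤ u l := fun l => (norm_nonneg _).trans (hb 0 l)
  refine tendsto_tsum_of_dominated_convergence (bound := fun l => 2 * u l) (hu.mul_left 2) ?_ ?_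
  · intro l
    have h1 : Tendsto (fun N : ℕ => ((N - l : ℕ) : ℝ)⁻¹ •
        ∑ k ∈ Finset.range (N - l), H k (k + l)) atTop (𝓝 (g l)) :=
      (hl l).cesaro_smul.comp (tendsto_sub_atTop_nat l)
    have h2 : Tendsto (fun N : ℕ => ((N - l : ℕ) : ℝ) / N) atTop (𝓝 1) := by
      have h3 : Tendsto (fun N : ℕ => 1 - (l : ℝ) / N) atTop (𝓝 (1 - 0)) :=
        tendsto_const_nhds.sub (tendsto_const_div_atTop_nhds_zero_nat _)
      rw [sub_zero] at h3
      refine h3.congr' ?_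
      filter_upwards [eventually_ge_atTop l, eventually_gt_atTop 0] with N h4 h5
      rw [Nat.cast_sub h4]
      have : (N : ℝ) ≠ 0 := by positivity
      field_simp
    have h4 := (h2.smul h1).const_mul (if l = 0 then (1 : ℂ) else 2)
    rw [one_smul] at h4
    refine h4.congr' ?_
    filter_upwards [eventually_gt_atTop l] with N h5
    rw [if_pos h5, smul_smul]
    have h6 : ((N - l : ℕ) : ℝ) ≠ 0 := by
      rw [Nat.cast_ne_zero]; omega
    rw [div_mul_eq_mul_div, mul_inv_cancel₀ h6, Complex.real_smul]
    push_cast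
    ring
  · refine Eventually.of_forall fun N l => ?_
    by_cases h1 : l < N
    · rw [if_pos h1, norm_mul]
      refine mul_le_mul (by split_ifs <;> simp) ?_ (norm_nonneg _) (by norm_num)
      rw [norm_mul, norm_inv, Complex.norm_natCast]
      have h2 : ‖∑ k ∈ Finset.range (N - l), H k (k + l)‖ ≤ N * u l := by
        refine (norm_sum_le_of_le _ fun k _ => hb k l).trans ?_
        rw [Finset.sum_const, Finset.card_range, nsmul_eq_mul]
        exact mul_le_mul_of_nonneg_right (by exact_mod_cast Nat.sub_le N l) (hu0 l)
      have h3 : (0 : ℝ) < N := by exact_mod_cast (by omega : 0 < N)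
      rw [inv_mul_le_iff₀ h3]
      exact h2
    · rw [if_neg h1]
      simpa using hu0 l

/-- A Schur-type bound: in each row, the indices on either side of the diagonal have distinct lags,
so each half of the row is at most `∑ u`. -/
theorem sum_sum_le_card_mul_tsum {u : ℕ → ℝ} (hu : Summable u) (hu0 : ∀ l, 0 ≤ u l)
    {v : ℕ → ℕ → ℝ} (hv : ∀ k l, v k (k + l) ≤ u l) (hv' : ∀ k l, v (k + l) k ≤ u l)
    (E : Finset ℕ) : ∑ a ∈ E, ∑ b ∈ E, v a b ≤ 2 * (∑' l, u l) * E.card := by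
  have h1 : ∀ a ∈ E, ∑ b ∈ E, v a b ≤ 2 * ∑' l, u l := by
    intro a _
    rw [← Finset.sum_filter_add_sum_filter_not E (fun b => a ≤ b), two_mul]
    have key : ∀ (s : Finset ℕ) (φ : ℕ → ℕ), Set.InjOn φ s → (∀ b ∈ s, v a b ≤ u (φ b)) →
        ∑ b ∈ s, v a b ≤ ∑' l, u l := by
      intro s φ h2 h3
      refine (Finset.sum_le_sum h3).trans ?_
      rw [← Finset.sum_image (f := u) h2]
      exact hu.sum_le_tsum _ fun l _ => hu0 l
    refine add_le_add (key _ (fun b => b - a) ?_ ?_) (key _ (fun b => a - b) ?_ ?_)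
    · intro b hb c hc h
      simp only [Finset.coe_filter, Set.mem_ofPred_eq] at hb hc h
      omega
    · intro b hb
      have := hv a (b - a)
      rwa [Nat.add_sub_of_le (Finset.mem_filter.1 hb).2] at this
    · intro b hb c hc h
      simp only [Finset.coe_filter, Set.mem_ofPred_eq] at hb hc h
      omega
    · intro b hb
      have := hv' b (a - b)
      rwa [Nat.add_sub_of_le (by have := (Finset.mem_filter.1 hb).2; omega)] at this
  calc _ ≤ ∑ a ∈ E, 2 * ∑' l, u l := Finset.sum_le_sum h1
    _ = _ := by simp; ring

/-! ### Comparison of `e^{iy}` with `(1 + iy) e^{-y²/2}` -/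

theorem norm_prod_sub_prod_le {ι : Type*} (s : Finset ι) {a b : ι → ℂ}
    (ha : ∀ i ∈ s, ‖a i‖ ≤ 1) (hb : ∀ i ∈ s, ‖b i‖ ≤ 1) :
    ‖∏ i ∈ s, a i - ∏ i ∈ s, b i‖ ≤ ∑ i ∈ s, ‖a i - b i‖ := by
  classical
  induction s using Finset.induction_on with
  | empty => simp
  | insert i s hi ih =>
    rw [Finset.prod_insert hi, Finset.prod_insert hi, Finset.sum_insert hi]
    have h1 : a i * ∏ j ∈ s, a j - b i * ∏ j ∈ s, b j =
        (a i - b i) * ∏ j ∈ s, a j + b i * (∏ j ∈ s, a j - ∏ j ∈ s, b j) := by ring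
    rw [h1]
    refine (norm_add_le _ _).trans (add_le_add ?_ ?_)
    · rw [norm_mul, norm_prod]
      exact mul_le_of_le_one_right (norm_nonneg _) (Finset.prod_le_one (fun _ _ => norm_nonneg _)
        fun j hj => ha j (Finset.mem_insert_of_mem hj))
    · rw [norm_mul]
      refine (mul_le_of_le_one_left (norm_nonneg _) (hb i (Finset.mem_insert_self _ _))).trans ?_
      exact ih (fun j hj => ha j (Finset.mem_insert_of_mem hj))
        (fun j hj => hb j (Finset.mem_insert_of_mem hj))

theorem norm_one_add_mul_I_sq (y : ℝ) : ‖1 + (y : ℂ) * Complex.I‖ ^ 2 = 1 + y ^ 2 := by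
  rw [← Complex.normSq_eq_norm_sq, Complex.normSq_apply]
  simp
  ring

/-- Follows from `1 + y² ≤ e^{y²}`. It puts `(1 + iy) e^{-y²/2}` in the unit disc, as
`norm_prod_sub_prod_le` requires. -/
theorem norm_one_add_mul_I_le (y : ℝ) : ‖1 + (y : ℂ) * Complex.I‖ ≤ Real.exp (y ^ 2 / 2) := by
  refine le_of_sq_le_sq ?_ (Real.exp_pos _).le
  rw [norm_one_add_mul_I_sq, ← Real.exp_nat_mul]
  have := Real.add_one_le_exp (y ^ 2)
  rw [show ((2 : ℕ) : ℝ) * (y ^ 2 / 2) = y ^ 2 by push_cast; ring]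
  linarith

theorem norm_exp_sub_le {y : ℝ} (hy : |y| ≤ 1) :
    ‖Complex.exp (y * Complex.I) - (1 + y * Complex.I) * Real.exp (-(y ^ 2 / 2))‖ ≤ 3 * |y| ^ 3 := by
  have h1 : ‖Complex.exp (y * Complex.I) - (1 + y * Complex.I - y ^ 2 / 2)‖ ≤ |y| ^ 3 := by
    have := Complex.exp_bound (x := y * Complex.I) (by simpa using hy) (n := 3) (by norm_num)
    simp only [Finset.sum_range_succ, Finset.sum_range_zero] at this
    have h2 : (y * Complex.I) ^ 2 = -(y : ℂ) ^ 2 := by rw [mul_pow, Complex.I_sq]; ring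
    have h3 : ‖(y : ℂ) * Complex.I‖ = |y| := by simp
    rw [h3] at this
    norm_num [h2, Nat.factorial] at this
    calc _ = ‖Complex.exp (y * Complex.I) - (1 + y * Complex.I + -(y : ℂ) ^ 2 / 2)‖ := by
          congr 1; ring
      _ ≤ _ := this
      _ ≤ _ := by nlinarith [pow_nonneg (abs_nonneg y) 3]
  have h2 : |Real.exp (-(y ^ 2 / 2)) - (1 - y ^ 2 / 2)| ≤ |y| ^ 3 / 2 := by
    have hy2 : y ^ 2 ≤ 1 := by rw [← sq_abs]; exact pow_le_one₀ (abs_nonneg _) hy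
    have := Real.abs_exp_sub_one_sub_id_le (x := -(y ^ 2 / 2))
      (by rw [abs_neg, abs_of_nonneg (by positivity)]; linarith)
    have h3 : (-(y ^ 2 / 2)) ^ 2 ≤ |y| ^ 3 / 2 := by
      have h4 : (-(y ^ 2 / 2)) ^ 2 = |y| ^ 4 / 4 := by
        rw [show |y| ^ 4 = (|y| ^ 2) ^ 2 by ring, sq_abs]; ring
      have h5 : |y| ^ 4 ≤ |y| ^ 3 := pow_le_pow_of_le_one (abs_nonneg _) hy (by norm_num)
      have := pow_nonneg (abs_nonneg y) 3
      rw [h4]; linarith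
    refine le_trans (le_of_eq ?_) (this.trans h3)
    congr 1; ring
  have h4 : ‖1 + (y : ℂ) * Complex.I‖ ≤ 2 := by
    refine (norm_add_le _ _).trans ?_
    simp only [norm_one, norm_mul, Complex.norm_real, Complex.norm_I, mul_one, Real.norm_eq_abs]
    linarith
  -- Both exponentials are replaced by their Taylor polynomials; `(1 + iy)(1 - y²/2)` misses `1 + iy
  -- - y²/2` by `i y³/2`. The three errors add up to `5/2 · |y|³`.
  have h5 : Complex.exp (y * Complex.I) - (1 + y * Complex.I) * Real.exp (-(y ^ 2 / 2)) =
      (Complex.exp (y * Complex.I) - (1 + y * Complex.I - y ^ 2 / 2)) -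
      (1 + y * Complex.I) * ((Real.exp (-(y ^ 2 / 2)) - (1 - y ^ 2 / 2) : ℝ) : ℂ) +
      ((y ^ 3 / 2 : ℝ) : ℂ) * Complex.I := by
    push_cast; ring
  rw [h5]
  have h6 : ‖(1 + (y : ℂ) * Complex.I) * ((Real.exp (-(y ^ 2 / 2)) - (1 - y ^ 2 / 2) : ℝ) : ℂ)‖
      ≤ 2 * (|y| ^ 3 / 2) := by
    rw [norm_mul, Complex.norm_real]
    exact mul_le_mul h4 h2 (norm_nonneg _) (by norm_num)
  have h7 : ‖((y ^ 3 / 2 : ℝ) : ℂ) * Complex.I‖ = |y| ^ 3 / 2 := by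
    rw [norm_mul, Complex.norm_I, mul_one, Complex.norm_real, Real.norm_eq_abs, abs_div, abs_pow]
    norm_num
  refine (norm_add_le _ _).trans ?_
  have := norm_sub_le (Complex.exp (y * Complex.I) - (1 + y * Complex.I - y ^ 2 / 2))
    ((1 + y * Complex.I) * ((Real.exp (-(y ^ 2 / 2)) - (1 - y ^ 2 / 2) : ℝ) : ℂ))
  have := pow_nonneg (abs_nonneg y) 3
  linarith

theorem abs_exp_neg_sub_exp_neg_le {u v : ℝ} (hu : 0 ≤ u) (hv : 0 ≤ v) :
    |Real.exp (-u) - Real.exp (-v)| ≤ |u - v| := by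
  wlog h : u ≤ v generalizing u v
  · rw [abs_sub_comm, abs_sub_comm u]; exact this hv hu (le_of_not_ge h)
  rw [abs_of_nonneg (by simpa using h), abs_of_nonpos (by linarith)]
  have h1 := Real.add_one_le_exp (u - v)
  have h2 : Real.exp (-v) = Real.exp (-u) * Real.exp (u - v) := by rw [← Real.exp_add]; congr 1; ring
  have h3 : Real.exp (-u) ≤ 1 := by simpa using hu
  rw [h2]
  nlinarith [Real.exp_pos (-u), Real.exp_pos (u-v)]

/-! ### A central limit theorem from exact product integrals -/

theorem integral_norm_le_sqrt_mul_sqrt {Ω : Type*} [MeasurableSpace Ω] {μ : Measure Ω}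
    [IsFiniteMeasure μ] {E : Type*} [NormedAddCommGroup E] {G : Ω → E} (hG : MemLp G 2 μ) :
    ∫ x, ‖G x‖ ∂μ ≤ √(μ.real Set.univ) * √(∫ x, ‖G x‖ ^ 2 ∂μ) := by
  have h := integral_mul_le_Lp_mul_Lq_of_nonneg (μ := μ) (p := 2) (q := 2)
    Real.HolderConjugate.two_two (f := fun _ => (1 : ℝ)) (g := fun x => ‖G x‖)
    (ae_of_all _ fun _ => zero_le_one) (ae_of_all _ fun _ => norm_nonneg _)
    (memLp_const _) (by simpa using hG.norm)
  simpa [Real.sqrt_eq_rpow] using h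

/-- No independence is needed. Factor by factor, `e^{is∑Y_j}` is close to `∏ (1 + isY_j)` times
`e^{-s²∑Y_j²/2}`, and `hlln` allows `∑ Y_j²` to be replaced by `J c`. What remains is a product of
known integral `I0` times a constant. As `s² J` stays bounded, the errors are of order `|s|`. -/
theorem tendsto_integral_exp_sum {Ω : Type*} [MeasurableSpace Ω] {μ : Measure Ω}
    [IsFiniteMeasure μ] {Y : ℕ → Ω → ℝ} (hYm : ∀ j, Measurable (Y j)) {B : ℝ}
    (hB : ∀ j x, |Y j x| ≤ B) {e : Ω → ℂ} (hem : Measurable e) (he : ∀ x, ‖e x‖ ≤ 1) {I0 : ℂ}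
    (hprod : ∀ (J : ℕ) (s : ℝ),
      ∫ x, e x * ∏ j ∈ Finset.range J, (1 + ((s * Y j x : ℝ) : ℂ) * Complex.I) ∂μ = I0)
    {c C : ℝ} (hc : 0 ≤ c)
    (hlln : ∀ J : ℕ, ∫ x, (∑ j ∈ Finset.range J, (Y j x ^ 2 - c)) ^ 2 ∂μ ≤ C * J)
    {s : ℕ → ℝ} {J : ℕ → ℕ} {κ : ℝ} (hs : Tendsto s atTop (𝓝 0))
    (hκ : Tendsto (fun N => s N ^ 2 * J N) atTop (𝓝 κ)) :
    Tendsto (fun N => ∫ x, e x *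
        Complex.exp (((s N * ∑ j ∈ Finset.range (J N), Y j x : ℝ) : ℂ) * Complex.I) ∂μ) atTop
      (𝓝 (I0 * (Real.exp (-(κ * c / 2)) : ℝ))) := by
  -- A point of `Ω` is needed only to deduce `0 ≤ B`; on an empty space all integrals vanish.
  rcases isEmpty_or_nonempty Ω with hΩ | ⟨⟨x0⟩⟩
  · have : I0 = 0 := by rw [← hprod 0 0]; simp [Measure.eq_zero_of_isEmpty μ]
    simp [Measure.eq_zero_of_isEmpty μ, this]
  have hB0 : 0 ≤ B := (abs_nonneg _).trans (hB 0 x0)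
  set W := μ.real Set.univ
  have hC : 0 ≤ C := by
    have := hlln 1
    refine le_trans (integral_nonneg fun x => sq_nonneg _) (by simpa using this)
  set T : ℕ → Ω → ℂ := fun N x =>
    ∏ j ∈ Finset.range (J N), (1 + ((s N * Y j x : ℝ) : ℂ) * Complex.I) with hT
  have hTm : ∀ N, Measurable (T N) := fun N => by
    refine Finset.measurable_fun_prod _ fun j _ => ?_
    have := hYm j
    fun_prop
  have hTb : ∀ N x, ‖T N x‖ ≤ Real.exp (∑ j ∈ Finset.range (J N), (s N * Y j x) ^ 2 / 2) := by
    intro N x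
    rw [hT, Real.exp_sum]
    simp only [norm_prod]
    exact Finset.prod_le_prod (fun _ _ => norm_nonneg _) fun j _ => norm_one_add_mul_I_le _
  -- The products stay bounded because `s² J` converges and the `Y_j` are uniformly bounded.
  have hsq : ∀ N x, ∑ j ∈ Finset.range (J N), (s N * Y j x) ^ 2 / 2 ≤ s N ^ 2 * J N * B ^ 2 / 2 := by
    intro N x
    have : ∀ j ∈ Finset.range (J N), (s N * Y j x) ^ 2 / 2 ≤ s N ^ 2 * B ^ 2 / 2 := by
      intro j _
      rw [mul_pow]
      have : Y j x ^ 2 ≤ B ^ 2 := by rw [← sq_abs (Y j x)]; gcongr; exact hB j x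
      gcongr
    refine (Finset.sum_le_sum this).trans (le_of_eq ?_)
    simp; ring
  have hTb' : ∀ N x, ‖T N x‖ ≤ Real.exp (s N ^ 2 * J N * B ^ 2 / 2) := fun N x =>
    (hTb N x).trans (Real.exp_le_exp.2 (hsq N x))
  -- comparison with the exact product
  have hcomp : ∀ᶠ N in atTop, ‖(∫ x, e x *
        Complex.exp (((s N * ∑ j ∈ Finset.range (J N), Y j x : ℝ) : ℂ) * Complex.I) ∂μ)
        - I0 * (Real.exp (-(s N ^ 2 * J N * c / 2)) : ℝ)‖ ≤
      W * (3 * B ^ 3 * (s N ^ 2 * J N) * |s N|) +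
        Real.exp (s N ^ 2 * J N * B ^ 2 / 2) / 2 * (√W * (√C * (|s N| * √(s N ^ 2 * J N)))) := by
    have h1 : ∀ᶠ N in atTop, |s N| * B ≤ 1 := by
      have : Tendsto (fun N => |s N| * B) atTop (𝓝 (|0| * B)) := hs.abs.mul_const B
      rw [abs_zero, zero_mul] at this
      exact this.eventually (eventually_le_nhds zero_lt_one)
    filter_upwards [h1] with N hN
    set G : Ω → ℝ := fun x => ∑ j ∈ Finset.range (J N), (Y j x ^ 2 - c) with hG
    have hGm : Measurable G := by
      refine Finset.measurable_fun_sum _ fun j _ => ?_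
      have := hYm j
      fun_prop
    have hGb : ∀ x, ‖G x‖ ≤ J N * (B ^ 2 + c) := by
      intro x
      refine (norm_sum_le_of_le (n := fun _ => B ^ 2 + c) _ fun j _ => ?_).trans (by simp [mul_add])
      refine (norm_sub_le _ _).trans ?_
      rw [Real.norm_of_nonneg (sq_nonneg _), Real.norm_of_nonneg hc, ← sq_abs (Y j x)]
      gcongr
      exact hB j x
    have hpt : ∀ x, ‖Complex.exp (((s N * ∑ j ∈ Finset.range (J N), Y j x : ℝ) : ℂ) * Complex.I)
        - T N x * (Real.exp (-(s N ^ 2 * J N * c / 2)) : ℝ)‖ ≤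
        3 * B ^ 3 * (s N ^ 2 * J N) * |s N| +
        Real.exp (s N ^ 2 * J N * B ^ 2 / 2) / 2 * (s N ^ 2 * ‖G x‖) := by
      intro x
      have h2 : Complex.exp (((s N * ∑ j ∈ Finset.range (J N), Y j x : ℝ) : ℂ) * Complex.I) =
          ∏ j ∈ Finset.range (J N), Complex.exp (((s N * Y j x : ℝ) : ℂ) * Complex.I) := by
        rw [← Complex.exp_sum]
        congr 1
        push_cast
        rw [Finset.mul_sum, Finset.sum_mul]
      set b : ℕ → ℂ := fun j => (1 + ((s N * Y j x : ℝ) : ℂ) * Complex.I) *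
        Real.exp (-((s N * Y j x) ^ 2 / 2))
      have hb : ∏ j ∈ Finset.range (J N), b j =
          T N x * (Real.exp (-∑ j ∈ Finset.range (J N), (s N * Y j x) ^ 2 / 2) : ℝ) := by
        simp only [b, Finset.prod_mul_distrib, hT]
        rw [← Finset.sum_neg_distrib, Real.exp_sum]
        push_cast
        rfl
      have h3 : ‖∏ j ∈ Finset.range (J N), Complex.exp (((s N * Y j x : ℝ) : ℂ) * Complex.I)
          - ∏ j ∈ Finset.range (J N), b j‖ ≤ 3 * B ^ 3 * (s N ^ 2 * J N) * |s N| := by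
        refine (norm_prod_sub_prod_le _ (fun j _ => ?_) (fun j _ => ?_)).trans ?_
        · rw [Complex.norm_exp_ofReal_mul_I]
        · rw [norm_mul, Complex.norm_real, Real.norm_of_nonneg (Real.exp_pos _).le]
          calc _ ≤ Real.exp ((s N * Y j x) ^ 2 / 2) * Real.exp (-((s N * Y j x) ^ 2 / 2)) := by
                gcongr; exact norm_one_add_mul_I_le _
            _ = 1 := by rw [← Real.exp_add]; simp
        · have h4 : ∀ j ∈ Finset.range (J N),
              ‖Complex.exp (((s N * Y j x : ℝ) : ℂ) * Complex.I) - b j‖ ≤ 3 * (|s N| * B) ^ 3 := by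
            intro j _
            have h5 : |s N * Y j x| ≤ |s N| * B := by
              rw [abs_mul]; gcongr; exact hB j x
            refine (norm_exp_sub_le (h5.trans hN)).trans ?_
            gcongr
          refine (Finset.sum_le_sum h4).trans (le_of_eq ?_)
          rw [Finset.sum_const, Finset.card_range, nsmul_eq_mul, ← sq_abs (s N)]
          ring
      have h6 : ‖T N x * (Real.exp (-∑ j ∈ Finset.range (J N), (s N * Y j x) ^ 2 / 2) : ℝ)
          - T N x * (Real.exp (-(s N ^ 2 * J N * c / 2)) : ℝ)‖ ≤
          Real.exp (s N ^ 2 * J N * B ^ 2 / 2) / 2 * (s N ^ 2 * ‖G x‖) := by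
        rw [← mul_sub, norm_mul, ← Complex.ofReal_sub, Complex.norm_real, Real.norm_eq_abs]
        have h7 := abs_exp_neg_sub_exp_neg_le
          (u := ∑ j ∈ Finset.range (J N), (s N * Y j x) ^ 2 / 2) (v := s N ^ 2 * J N * c / 2)
          (Finset.sum_nonneg fun _ _ => by positivity) (by positivity)
        have h8 : ∑ j ∈ Finset.range (J N), (s N * Y j x) ^ 2 / 2 - s N ^ 2 * J N * c / 2 =
            s N ^ 2 / 2 * G x := by
          rw [hG]
          simp only [Finset.sum_sub_distrib, Finset.sum_const, Finset.card_range, nsmul_eq_mul,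
            mul_sub, Finset.mul_sum]
          congr 1
          · exact Finset.sum_congr rfl fun j _ => by ring
          · ring
        rw [h8, abs_mul, abs_of_nonneg (by positivity : 0 ≤ s N ^ 2 / 2)] at h7
        refine (mul_le_mul (hTb' N x) h7 (abs_nonneg _) (Real.exp_pos _).le).trans (le_of_eq ?_)
        rw [Real.norm_eq_abs]
        ring
      rw [h2]
      rw [hb] at h3
      have := norm_add_le _ _ |>.trans (add_le_add h3 h6)
      rwa [sub_add_sub_cancel] at this
    have hi1 : Integrable (fun x => e x *
        Complex.exp (((s N * ∑ j ∈ Finset.range (J N), Y j x : ℝ) : ℂ) * Complex.I)) μ := by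
      refine Integrable.of_bound (C := 1) ?_ (ae_of_all _ fun x => ?_)
      · have : Measurable fun x => ∑ j ∈ Finset.range (J N), Y j x :=
          Finset.measurable_fun_sum _ fun j _ => hYm j
        fun_prop
      · rw [norm_mul, Complex.norm_exp_ofReal_mul_I, mul_one]; exact he x
    have hi2 : Integrable (fun x => e x * T N x) μ := by
      refine Integrable.of_bound (C := Real.exp (s N ^ 2 * J N * B ^ 2 / 2))
        (hem.mul (hTm N)).aestronglyMeasurable (ae_of_all _ fun x => ?_)
      rw [norm_mul]
      exact (mul_le_of_le_one_left (norm_nonneg _) (he x)).trans (hTb' N x)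
    have hGL : MemLp G 2 μ := MemLp.of_bound hGm.aestronglyMeasurable _ (ae_of_all _ hGb)
    have hGi : Integrable (fun x => ‖G x‖) μ := (hGL.integrable (by norm_num)).norm
    rw [← hprod (J N) (s N), ← integral_mul_const, ← integral_sub hi1 (hi2.mul_const _)]
    refine (norm_integral_le_of_norm_le (g := fun x => 3 * B ^ 3 * (s N ^ 2 * J N) * |s N| +
        Real.exp (s N ^ 2 * J N * B ^ 2 / 2) / 2 * (s N ^ 2 * ‖G x‖)) ?_
        (ae_of_all _ fun x => ?_)).trans ?_
    · exact (integrable_const _).add ((hGi.const_mul _).const_mul _)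
    · rw [mul_assoc, ← mul_sub, norm_mul]
      exact (mul_le_of_le_one_left (norm_nonneg _) (he x)).trans (hpt x)
    · rw [integral_add (integrable_const _) ((hGi.const_mul _).const_mul _), integral_const,
        integral_const_mul, integral_const_mul, smul_eq_mul]
      -- Cauchy–Schwarz turns the variance bound `C J` into `√J`, so one factor `|s|` is left over
      -- after `√(s² J)` is formed.
      have h9 : s N ^ 2 * ∫ x, ‖G x‖ ∂μ ≤ √W * (√C * (|s N| * √(s N ^ 2 * J N))) := by
        have h10 := integral_norm_le_sqrt_mul_sqrt hGL
        have h11 : √(∫ x, ‖G x‖ ^ 2 ∂μ) ≤ √C * √(J N) := by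
          rw [← Real.sqrt_mul hC]
          refine Real.sqrt_le_sqrt ?_
          simp only [Real.norm_eq_abs, sq_abs]
          exact hlln _
        have h12 : √(s N ^ 2 * J N) = |s N| * √(J N) := by
          rw [Real.sqrt_mul (sq_nonneg _), Real.sqrt_sq_eq_abs]
        rw [h12, ← sq_abs (s N)]
        calc |s N| ^ 2 * ∫ x, ‖G x‖ ∂μ ≤ |s N| ^ 2 * (√W * (√C * √(J N))) := by
              gcongr
              exact h10.trans (mul_le_mul_of_nonneg_left h11 (Real.sqrt_nonneg _))
          _ = _ := by ring
      gcongr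
  have hlim : Tendsto (fun N => W * (3 * B ^ 3 * (s N ^ 2 * J N) * |s N|) +
        Real.exp (s N ^ 2 * J N * B ^ 2 / 2) / 2 * (√W * (√C * (|s N| * √(s N ^ 2 * J N)))))
      atTop (𝓝 0) := by
    have h1 : Tendsto (fun N => W * (3 * B ^ 3 * (s N ^ 2 * J N) * |s N|)) atTop
        (𝓝 (W * (3 * B ^ 3 * κ * |0|))) := ((hκ.const_mul _).mul hs.abs).const_mul _
    have h2 : Tendsto (fun N => Real.exp (s N ^ 2 * J N * B ^ 2 / 2) / 2 *
        (√W * (√C * (|s N| * √(s N ^ 2 * J N))))) atTop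
        (𝓝 (Real.exp (κ * B ^ 2 / 2) / 2 * (√W * (√C * (|0| * √κ))))) := by
      refine Tendsto.mul ?_ (((hs.abs.mul ((Real.continuous_sqrt.tendsto _).comp hκ)).const_mul
        _).const_mul _)
      exact ((Real.continuous_exp.tendsto _).comp ((hκ.mul_const _).div_const _)).div_const _
    simpa using h1.add h2
  have hmain : Tendsto (fun N => I0 * ((Real.exp (-(s N ^ 2 * J N * c / 2)) : ℝ) : ℂ)) atTop
      (𝓝 (I0 * (Real.exp (-(κ * c / 2)) : ℝ))) := by
    refine Tendsto.const_mul _ ((Complex.continuous_ofReal.tendsto _).comp ?_)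
    exact (Real.continuous_exp.tendsto _).comp ((hκ.mul_const _).div_const _).neg
  have := (squeeze_zero_norm' hcomp hlim).add hmain
  simpa using this

/-! ### Exponentials with real frequencies -/

/-- The exponential `x ↦ exp(2π√-1 ηx)` with a real frequency. -/
noncomputable def expo {d : ℕ} (η x : Fin d → ℝ) : ℂ :=
  Complex.exp (2 * Real.pi * Complex.I * ((η ⬝ᵥ x : ℝ) : ℂ))

theorem expo_eq {d : ℕ} (η x : Fin d → ℝ) :
    expo η x = Complex.exp (((2 * Real.pi * (η ⬝ᵥ x) : ℝ) : ℂ) * Complex.I) := by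
  rw [expo]; congr 1; push_cast; ring

theorem norm_expo {d : ℕ} (η x : Fin d → ℝ) : ‖expo η x‖ = 1 := by
  rw [expo_eq, Complex.norm_exp_ofReal_mul_I]

theorem continuous_expo {d : ℕ} (η : Fin d → ℝ) : Continuous (expo η) := by
  unfold expo
  have : Continuous fun x : Fin d → ℝ => η ⬝ᵥ x := by unfold dotProduct; fun_prop
  fun_prop

theorem expo_add {d : ℕ} (η η' x : Fin d → ℝ) : expo (η + η') x = expo η x * expo η' x := by
  rw [expo, expo, expo, ← Complex.exp_add, add_dotProduct]; congr 1; push_cast; ring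

theorem expo_zero {d : ℕ} (x : Fin d → ℝ) : expo 0 x = 1 := by simp [expo]

theorem expo_neg {d : ℕ} (η x : Fin d → ℝ) : expo (-η) x = (starRingEnd ℂ) (expo η x) := by
  rw [expo_eq, expo_eq, ← Complex.exp_conj]
  simp [Complex.conj_ofNat]

theorem expo_mulVec {d : ℕ} (η x : Fin d → ℝ) (M : Matrix (Fin d) (Fin d) ℝ) :
    expo η (M *ᵥ x) = expo (η ᵥ* M) x := by
  rw [expo, expo, Matrix.dotProduct_mulVec]

/-! ### Mixing convergence and change of measure -/

/-- The hypothesis says that the characteristic function of the joint law of `(x, X N x)` tends to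
that of `μ ⊗ N(0, v)`. Lévy's continuity theorem in dimension `d + 1` gives weak convergence, which
is tested on `φ ⊗ g`. -/
theorem tendsto_integral_mul_of_charFun_bcf {d : ℕ} {μ : Measure (Fin d → ℝ)}
    [IsProbabilityMeasure μ]
    {X : ℕ → (Fin d → ℝ) → ℝ} (hX : ∀ N, Measurable (X N)) {v : ℝ≥0}
    (h : ∀ (ζ : Fin d → ℝ) (t : ℝ), Tendsto (fun N => ∫ x, expo ζ x *
      Complex.exp (((t * X N x : ℝ) : ℂ) * Complex.I) ∂μ) atTop
      (𝓝 ((∫ x, expo ζ x ∂μ) * (Real.exp (-(v * t ^ 2 / 2)) : ℝ))))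
    (φ : BoundedContinuousFunction (Fin d → ℝ) ℝ) (g : BoundedContinuousFunction ℝ ℝ) :
    Tendsto (fun N => ∫ x, φ x * g (X N x) ∂μ) atTop
      (𝓝 ((∫ x, φ x ∂μ) * ∫ z, g z ∂(gaussianReal 0 v))) := by
  -- Coordinate `0` carries the value of `X N`, the others carry `x`. The factor `(2π)⁻¹` below
  -- reconciles `expo` with the convention of `charFun`.
  let j : (Fin d → ℝ) × ℝ → EuclideanSpace ℝ (Fin (d + 1)) := fun p => WithLp.toLp 2 (Fin.cons p.2 p.1 : Fin (d + 1) → ℝ)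
  have hj : Measurable j := by
    refine (WithLp.measurable_toLp 2 _).comp (measurable_pi_lambda _ fun i => ?_)
    refine Fin.cases ?_ (fun i => ?_) i
    · simpa using measurable_snd
    · simp only [Fin.cons_succ]
      fun_prop
  have hΦ : ∀ N, Measurable fun x => j (x, X N x) := fun N =>
    hj.comp (measurable_id.prodMk (hX N))
  let P : ℕ → ProbabilityMeasure (EuclideanSpace ℝ (Fin (d + 1))) := fun N =>
    ⟨μ.map fun x => j (x, X N x), Measure.isProbabilityMeasure_map (hΦ N).aemeasurable⟩
  let P0 : ProbabilityMeasure (EuclideanSpace ℝ (Fin (d + 1))) :=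
    ⟨(μ.prod (gaussianReal 0 v)).map j, Measure.isProbabilityMeasure_map hj.aemeasurable⟩
  have hexp : ∀ (y : EuclideanSpace ℝ (Fin (d + 1))) (x : Fin d → ℝ) (z : ℝ),
      Complex.exp ((inner ℝ (j (x, z)) y : ℝ) * Complex.I) =
      expo (fun i => (2 * Real.pi)⁻¹ * y i.succ) x *
        Complex.exp (((y 0 * z : ℝ) : ℂ) * Complex.I) := by
    intro y x z
    rw [expo_eq, ← Complex.exp_add, ← add_mul, ← Complex.ofReal_add]
    congr 3
    simp only [PiLp.inner_apply, Fin.sum_univ_succ, j, Fin.cons_zero, Fin.cons_succ,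
      RCLike.inner_apply, conj_trivial, dotProduct]
    rw [Finset.mul_sum, add_comm]
    congr 1
    refine Finset.sum_congr rfl fun i _ => ?_
    have := Real.pi_ne_zero
    field_simp
  have hlim : Tendsto P atTop (𝓝 P0) := by
    refine ProbabilityMeasure.tendsto_of_tendsto_charFun fun y => ?_
    have h1 : ∀ N, charFun (P N : Measure (EuclideanSpace ℝ (Fin (d + 1)))) y =
        ∫ x, expo (fun i => (2 * Real.pi)⁻¹ * y i.succ) x *
        Complex.exp (((y 0 * X N x : ℝ) : ℂ) * Complex.I) ∂μ := by
      intro N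
      rw [charFun_apply]
      change ∫ x, _ ∂(μ.map fun x => j (x, X N x)) = _
      rw [integral_map (hΦ N).aemeasurable (by fun_prop)]
      simp only [hexp]
    have h2 : charFun (P0 : Measure (EuclideanSpace ℝ (Fin (d + 1)))) y =
        (∫ x, expo (fun i => (2 * Real.pi)⁻¹ * y i.succ) x ∂μ) *
          (Real.exp (-(v * y 0 ^ 2 / 2)) : ℝ) := by
      rw [charFun_apply]
      change ∫ x, _ ∂((μ.prod (gaussianReal 0 v)).map j) = _
      rw [integral_map hj.aemeasurable (by fun_prop)]
      have h3 : ∀ p : (Fin d → ℝ) × ℝ, Complex.exp ((inner ℝ (j p) y : ℝ) * Complex.I) =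
        expo (fun i => (2 * Real.pi)⁻¹ * y i.succ) p.1 *
        Complex.exp (((y 0 * p.2 : ℝ) : ℂ) * Complex.I) := fun p => hexp y p.1 p.2
      simp only [h3]
      rw [integral_prod_mul (fun x => expo (fun i => (2 * Real.pi)⁻¹ * y i.succ) x)
        (fun z : ℝ => Complex.exp (((y 0 * z : ℝ) : ℂ) * Complex.I))]
      congr 1
      have h4 := charFun_gaussianReal (μ := 0) (v := v) (y 0)
      rw [charFun_apply] at h4
      simp only [RCLike.inner_apply, conj_trivial] at h4
      rw [h4]
      push_cast
      congr 1
      ring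
    simp only [h1, h2]
    exact h _ _
  rw [ProbabilityMeasure.tendsto_iff_forall_integral_tendsto] at hlim
  let ψ : BoundedContinuousFunction (EuclideanSpace ℝ (Fin (d + 1))) ℝ :=
    (φ.compContinuous ⟨fun y : EuclideanSpace ℝ (Fin (d + 1)) => fun i => y i.succ, by fun_prop⟩) *
      (g.compContinuous ⟨fun y : EuclideanSpace ℝ (Fin (d + 1)) => y 0, by fun_prop⟩)
  have hψ : ∀ p, ψ (j p) = φ p.1 * g p.2 := fun p => rfl
  have := hlim ψ
  have h1 : ∀ N, ∫ y, ψ y ∂(P N : Measure (EuclideanSpace ℝ (Fin (d + 1)))) = ∫ x, φ x * g (X N x) ∂μ := by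
    intro N
    change ∫ x, _ ∂(μ.map fun x => j (x, X N x)) = _
    rw [integral_map (hΦ N).aemeasurable (by fun_prop)]
    simp only [hψ]
  have h2 : ∫ y, ψ y ∂(P0 : Measure (EuclideanSpace ℝ (Fin (d + 1)))) = (∫ x, φ x ∂μ) * ∫ z, g z ∂(gaussianReal 0 v) := by
    change ∫ x, _ ∂((μ.prod (gaussianReal 0 v)).map j) = _
    rw [integral_map hj.aemeasurable (by fun_prop)]
    simp only [hψ]
    rw [integral_prod_mul]
  simpa only [h1, h2] using this

/-- Dividing by the total mass reduces to probability measures. Since `g` is bounded, approximating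
`φ` in `L¹` by bounded continuous functions costs an error uniform in `N`. -/
theorem tendsto_integral_mul_of_charFun {d : ℕ} {μ : Measure (Fin d → ℝ)} [IsFiniteMeasure μ]
    {X : ℕ → (Fin d → ℝ) → ℝ} (hX : ∀ N, Measurable (X N)) {v : ℝ≥0}
    (h : ∀ (ζ : Fin d → ℝ) (t : ℝ), Tendsto (fun N => ∫ x, expo ζ x *
      Complex.exp (((t * X N x : ℝ) : ℂ) * Complex.I) ∂μ) atTop
      (𝓝 ((∫ x, expo ζ x ∂μ) * (Real.exp (-(v * t ^ 2 / 2)) : ℝ))))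
    {φ : (Fin d → ℝ) → ℝ} (hφ : Integrable φ μ) (g : BoundedContinuousFunction ℝ ℝ) :
    Tendsto (fun N => ∫ x, φ x * g (X N x) ∂μ) atTop
      (𝓝 ((∫ x, φ x ∂μ) * ∫ z, g z ∂(gaussianReal 0 v))) := by
  rcases eq_or_ne μ 0 with rfl | hμ
  · simp
  have hbcf : ∀ φ : BoundedContinuousFunction (Fin d → ℝ) ℝ,
      Tendsto (fun N => ∫ x, φ x * g (X N x) ∂μ) atTop
      (𝓝 ((∫ x, φ x ∂μ) * ∫ z, g z ∂(gaussianReal 0 v))) := by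
    intro φ
    have : NeZero μ := ⟨hμ⟩
    set c : ℝ≥0∞ := (μ Set.univ)⁻¹
    have hc : c.toReal ≠ 0 := by
      simp only [c, ENNReal.toReal_inv, ne_eq, inv_eq_zero]
      exact (ENNReal.toReal_pos (NeZero.ne _) (measure_ne_top _ _)).ne'
    have : IsProbabilityMeasure (c • μ) := inferInstance
    have key := tendsto_integral_mul_of_charFun_bcf (μ := c • μ) hX (v := v) (fun ζ t => by
      simp only [integral_smul_measure, smul_mul_assoc]
      exact (h ζ t).const_smul _) φ g
    simp only [integral_smul_measure, smul_mul_assoc] at key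
    have := key.const_smul (c.toReal)⁻¹
    simpa only [smul_smul, inv_mul_cancel₀ hc, one_smul] using this
  set γ := gaussianReal 0 v
  have hgi : ∀ {f : (Fin d → ℝ) → ℝ} (N : ℕ), Integrable f μ →
      Integrable (fun x => f x * g (X N x)) μ := fun N hf => by
    refine hf.mul_bdd (c := ‖g‖) ?_ (ae_of_all _ fun x => g.norm_coe_le_norm _)
    exact (g.continuous.measurable.comp (hX N)).aestronglyMeasurable
  have hgn : ‖∫ z, g z ∂γ‖ ≤ ‖g‖ := by
    have := norm_integral_le_of_norm_le_const (μ := γ) (ae_of_all _ fun z => g.norm_coe_le_norm z)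
    simpa using this
  refine tendsto_of_approx fun ε hε => ?_
  -- The `+ 1` guards against `‖g‖ = 0`.
  obtain ⟨ψ, hψ, hψi⟩ := hφ.exists_boundedContinuous_integral_sub_le
    (ε := ε / (‖g‖ + 1)) (by positivity)
  have hε' : ε / (‖g‖ + 1) * ‖g‖ ≤ ε := by
    rw [div_mul_eq_mul_div, div_le_iff₀ (by positivity)]
    nlinarith [norm_nonneg g]
  refine ⟨_, _, hbcf ψ, ?_, Eventually.of_forall fun N => ?_⟩
  · rw [dist_comm, dist_eq_norm, ← sub_mul, norm_mul, ← integral_sub hφ hψi]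
    refine le_trans ?_ hε'
    exact mul_le_mul ((norm_integral_le_integral_norm _).trans hψ) hgn (norm_nonneg _)
      (by positivity)
  · rw [dist_eq_norm, ← integral_sub (hgi N hφ) (hgi N hψi)]
    refine le_trans ?_ hε'
    refine (norm_integral_le_of_norm_le (g := fun x => ‖φ x - ψ x‖ * ‖g‖)
      ((hφ.sub hψi).norm.mul_const _) (ae_of_all _ fun x => ?_)).trans ?_
    · rw [← sub_mul, norm_mul]
      exact mul_le_mul_of_nonneg_left (g.norm_coe_le_norm _) (norm_nonneg _)
    · rw [integral_mul_const]
      exact mul_le_mul_of_nonneg_right hψ (norm_nonneg _)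

/-- The density of `ν` with respect to `μ` serves as the test function `φ`; this is how a limit
theorem under a smooth weight reaches Lebesgue measure on `Γ`. -/
theorem tendsto_integral_of_le {d : ℕ} {μ ν : Measure (Fin d → ℝ)} [IsFiniteMeasure μ]
    (hν : ν ≤ μ) {X : ℕ → (Fin d → ℝ) → ℝ} (hX : ∀ N, Measurable (X N)) {v : ℝ≥0}
    (h : ∀ (ζ : Fin d → ℝ) (t : ℝ), Tendsto (fun N => ∫ x, expo ζ x *
      Complex.exp (((t * X N x : ℝ) : ℂ) * Complex.I) ∂μ) atTop
      (𝓝 ((∫ x, expo ζ x ∂μ) * (Real.exp (-(v * t ^ 2 / 2)) : ℝ))))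
    (g : BoundedContinuousFunction ℝ ℝ) :
    Tendsto (fun N => ∫ x, g (X N x) ∂ν) atTop
      (𝓝 (ν.real Set.univ * ∫ z, g z ∂(gaussianReal 0 v))) := by
  have : IsFiniteMeasure ν := isFiniteMeasure_of_le μ hν
  have hac : ν ≪ μ := Measure.absolutelyContinuous_of_le hν
  have : ν.HaveLebesgueDecomposition μ := Measure.haveLebesgueDecomposition_of_sigmaFinite ν μ
  have h1 := tendsto_integral_mul_of_charFun hX h
    (φ := fun x => (ν.rnDeriv μ x).toReal) Measure.integrable_toReal_rnDeriv g
  rw [Measure.integral_toReal_rnDeriv hac] at h1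
  refine h1.congr fun N => ?_
  simpa only [smul_eq_mul] using integral_rnDeriv_smul hac (f := fun x => g (X N x))

/-- The truncated square `z ↦ min (z²) M`. -/
noncomputable def truncSq (M : ℕ) : BoundedContinuousFunction ℝ ℝ :=
  BoundedContinuousFunction.ofNormedAddCommGroup (fun z => min (z ^ 2) (M : ℝ)) (by fun_prop) M
    fun z => by
      rw [Real.norm_of_nonneg (le_min (sq_nonneg _) (Nat.cast_nonneg _))]
      exact min_le_right _ _

theorem truncSq_apply (M : ℕ) (z : ℝ) : truncSq M z = min (z ^ 2) (M : ℝ) := rfl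

theorem integral_sq_gaussianReal (v : ℝ≥0) : ∫ z, z ^ 2 ∂(gaussianReal 0 v) = v := by
  have h := variance_id_gaussianReal (μ := 0) (v := v)
  rw [variance_eq_integral (by fun_prop)] at h
  simpa using h

theorem tendsto_integral_truncSq (v : ℝ≥0) :
    Tendsto (fun M => ∫ z, truncSq M z ∂(gaussianReal 0 v)) atTop (𝓝 v) := by
  rw [← integral_sq_gaussianReal v]
  refine tendsto_integral_of_dominated_convergence (fun z => z ^ 2)
    (fun M => (truncSq M).continuous.aestronglyMeasurable) ?_ (fun M => ae_of_all _ fun z => ?_)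
    (ae_of_all _ fun z => ?_)
  · exact (memLp_id_gaussianReal (μ := 0) (v := v) 2).integrable_sq
  · rw [truncSq_apply, Real.norm_of_nonneg (le_min (sq_nonneg _) (Nat.cast_nonneg _))]
    exact min_le_left _ _
  · refine tendsto_const_nhds.congr' ?_
    obtain ⟨n, hn⟩ := exists_nat_ge (z ^ 2)
    filter_upwards [eventually_ge_atTop n] with M hM
    rw [truncSq_apply, min_eq_left]
    exact hn.trans (by exact_mod_cast hM)

section SecondMoment

variable {d : ℕ} {μ ν : Measure (Fin d → ℝ)} [IsFiniteMeasure μ]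
  {X : ℕ → (Fin d → ℝ) → ℝ} {v : ℝ≥0}

/-- Convergence in law only controls bounded test functions, so truncated squares give a lower bound
for the second moment, as in Fatou's lemma. -/
theorem eventually_le_integral_sq_of_le (hν : ν ≤ μ) (hX : ∀ N, Measurable (X N))
    (h : ∀ (ζ : Fin d → ℝ) (t : ℝ), Tendsto (fun N => ∫ x, expo ζ x *
      Complex.exp (((t * X N x : ℝ) : ℂ) * Complex.I) ∂μ) atTop
      (𝓝 ((∫ x, expo ζ x ∂μ) * (Real.exp (-(v * t ^ 2 / 2)) : ℝ))))
    (hint : ∀ N, Integrable (fun x => X N x ^ 2) μ) {ε : ℝ} (hε : 0 < ε) :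
    ∀ᶠ N in atTop, ν.real Set.univ * v - ε ≤ ∫ x, X N x ^ 2 ∂ν := by
  have : IsFiniteMeasure ν := isFiniteMeasure_of_le μ hν
  have h1 := (tendsto_integral_truncSq v).const_mul (ν.real Set.univ)
  obtain ⟨M, hM⟩ := (h1.eventually (eventually_gt_nhds
    (show ν.real Set.univ * v - ε < ν.real Set.univ * v by linarith))).exists
  filter_upwards [(tendsto_integral_of_le hν hX h (truncSq M)).eventually
    (eventually_gt_nhds hM)] with N hN
  refine hN.le.trans (integral_mono ?_ ((hint N).mono_measure hν) fun x => min_le_left _ _)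
  refine Integrable.of_bound (C := ‖truncSq M‖)
    (((truncSq M).continuous.measurable.comp (hX N)).aestronglyMeasurable)
    (ae_of_all _ fun x => (truncSq M).norm_coe_le_norm _)

/-- The lower bound holds for `ν` and for `μ - ν`. Their second moments add up to that under `μ`,
whose limit is known, so neither can exceed its lower bound in the limit. -/
theorem tendsto_integral_sq_of_le (hν : ν ≤ μ) (hX : ∀ N, Measurable (X N))
    (h : ∀ (ζ : Fin d → ℝ) (t : ℝ), Tendsto (fun N => ∫ x, expo ζ x *
      Complex.exp (((t * X N x : ℝ) : ℂ) * Complex.I) ∂μ) atTop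
      (𝓝 ((∫ x, expo ζ x ∂μ) * (Real.exp (-(v * t ^ 2 / 2)) : ℝ))))
    (hint : ∀ N, Integrable (fun x => X N x ^ 2) μ)
    (hsq : Tendsto (fun N => ∫ x, X N x ^ 2 ∂μ) atTop (𝓝 (μ.real Set.univ * v))) :
    Tendsto (fun N => ∫ x, X N x ^ 2 ∂ν) atTop (𝓝 (ν.real Set.univ * v)) := by
  have : IsFiniteMeasure ν := isFiniteMeasure_of_le μ hν
  have hsub : μ - ν + ν = μ := Measure.sub_add_cancel_of_le hν
  have hν' : μ - ν ≤ μ := Measure.sub_le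
  have : IsFiniteMeasure (μ - ν) := isFiniteMeasure_of_le μ hν'
  have hmass : (μ - ν).real Set.univ + ν.real Set.univ = μ.real Set.univ := by
    rw [← measureReal_add_apply, hsub]
  have hsum : ∀ N, ∫ x, X N x ^ 2 ∂(μ - ν) + ∫ x, X N x ^ 2 ∂ν = ∫ x, X N x ^ 2 ∂μ := fun N => by
    rw [← integral_add_measure ((hint N).mono_measure hν') ((hint N).mono_measure hν), hsub]
  rw [Metric.tendsto_nhds]
  intro ε hε
  filter_upwards [eventually_le_integral_sq_of_le hν hX h hint (half_pos hε),
    eventually_le_integral_sq_of_le hν' hX h hint (half_pos (half_pos hε)),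
    hsq.eventually (eventually_lt_nhds
      (show μ.real Set.univ * v < μ.real Set.univ * v + ε / 4 by linarith))] with N h1 h2 h3
  rw [Real.dist_eq, abs_lt]
  rw [← hmass, ← hsum N] at h3
  constructor <;> nlinarith

end SecondMoment

/-- Lévy's theorem and the portmanteau theorem apply because the boundary `{t}` is a null set of the
limit law: it has no atoms if `v > 0`, and its only atom is `0` if `v = 0`. -/
theorem tendsto_measureReal_le_of_tendsto_charFun {Ω : Type*} [MeasurableSpace Ω] {ν : Measure Ω}
    [IsFiniteMeasure ν] {X : ℕ → Ω → ℝ} (hX : ∀ N, AEMeasurable (X N) ν) {v : ℝ≥0}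
    (h : ∀ t : ℝ, Tendsto (fun N => ∫ x, Complex.exp (((t * X N x : ℝ) : ℂ) * Complex.I) ∂ν) atTop
      (𝓝 (ν.real Set.univ * (Real.exp (-(v * t ^ 2 / 2)) : ℝ)))) {t : ℝ} (ht : t ≠ 0 ∨ 0 < v) :
    Tendsto (fun N => ν.real {x | X N x ≤ t}) atTop
      (𝓝 (ν.real Set.univ * cdf (gaussianReal 0 v) t)) := by
  rcases eq_or_ne ν 0 with rfl | hν
  · simp
  have : NeZero ν := ⟨hν⟩
  set c : ℝ≥0∞ := (ν Set.univ)⁻¹ with hcdef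
  have hc : c.toReal * ν.real Set.univ = 1 := by
    rw [hcdef, ENNReal.toReal_inv, measureReal_def]
    exact inv_mul_cancel₀ (ENNReal.toReal_pos (NeZero.ne _) (measure_ne_top _ _)).ne'
  have : IsProbabilityMeasure (c • ν) := inferInstance
  have hX' : ∀ N, AEMeasurable (X N) (c • ν) := fun N => (hX N).smul_measure _
  let P : ℕ → ProbabilityMeasure ℝ := fun N =>
    ⟨(c • ν).map (X N), Measure.isProbabilityMeasure_map (hX' N)⟩
  let P0 : ProbabilityMeasure ℝ := ⟨gaussianReal 0 v, inferInstance⟩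
  have hlim : Tendsto P atTop (𝓝 P0) := by
    refine ProbabilityMeasure.tendsto_of_tendsto_charFun fun s => ?_
    have h1 : ∀ N, charFun (P N : Measure ℝ) s =
        c.toReal • ∫ x, Complex.exp (((s * X N x : ℝ) : ℂ) * Complex.I) ∂ν := by
      intro N
      rw [charFun_apply]
      change ∫ x, _ ∂((c • ν).map (X N)) = _
      rw [integral_map (hX' N) (by fun_prop), integral_smul_measure]
      simp
    have h2 : charFun (P0 : Measure ℝ) s =
        c.toReal • ((ν.real Set.univ : ℂ) * (Real.exp (-(v * s ^ 2 / 2)) : ℝ)) := by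
      change charFun (gaussianReal 0 v) s = _
      rw [charFun_gaussianReal, Complex.real_smul, ← mul_assoc,
        ← Complex.ofReal_mul c.toReal (ν.real Set.univ), hc]
      push_cast
      rw [one_mul]
      congr 1
      ring
    simp only [h1, h2]
    exact (h s).const_smul _
  have hfr : (P0 : Measure ℝ) (frontier (Set.Iic t)) = 0 := by
    change gaussianReal 0 v _ = 0
    rw [frontier_Iic]
    rcases eq_or_ne v 0 with rfl | hv
    · rw [gaussianReal_zero_var, Measure.dirac_apply' _ (measurableSet_singleton t)]
      have : t ≠ 0 := by simpa using ht
      simp [this.symm]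
    · have := nullSingletonClass_gaussianReal (μ := 0) hv
      exact measure_singleton t
  have h3 := ProbabilityMeasure.tendsto_measure_of_null_frontier_of_tendsto' hlim hfr
  have h4 := ((ENNReal.tendsto_toReal (measure_ne_top _ _)).comp h3).const_mul (ν.real Set.univ)
  have h5 : ((P0 : Measure ℝ) (Set.Iic t)).toReal = cdf (gaussianReal 0 v) t := by
    rw [cdf_eq_real]; rfl
  rw [h5] at h4
  refine h4.congr fun N => ?_
  simp only [Function.comp]
  change ν.real Set.univ * ((c • ν).map (X N) (Set.Iic t)).toReal = _
  rw [Measure.map_apply_of_aemeasurable (hX' N) measurableSet_Iic, Measure.smul_apply, smul_eq_mul,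
    ENNReal.toReal_mul, ← mul_assoc, mul_comm (ν.real Set.univ), hc, one_mul]
  rfl

/-! ### Euclidean norms of row vectors under an expanding matrix -/

/-- The Euclidean norm on `Fin d → ℝ`. -/
noncomputable def euclNorm {d : ℕ} (v : Fin d → ℝ) : ℝ := ‖WithLp.toLp 2 v‖

/-- `A` expands the Euclidean norm by a factor at least `q > 1`. -/
def ExpandsBy {d : ℕ} (A : Matrix (Fin d) (Fin d) ℝ) (q : ℝ) : Prop :=
  1 < q ∧ ∀ x : Fin d → ℝ, q * euclNorm x ≤ euclNorm (A *ᵥ x)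

section EuclNorm

variable {d : ℕ}

theorem euclNorm_nonneg (v : Fin d → ℝ) : 0 ≤ euclNorm v := norm_nonneg _

theorem euclNorm_zero : euclNorm (0 : Fin d → ℝ) = 0 := by simp [euclNorm]

theorem euclNorm_eq_zero {v : Fin d → ℝ} : euclNorm v = 0 ↔ v = 0 := by simp [euclNorm]

theorem euclNorm_pos {v : Fin d → ℝ} (hv : v ≠ 0) : 0 < euclNorm v :=
  (euclNorm_nonneg v).lt_of_ne' (by rwa [Ne, euclNorm_eq_zero])

theorem euclNorm_neg (v : Fin d → ℝ) : euclNorm (-v) = euclNorm v := by simp [euclNorm]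

theorem euclNorm_sub_le (v w : Fin d → ℝ) : euclNorm (v - w) ≤ euclNorm v + euclNorm w := by
  simpa [euclNorm] using norm_sub_le (WithLp.toLp 2 v) (WithLp.toLp 2 w)

theorem le_euclNorm_add (v w : Fin d → ℝ) : euclNorm w - euclNorm v ≤ euclNorm (v + w) := by
  have := euclNorm_sub_le (v + w) v
  rw [add_sub_cancel_left] at this
  linarith

theorem euclNorm_sq (v : Fin d → ℝ) : euclNorm v ^ 2 = v ⬝ᵥ v := by
  rw [euclNorm, EuclideanSpace.norm_sq_eq]
  simp [dotProduct, sq]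

theorem dotProduct_le_euclNorm (v w : Fin d → ℝ) : v ⬝ᵥ w ≤ euclNorm v * euclNorm w := by
  have := real_inner_le_norm (WithLp.toLp 2 v) (WithLp.toLp 2 w)
  refine le_trans (le_of_eq ?_) this
  simp [PiLp.inner_apply, dotProduct, mul_comm]

theorem abs_le_euclNorm (v : Fin d → ℝ) (i : Fin d) : |v i| ≤ euclNorm v := by
  simpa [euclNorm] using PiLp.norm_apply_le (WithLp.toLp 2 v) i

theorem toRow_zero : toRow (0 : Fin d → ℤ) = 0 := by ext; simp [toRow]

theorem toRow_neg (ξ : Fin d → ℤ) : toRow (-ξ) = -toRow ξ := by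
  ext; simp [toRow]

theorem toRow_sub (ξ ξ' : Fin d → ℤ) : toRow (ξ - ξ') = toRow ξ - toRow ξ' := by
  ext; simp [toRow]

theorem one_le_euclNorm_toRow {ξ : Fin d → ℤ} (hξ : ξ ≠ 0) : 1 ≤ euclNorm (toRow ξ) := by
  obtain ⟨i, hi⟩ := Function.ne_iff.1 hξ
  refine le_trans ?_ (abs_le_euclNorm _ i)
  rw [toRow, ← Int.cast_abs]
  exact_mod_cast Int.one_le_abs hi

theorem eq_of_euclNorm_toRow_sub_lt_one {ξ ξ' : Fin d → ℤ}
    (h : euclNorm (toRow ξ - toRow ξ') < 1) : ξ = ξ' := by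
  by_contra hne
  rw [← toRow_sub] at h
  exact h.not_ge (one_le_euclNorm_toRow (sub_ne_zero.2 hne))

end EuclNorm

section Expanding

variable {d : ℕ} {A : Matrix (Fin d) (Fin d) ℝ} {q : ℝ}

theorem ExpandsBy.isUnit_det (h : ExpandsBy A q) : IsUnit A.det := by
  rw [← Matrix.isUnit_iff_isUnit_det, ← Matrix.mulVec_injective_iff_isUnit]
  intro x y hxy
  have h1 := h.2 (x - y)
  rw [Matrix.mulVec_sub, sub_eq_zero.2 hxy, euclNorm_zero] at h1
  have h2 : euclNorm (x - y) = 0 := by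
    nlinarith [euclNorm_nonneg (x - y), h.1]
  exact sub_eq_zero.1 (euclNorm_eq_zero.1 h2)

/-- Duality: with `x = A⁻¹ v`, `‖v‖² = (vA) · x ≤ ‖vA‖ ‖x‖` and `q ‖x‖ ≤ ‖v‖`. Frequencies are row
vectors, so this is the form in which expansion is used. -/
theorem ExpandsBy.vecMul (h : ExpandsBy A q) (v : Fin d → ℝ) :
    q * euclNorm v ≤ euclNorm (v ᵥ* A) := by
  set x := A⁻¹ *ᵥ v
  have hx : A *ᵥ x = v := by
    rw [Matrix.mulVec_mulVec, Matrix.mul_nonsing_inv _ h.isUnit_det, Matrix.one_mulVec]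
  have h1 : euclNorm v ^ 2 ≤ euclNorm (v ᵥ* A) * euclNorm x := by
    rw [euclNorm_sq]
    nth_rewrite 2 [← hx]
    rw [Matrix.dotProduct_mulVec]
    exact dotProduct_le_euclNorm _ _
  have h2 := h.2 x
  rw [hx] at h2
  rcases (euclNorm_nonneg v).eq_or_lt with h3 | h3
  · rw [← h3, mul_zero]; exact euclNorm_nonneg _
  · have h4 : (q * euclNorm v) * euclNorm v ≤ euclNorm (v ᵥ* A) * euclNorm v := by
      nlinarith [euclNorm_nonneg (v ᵥ* A), h.1]
    exact le_of_mul_le_mul_right h4 h3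

theorem ExpandsBy.vecMul_pow (h : ExpandsBy A q) (v : Fin d → ℝ) (k : ℕ) :
    q ^ k * euclNorm v ≤ euclNorm (v ᵥ* A ^ k) := by
  induction k with
  | zero => simp
  | succ k ih =>
    rw [pow_succ A, ← Matrix.vecMul_vecMul]
    refine le_trans ?_ (h.vecMul _)
    rw [pow_succ', mul_assoc]
    exact mul_le_mul_of_nonneg_left ih (by linarith [h.1])

theorem ExpandsBy.le_vecMul_pow (h : ExpandsBy A q) (v : Fin d → ℝ) (k : ℕ) :
    euclNorm v ≤ euclNorm (v ᵥ* A ^ k) :=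
  (le_mul_of_one_le_left (euclNorm_nonneg _) (one_le_pow₀ h.1.le)).trans (h.vecMul_pow v k)

theorem ExpandsBy.vecMul_pow_eq_zero (h : ExpandsBy A q) {v : Fin d → ℝ} {k : ℕ} :
    v ᵥ* A ^ k = 0 ↔ v = 0 := by
  refine ⟨fun hv => ?_, fun hv => by simp [hv]⟩
  have := h.le_vecMul_pow v k
  rw [hv, euclNorm_zero] at this
  exact euclNorm_eq_zero.1 (le_antisymm this (euclNorm_nonneg _))

/-- Factoring out `A ^ k`, which does not shrink rows, reduces lower bounds for combined frequencies
to ones depending on the lag `l` alone. -/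
theorem vecMul_pow_add_split (v w : Fin d → ℝ) (k l : ℕ) :
    v ᵥ* A ^ k + w ᵥ* A ^ (k + l) = (v + w ᵥ* A ^ l) ᵥ* A ^ k := by
  rw [Matrix.add_vecMul, Matrix.vecMul_vecMul, ← pow_add, add_comm l]

end Expanding

/-! ### Band-limited measures and spans of exponentials -/

/-- The integral of `expo η` against `μ` vanishes for all frequencies of norm at least `1/2`. -/
def BandLimited {d : ℕ} (μ : Measure (Fin d → ℝ)) : Prop :=
  ∀ η : Fin d → ℝ, 1 / 2 ≤ euclNorm η → ∫ x, expo η x ∂μ = 0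

section Span

variable {d : ℕ}

/-- Continuous bounded functions. -/
def BddCont (h : (Fin d → ℝ) → ℂ) : Prop := Continuous h ∧ ∃ C, ∀ x, ‖h x‖ ≤ C

theorem BddCont.expo (η : Fin d → ℝ) : BddCont (expo η) :=
  ⟨continuous_expo η, 1, fun x => (norm_expo η x).le⟩

theorem BddCont.add {h h' : (Fin d → ℝ) → ℂ} (h1 : BddCont h) (h2 : BddCont h') :
    BddCont (h + h') := by
  obtain ⟨c1, C1, b1⟩ := h1
  obtain ⟨c2, C2, b2⟩ := h2
  exact ⟨c1.add c2, C1 + C2, fun x => (norm_add_le _ _).trans (add_le_add (b1 x) (b2 x))⟩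

theorem BddCont.mul {h h' : (Fin d → ℝ) → ℂ} (h1 : BddCont h) (h2 : BddCont h') :
    BddCont (h * h') := by
  obtain ⟨c1, C1, b1⟩ := h1
  obtain ⟨c2, C2, b2⟩ := h2
  refine ⟨c1.mul c2, C1 * C2, fun x => ?_⟩
  rw [Pi.mul_apply, norm_mul]
  exact mul_le_mul (b1 x) (b2 x) (norm_nonneg _) ((norm_nonneg _).trans (b1 x))

theorem BddCont.const (c : ℂ) : BddCont (fun _ : Fin d → ℝ => c) :=
  ⟨continuous_const, ‖c‖, fun _ => le_rfl⟩

theorem BddCont.smul {h : (Fin d → ℝ) → ℂ} (h1 : BddCont h) (c : ℂ) : BddCont (c • h) :=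
  (BddCont.const c).mul h1

theorem BddCont.sum {ι : Type*} {s : Finset ι} {h : ι → (Fin d → ℝ) → ℂ}
    (h1 : ∀ i ∈ s, BddCont (h i)) : BddCont (fun x => ∑ i ∈ s, h i x) := by
  classical
  induction s using Finset.induction_on with
  | empty => simpa using BddCont.const 0
  | insert i s hi ih =>
    simp only [Finset.sum_insert hi]
    exact (h1 i (Finset.mem_insert_self _ _)).add
      (ih fun j hj => h1 j (Finset.mem_insert_of_mem hj))

theorem continuous_mulVec (M : Matrix (Fin d) (Fin d) ℝ) : Continuous fun x => M *ᵥ x :=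
  Continuous.matrix_mulVec continuous_const continuous_id

theorem BddCont.comp_mulVec {h : (Fin d → ℝ) → ℂ} (h1 : BddCont h)
    (M : Matrix (Fin d) (Fin d) ℝ) : BddCont (fun x => h (M *ᵥ x)) :=
  ⟨h1.1.comp (continuous_mulVec M), h1.2.imp fun _ hC _ => hC _⟩

theorem BddCont.memLp {h : (Fin d → ℝ) → ℂ} (h1 : BddCont h) (μ : Measure (Fin d → ℝ))
    [IsFiniteMeasure μ] (p : ℝ≥0∞) : MemLp h p μ :=
  MemLp.of_bound h1.1.aestronglyMeasurable h1.2.choose (ae_of_all _ h1.2.choose_spec)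

theorem BddCont.integrable {h : (Fin d → ℝ) → ℂ} (h1 : BddCont h) (μ : Measure (Fin d → ℝ))
    [IsFiniteMeasure μ] : Integrable h μ := (memLp_one_iff_integrable.1 (h1.memLp μ 1))

/-- The span of the exponentials with nonzero frequencies. -/
noncomputable def nonzeroSpan (d : ℕ) : Submodule ℂ ((Fin d → ℝ) → ℂ) :=
  Submodule.span ℂ {h | ∃ η : Fin d → ℝ, η ≠ 0 ∧ h = expo η}

/-- The span of the exponentials with frequencies `v A^k`, where `v` has norm at least one. -/
noncomputable def highSpan (A : Matrix (Fin d) (Fin d) ℝ) (k : ℕ) :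
    Submodule ℂ ((Fin d → ℝ) → ℂ) :=
  Submodule.span ℂ {h | ∃ v : Fin d → ℝ, 1 ≤ euclNorm v ∧ h = expo (v ᵥ* A ^ k)}

theorem bddCont_of_mem_nonzeroSpan {h : (Fin d → ℝ) → ℂ} (hh : h ∈ nonzeroSpan d) : BddCont h := by
  induction hh using Submodule.span_induction with
  | mem h hh => obtain ⟨η, -, rfl⟩ := hh; exact BddCont.expo η
  | zero => exact BddCont.const 0
  | add h h' _ _ h1 h2 => exact h1.add h2
  | smul c h _ h1 => exact h1.smul c

/-- Subtracting the mean value of a generalized trigonometric polynomial leaves only nonzero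
frequencies. -/
theorem sum_expo_sub_mem_nonzeroSpan {ι : Type*} (s : Finset ι) (a : ι → ℂ)
    (η : ι → Fin d → ℝ) [DecidableEq (Fin d → ℝ)] :
    (fun x => ∑ i ∈ s, a i * expo (η i) x - ∑ i ∈ s, if η i = 0 then a i else 0) ∈
      nonzeroSpan d := by
  have : (fun x => ∑ i ∈ s, a i * expo (η i) x - ∑ i ∈ s, if η i = 0 then a i else 0) =
      ∑ i ∈ s, (if η i = 0 then 0 else a i • expo (η i)) := by
    ext x
    rw [Finset.sum_apply, ← Finset.sum_sub_distrib]
    refine Finset.sum_congr rfl fun i _ => ?_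
    split_ifs with h
    · simp [h, expo_zero]
    · simp
  rw [this]
  refine Submodule.sum_mem _ fun i _ => ?_
  split_ifs with h
  · exact Submodule.zero_mem _
  · exact Submodule.smul_mem _ _ (Submodule.subset_span ⟨_, h, rfl⟩)

variable {A : Matrix (Fin d) (Fin d) ℝ} {q : ℝ} {μ : Measure (Fin d → ℝ)} [IsFiniteMeasure μ]

theorem eventually_le_pow_mul {q : ℝ} (hq : 1 < q) (C : ℝ) {c : ℝ} (hc : 0 < c) :
    ∀ᶠ k : ℕ in atTop, C ≤ q ^ k * c :=
  ((tendsto_pow_atTop_atTop_of_one_lt hq).atTop_mul_const hc).eventually_ge_atTop C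

/-- Finitely many nonzero frequencies are involved, and multiplication by `A ^ k` eventually pushes
each beyond `1/2`. The integrals vanish exactly rather than merely decay. -/
theorem eventually_integral_eq_zero (hA : ExpandsBy A q) (hμ : BandLimited μ)
    {h : (Fin d → ℝ) → ℂ} (hh : h ∈ nonzeroSpan d) :
    ∀ᶠ k : ℕ in atTop, ∫ x, h ((A ^ k) *ᵥ x) ∂μ = 0 := by
  induction hh using Submodule.span_induction with
  | mem h hh =>
    obtain ⟨η, hη, rfl⟩ := hh
    filter_upwards [eventually_le_pow_mul hA.1 (1 / 2) (euclNorm_pos hη)] with k hk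
    simp only [expo_mulVec]
    exact hμ _ (hk.trans (hA.vecMul_pow η k))
  | zero => simp
  | add h h' hh hh' h1 h2 =>
    filter_upwards [h1, h2] with k h3 h4
    simp only [Pi.add_apply]
    rw [integral_add (((bddCont_of_mem_nonzeroSpan hh).comp_mulVec _).integrable μ)
      (((bddCont_of_mem_nonzeroSpan hh').comp_mulVec _).integrable μ), h3, h4, add_zero]
  | smul c h _ h1 =>
    filter_upwards [h1] with k h2
    simp only [Pi.smul_apply]
    rw [integral_smul, h2, smul_zero]

theorem integral_norm_sum_sq_le {φ : ℕ → (Fin d → ℝ) → ℂ} (hφ : ∀ k, BddCont (φ k)) {u : ℕ → ℝ}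
    (hu : Summable u) (hb : ∀ k l, ‖∫ x, φ k x * (starRingEnd ℂ) (φ (k + l) x) ∂μ‖ ≤ u l)
    (E : Finset ℕ) : ∫ x, ‖∑ k ∈ E, φ k x‖ ^ 2 ∂μ ≤ 2 * (∑' l, u l) * E.card := by
  have hconj : ∀ k, BddCont (fun x => (starRingEnd ℂ) (φ k x)) := fun k =>
    ⟨Complex.continuous_conj.comp (hφ k).1, (hφ k).2.imp fun _ hC x => by simpa using hC x⟩
  have h1 : ((∫ x, ‖∑ k ∈ E, φ k x‖ ^ 2 ∂μ : ℝ) : ℂ) =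
      ∑ a ∈ E, ∑ b ∈ E, ∫ x, φ a x * (starRingEnd ℂ) (φ b x) ∂μ := by
    rw [← integral_complex_ofReal]
    have h2 : ∀ x, ((‖∑ k ∈ E, φ k x‖ ^ 2 : ℝ) : ℂ) =
        ∑ a ∈ E, ∑ b ∈ E, φ a x * (starRingEnd ℂ) (φ b x) := by
      intro x
      rw [← Finset.sum_mul_sum, ← map_sum, Complex.mul_conj, Complex.normSq_eq_norm_sq]
    simp only [h2]
    rw [integral_finsetSum]
    · refine Finset.sum_congr rfl fun a _ => integral_finsetSum _ fun b _ => ?_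
      exact ((hφ a).mul (hconj b)).integrable μ
    · intro a _
      exact integrable_finsetSum _ fun b _ => ((hφ a).mul (hconj b)).integrable μ
  have h3 : ∫ x, ‖∑ k ∈ E, φ k x‖ ^ 2 ∂μ ≤
      ∑ a ∈ E, ∑ b ∈ E, ‖∫ x, φ a x * (starRingEnd ℂ) (φ b x) ∂μ‖ := by
    have h4 : ∫ x, ‖∑ k ∈ E, φ k x‖ ^ 2 ∂μ ≤ ‖((∫ x, ‖∑ k ∈ E, φ k x‖ ^ 2 ∂μ : ℝ) : ℂ)‖ := by
      rw [Complex.norm_real]; exact le_abs_self _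
    rw [h1] at h4
    exact h4.trans ((norm_sum_le _ _).trans (Finset.sum_le_sum fun a _ => norm_sum_le _ _))
  refine h3.trans (sum_sum_le_card_mul_tsum hu (fun l => (norm_nonneg _).trans (hb 0 l)) hb ?_ E)
  intro k l
  refine le_trans (le_of_eq ?_) (hb k l)
  rw [← Complex.norm_conj, ← integral_conj]
  congr 2
  ext x
  simp [mul_comm]

theorem norm_integral_expo_le (η : Fin d → ℝ) : ‖∫ x, expo η x ∂μ‖ ≤ μ.real Set.univ := by
  simpa using norm_integral_le_of_norm_le_const (μ := μ) (ae_of_all _ fun x => (norm_expo η x).le)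

/-- For one exponential the correlation at lag `l` has frequency `(η - ηA^l)A^k`, of norm at least
`1/2` as soon as `q^l ‖η‖ ≥ 1/2 + ‖η‖`. Only finitely many lags contribute, and each is at most the
mass of `μ`. The set `E` is arbitrary so that both arithmetic progressions and leftover gaps are
covered. -/
theorem exists_integral_norm_sum_sq_le (hA : ExpandsBy A q) (hμ : BandLimited μ)
    {h : (Fin d → ℝ) → ℂ} (hh : h ∈ nonzeroSpan d) :
    ∃ C, 0 ≤ C ∧
      ∀ E : Finset ℕ, ∫ x, ‖∑ k ∈ E, h ((A ^ k) *ᵥ x)‖ ^ 2 ∂μ ≤ C * E.card := by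
  induction hh using Submodule.span_induction with
  | mem h hh =>
    obtain ⟨η, hη, rfl⟩ := hh
    obtain ⟨L, hL⟩ := (eventually_le_pow_mul hA.1 (1 / 2 + euclNorm η) (euclNorm_pos hη)).exists_forall_of_atTop
    set u : ℕ → ℝ := fun l => if l < L then μ.real Set.univ else 0 with hu
    have hus : Summable u := summable_of_ne_finset_zero (s := Finset.range L) fun l hl => by
      rw [Finset.mem_range] at hl; simp [hu, hl]
    have hu0 : ∀ l, 0 ≤ u l := fun l => by simp only [hu]; split_ifs <;> positivity
    refine ⟨2 * ∑' l, u l, mul_nonneg two_pos.le (tsum_nonneg hu0), fun E => ?_⟩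
    simp only [expo_mulVec]
    refine integral_norm_sum_sq_le (fun k => BddCont.expo _) hus (fun k l => ?_) E
    simp only [← expo_neg, ← expo_add]
    simp only [hu]
    split_ifs with hl
    · exact norm_integral_expo_le _
    · rw [← Matrix.neg_vecMul, vecMul_pow_add_split, hμ _ _, norm_zero]
      refine le_trans ?_ (hA.le_vecMul_pow _ k)
      have h1 := le_euclNorm_add η ((-η) ᵥ* A ^ l)
      rw [Matrix.neg_vecMul, euclNorm_neg] at h1
      rw [Matrix.neg_vecMul]
      linarith [hL l (not_lt.1 hl), hA.vecMul_pow η l]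
  | zero => exact ⟨0, le_rfl, by simp⟩
  | add h h' hh hh' h1 h2 =>
    obtain ⟨C, hC0, hC⟩ := h1
    obtain ⟨C', hC0', hC'⟩ := h2
    refine ⟨2 * C + 2 * C', by positivity, fun E => ?_⟩
    have b1 : BddCont fun x => ∑ k ∈ E, h ((A ^ k) *ᵥ x) :=
      BddCont.sum fun k _ => (bddCont_of_mem_nonzeroSpan hh).comp_mulVec _
    have b2 : BddCont fun x => ∑ k ∈ E, h' ((A ^ k) *ᵥ x) :=
      BddCont.sum fun k _ => (bddCont_of_mem_nonzeroSpan hh').comp_mulVec _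
    have i1 := (b1.memLp μ 2).integrable_norm_pow (by norm_num)
    have i2 := (b2.memLp μ 2).integrable_norm_pow (by norm_num)
    calc ∫ x, ‖∑ k ∈ E, (h + h') ((A ^ k) *ᵥ x)‖ ^ 2 ∂μ ≤
        ∫ x, (2 * ‖∑ k ∈ E, h ((A ^ k) *ᵥ x)‖ ^ 2 + 2 * ‖∑ k ∈ E, h' ((A ^ k) *ᵥ x)‖ ^ 2) ∂μ := by
          refine integral_mono_of_nonneg (ae_of_all _ fun x => sq_nonneg _)
            ((i1.const_mul 2).add (i2.const_mul 2)) (ae_of_all _ fun x => ?_)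
          simp only [Pi.add_apply, Finset.sum_add_distrib]
          have := norm_add_le (∑ k ∈ E, h ((A ^ k) *ᵥ x)) (∑ k ∈ E, h' ((A ^ k) *ᵥ x))
          have h3 := pow_le_pow_left₀ (norm_nonneg _) this 2
          nlinarith [sq_nonneg (‖∑ k ∈ E, h ((A ^ k) *ᵥ x)‖ - ‖∑ k ∈ E, h' ((A ^ k) *ᵥ x)‖)]
      _ ≤ _ := by
          rw [integral_add (i1.const_mul 2) (i2.const_mul 2), integral_const_mul,
            integral_const_mul]
          linarith [hC E, hC' E]
  | smul c h _ h1 =>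
    obtain ⟨C, hC0, hC⟩ := h1
    refine ⟨‖c‖ ^ 2 * C, by positivity, fun E => ?_⟩
    simp only [Pi.smul_apply, ← Finset.smul_sum, norm_smul, mul_pow]
    rw [integral_const_mul, mul_assoc]
    exact mul_le_mul_of_nonneg_left (hC E) (by positivity)

end Span

section HighSpan

variable {d : ℕ} {A : Matrix (Fin d) (Fin d) ℝ} {q : ℝ} {μ : Measure (Fin d → ℝ)}
  [IsFiniteMeasure μ]

theorem highSpan_antitone (hA : ExpandsBy A q) : Antitone (highSpan A) := by
  intro k k' hk
  refine Submodule.span_mono ?_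
  rintro _ ⟨v, hv, rfl⟩
  refine ⟨v ᵥ* A ^ (k' - k), hv.trans (hA.le_vecMul_pow _ _), ?_⟩
  rw [Matrix.vecMul_vecMul, ← pow_add, Nat.sub_add_cancel hk]

theorem bddCont_of_mem_highSpan {k : ℕ} {h : (Fin d → ℝ) → ℂ} (hh : h ∈ highSpan A k) :
    BddCont h := by
  induction hh using Submodule.span_induction with
  | mem h hh => obtain ⟨η, -, rfl⟩ := hh; exact BddCont.expo _
  | zero => exact BddCont.const 0
  | add h h' _ _ h1 h2 => exact h1.add h2
  | smul c h _ h1 => exact h1.smul c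

/-- A frequency `ζ + vA^k` has norm at least `q^k - ‖ζ‖ ≥ 1/2`. -/
theorem integral_expo_mul_eq_zero (hA : ExpandsBy A q) (hμ : BandLimited μ) {ζ : Fin d → ℝ} {k : ℕ}
    (hk : 1 / 2 + euclNorm ζ ≤ q ^ k) {h : (Fin d → ℝ) → ℂ} (hh : h ∈ highSpan A k) :
    ∫ x, expo ζ x * h x ∂μ = 0 := by
  have hi : ∀ {h : (Fin d → ℝ) → ℂ}, h ∈ highSpan A k → Integrable (fun x => expo ζ x * h x) μ :=
    fun hh => ((BddCont.expo ζ).mul (bddCont_of_mem_highSpan hh)).integrable μ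
  induction hh using Submodule.span_induction with
  | mem h hh =>
    obtain ⟨v, hv, rfl⟩ := hh
    simp only [← expo_add]
    refine hμ _ ?_
    have h1 := le_euclNorm_add ζ (v ᵥ* A ^ k)
    have h2 := hA.vecMul_pow v k
    have h3 : q ^ k ≤ q ^ k * euclNorm v := le_mul_of_one_le_right (by have := hA.1; positivity) hv
    linarith
  | zero => simp
  | add h h' hh hh' h1 h2 =>
    simp only [Pi.add_apply, mul_add]
    rw [integral_add (hi hh) (hi hh'), h1, h2, add_zero]
  | smul c h _ h1 =>
    simp only [Pi.smul_apply, smul_eq_mul, mul_left_comm _ c]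
    rw [integral_const_mul, h1, mul_zero]

end HighSpan

/-! ### Trigonometric polynomials and their resonances -/

/-- The trigonometric polynomial with coefficients `c` and frequencies in `F`. -/
noncomputable def trigPoly {d : ℕ} (c : (Fin d → ℤ) → ℂ) (F : Finset (Fin d → ℤ))
    (x : Fin d → ℝ) : ℂ :=
  ∑ ξ ∈ F, c ξ * expo (toRow ξ) x

open Classical in
/-- The mean value of `x ↦ p(A^a x) p(A^b x)` for the trigonometric polynomial `p`. -/
noncomputable def resonance {d : ℕ} (A : Matrix (Fin d) (Fin d) ℝ) (c : (Fin d → ℤ) → ℂ)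
    (F : Finset (Fin d → ℤ)) (a b : ℕ) : ℂ :=
  ∑ i ∈ F ×ˢ F, if toRow i.1 ᵥ* A ^ a + toRow i.2 ᵥ* A ^ b = 0 then c i.1 * c i.2 else 0

section TrigPoly

variable {d : ℕ} {A : Matrix (Fin d) (Fin d) ℝ} {q : ℝ} {μ : Measure (Fin d → ℝ)}
  [IsFiniteMeasure μ] {c : (Fin d → ℤ) → ℂ} {F : Finset (Fin d → ℤ)}

theorem BddCont.trigPoly (c : (Fin d → ℤ) → ℂ) (F : Finset (Fin d → ℤ)) :
    BddCont (trigPoly c F) :=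
  BddCont.sum fun ξ _ => (BddCont.expo (toRow ξ)).smul (c ξ)

theorem trigPoly_mulVec (M : Matrix (Fin d) (Fin d) ℝ) (x : Fin d → ℝ) :
    trigPoly c F (M *ᵥ x) = ∑ ξ ∈ F, c ξ * expo (toRow ξ ᵥ* M) x := by
  simp only [trigPoly, expo_mulVec]

theorem trigPoly_mem_nonzeroSpan (hF : 0 ∉ F) : trigPoly c F ∈ nonzeroSpan d := by
  have : trigPoly c F = ∑ ξ ∈ F, c ξ • expo (toRow ξ) := by ext x; simp [trigPoly]
  rw [this]
  refine Submodule.sum_mem _ fun ξ hξ => Submodule.smul_mem _ _ (Submodule.subset_span ⟨_, ?_, rfl⟩)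
  intro h0
  have := one_le_euclNorm_toRow (ne_of_mem_of_not_mem hξ hF)
  rw [h0, euclNorm_zero] at this
  linarith

theorem trigPoly_mul_sub_resonance_mem (c : (Fin d → ℤ) → ℂ) (F : Finset (Fin d → ℤ)) (a b : ℕ) :
    (fun x => trigPoly c F (A ^ a *ᵥ x) * trigPoly c F (A ^ b *ᵥ x) - resonance A c F a b) ∈
      nonzeroSpan d := by
  classical
  have := sum_expo_sub_mem_nonzeroSpan (F ×ˢ F) (fun i => c i.1 * c i.2)
    (fun i => toRow i.1 ᵥ* A ^ a + toRow i.2 ᵥ* A ^ b)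
  convert this using 1
  ext x
  rw [trigPoly_mulVec, trigPoly_mulVec, Finset.sum_mul_sum, ← Finset.sum_product']
  congr 1
  · refine Finset.sum_congr rfl fun i _ => ?_
    rw [expo_add]; ring

theorem resonance_symm (a b : ℕ) : resonance A c F a b = resonance A c F b a := by
  unfold resonance
  rw [Finset.sum_product, Finset.sum_comm, ← Finset.sum_product']
  refine Finset.sum_congr rfl fun i _ => ?_
  rw [add_comm, mul_comm]

/-- Stationarity: `A ^ k` is injective on rows, so a resonance depends only on the lag. -/
theorem resonance_add (hA : ExpandsBy A q) (k l : ℕ) :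
    resonance A c F k (k + l) = resonance A c F 0 l := by
  unfold resonance
  refine Finset.sum_congr rfl fun i _ => ?_
  rw [vecMul_pow_add_split, pow_zero, Matrix.vecMul_one]
  simp only [hA.vecMul_pow_eq_zero]

/-- Nonzero integer rows have norm at least one, so `ξ'A^l` outgrows the finite set `F`. Hence
correlations of a trigonometric polynomial have finite range. -/
theorem exists_half_le_euclNorm (hA : ExpandsBy A q) (hF : 0 ∉ F) :
    ∃ L, ∀ l ≥ L, ∀ ξ ∈ F, ∀ ξ' ∈ F, 1 / 2 ≤ euclNorm (toRow ξ + toRow ξ' ᵥ* A ^ l) := by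
  obtain ⟨L, hL⟩ := (eventually_le_pow_mul hA.1 (1 / 2 + ∑ ξ ∈ F, euclNorm (toRow ξ))
    one_pos).exists_forall_of_atTop
  refine ⟨L, fun l hl ξ hξ ξ' hξ' => ?_⟩
  have h1 := le_euclNorm_add (toRow ξ) (toRow ξ' ᵥ* A ^ l)
  have h2 := hA.vecMul_pow (toRow ξ') l
  have h3 : q ^ l * 1 ≤ q ^ l * euclNorm (toRow ξ') := mul_le_mul_of_nonneg_left
    (one_le_euclNorm_toRow (ne_of_mem_of_not_mem hξ' hF)) (by have := hA.1; positivity)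
  have h4 := Finset.single_le_sum (f := fun ξ : Fin d → ℤ => euclNorm (toRow ξ))
    (fun _ _ => euclNorm_nonneg _) hξ
  have := hL l hl
  linarith

/-- The limiting variance of a trigonometric polynomial. -/
noncomputable def polyVariance (A : Matrix (Fin d) (Fin d) ℝ) (c : (Fin d → ℤ) → ℂ)
    (F : Finset (Fin d → ℤ)) : ℂ :=
  ∑' l, (if l = 0 then 1 else 2) * resonance A c F 0 l

theorem tendsto_resonance_mean (hA : ExpandsBy A q) (hF : 0 ∉ F) :
    Tendsto (fun N : ℕ => (N : ℂ)⁻¹ * ∑ a ∈ Finset.range N, ∑ b ∈ Finset.range N,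
      resonance A c F a b) atTop (𝓝 (polyVariance A c F)) := by
  obtain ⟨L, hL⟩ := exists_half_le_euclNorm hA hF
  refine tendsto_cesaro_double resonance_symm (u := fun l => ‖resonance A c F 0 l‖)
    (summable_of_ne_finset_zero (s := Finset.range L) fun l hl => ?_) (fun k l => ?_) fun l => ?_
  · rw [norm_eq_zero]
    refine Finset.sum_eq_zero fun i hi => if_neg fun h0 => ?_
    rw [Finset.mem_product] at hi
    have := hL l (by simpa using hl) _ hi.1 _ hi.2
    rw [pow_zero, Matrix.vecMul_one] at h0
    rw [h0, euclNorm_zero] at this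
    norm_num at this
  · rw [resonance_add hA]
  · simp only [resonance_add hA]
    exact tendsto_const_nhds

theorem BddCont.trigPoly_mul (a b : ℕ) :
    BddCont fun x => RieszRaikov.trigPoly c F (A ^ a *ᵥ x) *
      RieszRaikov.trigPoly c F (A ^ b *ᵥ x) :=
  ((BddCont.trigPoly c F).comp_mulVec _).mul ((BddCont.trigPoly c F).comp_mulVec _)

/-- Correlations under `μ` vanish beyond a fixed lag, and at each fixed lag they eventually equal
the resonance times the mass, so the double Cesàro limit applies. -/
theorem tendsto_integral_mean (hA : ExpandsBy A q) (hF : 0 ∉ F) (hμ : BandLimited μ) :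
    Tendsto (fun N : ℕ => (N : ℂ)⁻¹ * ∑ a ∈ Finset.range N, ∑ b ∈ Finset.range N,
      ∫ x, trigPoly c F (A ^ (a + 1) *ᵥ x) * trigPoly c F (A ^ (b + 1) *ᵥ x) ∂μ) atTop
      (𝓝 (μ.real Set.univ * polyVariance A c F)) := by
  obtain ⟨L, hL⟩ := exists_half_le_euclNorm hA hF
  obtain ⟨B, hB⟩ := (BddCont.trigPoly c F).2
  have key := tendsto_cesaro_double
    (H := fun a b => ∫ x, trigPoly c F (A ^ (a + 1) *ᵥ x) * trigPoly c F (A ^ (b + 1) *ᵥ x) ∂μ)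
    (fun a b => by simp only [mul_comm])
    (u := fun l => if l < L then B * B * μ.real Set.univ else 0)
    (g := fun l => μ.real Set.univ * resonance A c F 0 l)
    (summable_of_ne_finset_zero (s := Finset.range L) fun l hl => ?_) (fun k l => ?_) fun l => ?_
  · simp only [mul_left_comm _ (μ.real Set.univ : ℂ)] at key
    rw [tsum_mul_left] at key
    exact key
  · rw [Finset.mem_range] at hl; simp [hl]
  · split_ifs with hl
    · refine norm_integral_le_of_norm_le_const (ae_of_all _ fun x => ?_)
      rw [norm_mul]
      exact mul_le_mul (hB _) (hB _) (norm_nonneg _) ((norm_nonneg _).trans (hB 0))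
    · rw [show k + l + 1 = k + 1 + l by ring]
      have h1 : ∀ x, trigPoly c F (A ^ (k + 1) *ᵥ x) * trigPoly c F (A ^ (k + 1 + l) *ᵥ x) =
          ∑ i ∈ F ×ˢ F, c i.1 * c i.2 *
            expo ((toRow i.1 + toRow i.2 ᵥ* A ^ l) ᵥ* A ^ (k + 1)) x := by
        intro x
        rw [trigPoly_mulVec, trigPoly_mulVec, Finset.sum_mul_sum, ← Finset.sum_product']
        refine Finset.sum_congr rfl fun i _ => ?_
        rw [← vecMul_pow_add_split, expo_add]; ring
      simp only [h1]
      rw [integral_finsetSum _ fun i _ => ((BddCont.expo _).integrable μ).const_mul _]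
      refine le_of_eq (norm_eq_zero.2 (Finset.sum_eq_zero fun i hi => ?_))
      rw [Finset.mem_product] at hi
      rw [integral_const_mul, hμ _ ((hL l (not_lt.1 hl) _ hi.1 _ hi.2).trans
        (hA.le_vecMul_pow _ _)), mul_zero]
  -- The non-resonant part at lag `l` is killed by `μ` for large `k`; the shift by one comes from
  -- sums that start at `A ^ 1`.
  · have h1 := (tendsto_add_atTop_iff_nat 1).2 (tendsto_const_nhds (x := (0 : ℂ)) |>.congr'
      ((eventually_integral_eq_zero hA hμ
      (trigPoly_mul_sub_resonance_mem (A := A) c F 0 l)).mono fun k hk => hk.symm))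
    have h2 := h1.const_add (μ.real Set.univ * resonance A c F 0 l)
    rw [add_zero] at h2
    refine h2.congr fun k => ?_
    have h3 : ∀ x, trigPoly c F (A ^ 0 *ᵥ (A ^ (k + 1) *ᵥ x)) *
        trigPoly c F (A ^ l *ᵥ (A ^ (k + 1) *ᵥ x)) =
        trigPoly c F (A ^ (k + 1) *ᵥ x) * trigPoly c F (A ^ (k + l + 1) *ᵥ x) := by
      intro x
      rw [pow_zero, Matrix.one_mulVec, Matrix.mulVec_mulVec, ← pow_add,
        show l + (k + 1) = k + l + 1 by ring]
    simp only [h3]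
    rw [integral_sub ((BddCont.trigPoly_mul _ _).integrable μ) (integrable_const _),
      integral_const, Complex.real_smul]
    ring

theorem trigPoly_mem_highSpan (hF : 0 ∉ F) (k : ℕ) :
    (fun x => trigPoly c F (A ^ k *ᵥ x)) ∈ highSpan A k := by
  have : (fun x => trigPoly c F (A ^ k *ᵥ x)) = ∑ ξ ∈ F, c ξ • expo (toRow ξ ᵥ* A ^ k) := by
    ext x; simp [trigPoly_mulVec]
  rw [this]
  exact Submodule.sum_mem _ fun ξ hξ => Submodule.smul_mem _ _ (Submodule.subset_span
    ⟨_, one_le_euclNorm_toRow (ne_of_mem_of_not_mem hξ hF), rfl⟩)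

/-- The new frequencies are `(ξ + vA^(k'-k))A^k`, and the gap `g` is long enough for the bracket to
keep norm at least `q^g - ‖ξ‖ ≥ 1`: a later factor always dominates an earlier one. -/
theorem trigPoly_mul_mem_highSpan (hA : ExpandsBy A q) {g : ℕ}
    (hg : ∀ ξ ∈ F, euclNorm (toRow ξ) + 1 ≤ q ^ g) {k k' : ℕ} (hk : k + g ≤ k')
    {h : (Fin d → ℝ) → ℂ} (hh : h ∈ highSpan A k') :
    (fun x => trigPoly c F (A ^ k *ᵥ x)) * h ∈ highSpan A k := by
  induction hh using Submodule.span_induction with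
  | mem h hh =>
    obtain ⟨v, hv, rfl⟩ := hh
    have : (fun x => trigPoly c F (A ^ k *ᵥ x)) * expo (v ᵥ* A ^ k') =
        ∑ ξ ∈ F, c ξ • expo ((toRow ξ + v ᵥ* A ^ (k' - k)) ᵥ* A ^ k) := by
      ext x
      rw [Pi.mul_apply, trigPoly_mulVec, Finset.sum_mul, Finset.sum_apply]
      refine Finset.sum_congr rfl fun ξ _ => ?_
      rw [← vecMul_pow_add_split, Pi.smul_apply, expo_add, smul_eq_mul, mul_assoc,
        Nat.add_sub_of_le (by omega)]
    rw [this]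
    refine Submodule.sum_mem _ fun ξ hξ => Submodule.smul_mem _ _ (Submodule.subset_span
      ⟨_, ?_, rfl⟩)
    have h1 := le_euclNorm_add (toRow ξ) (v ᵥ* A ^ (k' - k))
    have h2 := hA.vecMul_pow v (k' - k)
    have h3 : q ^ g ≤ q ^ (k' - k) := pow_le_pow_right₀ hA.1.le (by omega)
    have h4 : q ^ (k' - k) ≤ q ^ (k' - k) * euclNorm v :=
      le_mul_of_one_le_right (by have := hA.1; positivity) hv
    linarith [hg ξ hξ]
  | zero => rw [mul_zero]; exact Submodule.zero_mem _
  | add h h' _ _ h1 h2 => rw [mul_add]; exact Submodule.add_mem _ h1 h2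
  | smul a h _ h1 => rw [mul_smul_comm]; exact Submodule.smul_mem _ _ h1

/-- Expanding the product, each term other than `1` takes at most one frequency from each block, and
the gaps prevent cancellation between blocks. The induction peels off the earliest block, hence `k`
varies. -/
theorem prod_block_sub_one_mem_highSpan (hA : ExpandsBy A q) (hF : 0 ∉ F) {g n m : ℕ}
    (hg : ∀ ξ ∈ F, euclNorm (toRow ξ) + 1 ≤ q ^ g) (hm : n + g ≤ m) (w : ℂ) (J k : ℕ) :
    (fun x => ∏ j ∈ Finset.range J, (1 + w * ∑ a ∈ Finset.range n,
      trigPoly c F (A ^ (k + j * m + a) *ᵥ x)) - 1) ∈ highSpan A k := by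
  induction J generalizing k with
  | zero =>
    simp only [Finset.range_zero, Finset.prod_empty, sub_self]
    exact Submodule.zero_mem _
  | succ J ih =>
    set Q : (Fin d → ℝ) → ℂ := fun x => ∏ j ∈ Finset.range J, (1 + w * ∑ a ∈ Finset.range n,
      trigPoly c F (A ^ (k + m + j * m + a) *ᵥ x)) - 1 with hQdef
    have hQ : Q ∈ highSpan A (k + m) := ih (k + m)
    -- With `S` the first block sum and `1 + Q` the remaining product, `(1 + wS)(1 + Q) - 1 = Q + wS
    -- + wSQ`.
    have h1 : (fun x => ∏ j ∈ Finset.range (J + 1), (1 + w * ∑ a ∈ Finset.range n,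
        trigPoly c F (A ^ (k + j * m + a) *ᵥ x)) - 1) =
        Q + w • ∑ a ∈ Finset.range n, (fun x => trigPoly c F (A ^ (k + a) *ᵥ x)) +
        w • ∑ a ∈ Finset.range n, (fun x => trigPoly c F (A ^ (k + a) *ᵥ x)) * Q := by
      ext x
      rw [Finset.prod_range_succ']
      have h2 : ∀ j, k + (j + 1) * m = k + m + j * m := fun j => by ring
      simp only [h2, zero_mul, add_zero, Pi.add_apply, Pi.smul_apply, Finset.sum_apply,
        Pi.mul_apply, smul_eq_mul, ← Finset.sum_mul]
      simp only [hQdef]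
      ring
    rw [h1]
    refine Submodule.add_mem _ (Submodule.add_mem _ (highSpan_antitone hA (by omega) hQ)
      (Submodule.smul_mem _ _ (Submodule.sum_mem _ fun a _ =>
        highSpan_antitone hA (by omega) (trigPoly_mem_highSpan hF (k + a)))))
      (Submodule.smul_mem _ _ (Submodule.sum_mem _ fun a ha => ?_))
    rw [Finset.mem_range] at ha
    exact highSpan_antitone hA (by omega : k ≤ k + a)
      (trigPoly_mul_mem_highSpan hA hg (by omega) hQ)

end TrigPoly

theorem norm_exp_mul_I_sub_le (α β : ℝ) :
    ‖Complex.exp (α * Complex.I) - Complex.exp (β * Complex.I)‖ ≤ |α - β| := by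
  have h : Complex.exp (α * Complex.I) - Complex.exp (β * Complex.I) =
      Complex.exp (β * Complex.I) * (Complex.exp (Complex.I * ((α - β : ℝ) : ℂ)) - 1) := by
    rw [mul_sub, ← Complex.exp_add, mul_one]
    congr 2
    push_cast
    ring
  rw [h, norm_mul, Complex.norm_exp_ofReal_mul_I, one_mul]
  exact Real.norm_exp_I_mul_ofReal_sub_one_le

section RealTrigPoly

variable {d : ℕ} {A : Matrix (Fin d) (Fin d) ℝ} {q : ℝ} {μ : Measure (Fin d → ℝ)}
  [IsFiniteMeasure μ] {c : (Fin d → ℤ) → ℂ} {F : Finset (Fin d → ℤ)} {p : (Fin d → ℝ) → ℝ}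

theorem continuous_of_eq_trigPoly (hp : ∀ x, (p x : ℂ) = trigPoly c F x) : Continuous p := by
  have : p = fun x => (trigPoly c F x).re := by ext x; rw [← hp, Complex.ofReal_re]
  rw [this]
  exact Complex.continuous_re.comp (BddCont.trigPoly c F).1

theorem exists_abs_le_of_eq_trigPoly (hp : ∀ x, (p x : ℂ) = trigPoly c F x) :
    ∃ B, ∀ x, |p x| ≤ B := by
  obtain ⟨B, hB⟩ := (BddCont.trigPoly c F).2
  refine ⟨B, fun x => ?_⟩
  have := hB x
  rwa [← hp, Complex.norm_real] at this

theorem sq_block_sub_mem_nonzeroSpan (hp : ∀ x, (p x : ℂ) = trigPoly c F x) (n : ℕ) :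
    (fun x => (((∑ a ∈ Finset.range n, p (A ^ a *ᵥ x)) ^ 2 : ℝ) : ℂ) -
      ∑ a ∈ Finset.range n, ∑ b ∈ Finset.range n, resonance A c F a b) ∈ nonzeroSpan d := by
  have : (fun x => (((∑ a ∈ Finset.range n, p (A ^ a *ᵥ x)) ^ 2 : ℝ) : ℂ) -
      ∑ a ∈ Finset.range n, ∑ b ∈ Finset.range n, resonance A c F a b) =
      ∑ a ∈ Finset.range n, ∑ b ∈ Finset.range n, (fun x =>
        trigPoly c F (A ^ a *ᵥ x) * trigPoly c F (A ^ b *ᵥ x) - resonance A c F a b) := by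
    ext x
    simp only [Finset.sum_apply, Finset.sum_sub_distrib, ← Finset.sum_mul_sum]
    push_cast
    simp only [hp]
    ring
  rw [this]
  exact Submodule.sum_mem _ fun a _ => Submodule.sum_mem _ fun b _ =>
    trigPoly_mul_sub_resonance_mem c F a b

/-- Composing the squared block with a large power of `A` makes its oscillating part integrate to
zero, so its mean value is a normalised integral of a square. This is where real-valuedness of `p`
gives positivity. -/
theorem exists_block_mean (hA : ExpandsBy A q) (hμ : BandLimited μ) (hμ0 : μ ≠ 0)
    (hp : ∀ x, (p x : ℂ) = trigPoly c F x) (n : ℕ) :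
    ∃ r : ℝ, 0 ≤ r ∧
      (r : ℂ) = ∑ a ∈ Finset.range n, ∑ b ∈ Finset.range n, resonance A c F a b := by
  set z := ∑ a ∈ Finset.range n, ∑ b ∈ Finset.range n, resonance A c F a b with hz
  have hmem := sq_block_sub_mem_nonzeroSpan (A := A) hp n
  rw [← hz] at hmem
  obtain ⟨k, hk⟩ := (eventually_integral_eq_zero hA hμ hmem).exists
  have hcont : BddCont (fun x => (((∑ a ∈ Finset.range n, p (A ^ a *ᵥ x)) ^ 2 : ℝ) : ℂ)) := by
    have := (bddCont_of_mem_nonzeroSpan hmem).add (BddCont.const z)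
    convert this using 1
    ext x
    simp
  rw [integral_sub ((hcont.comp_mulVec _).integrable μ) (integrable_const _), integral_const,
    integral_complex_ofReal, sub_eq_zero, Complex.real_smul] at hk
  have hW : 0 < μ.real Set.univ := by
    have : NeZero μ := ⟨hμ0⟩
    exact measureReal_univ_pos
  refine ⟨(μ.real Set.univ)⁻¹ * ∫ x, (∑ a ∈ Finset.range n, p (A ^ a *ᵥ (A ^ k *ᵥ x))) ^ 2 ∂μ,
    mul_nonneg (by positivity) (integral_nonneg fun x => sq_nonneg _), ?_⟩
  rw [Complex.ofReal_mul, hk, ← mul_assoc, ← Complex.ofReal_mul, inv_mul_cancel₀ hW.ne']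
  simp

theorem exists_polyVariance_eq (hA : ExpandsBy A q) (hμ : BandLimited μ) (hμ0 : μ ≠ 0)
    (hF : 0 ∉ F) (hp : ∀ x, (p x : ℂ) = trigPoly c F x) :
    ∃ v : ℝ≥0, polyVariance A c F = ((v : ℝ) : ℂ) := by
  choose r hr0 hr using exists_block_mean (A := A) hA hμ hμ0 hp
  have h1 := tendsto_resonance_mean (c := c) hA hF
  simp only [← hr] at h1
  have h2 : Tendsto (fun N : ℕ => (N : ℝ)⁻¹ * r N) atTop (𝓝 (polyVariance A c F).re) := by
    refine ((Complex.continuous_re.tendsto _).comp h1).congr fun N => ?_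
    simp only [Function.comp]
    rw [← Complex.ofReal_natCast, ← Complex.ofReal_inv, ← Complex.ofReal_mul, Complex.ofReal_re]
  have h3 : 0 ≤ (polyVariance A c F).re :=
    ge_of_tendsto' h2 fun N => mul_nonneg (by positivity) (hr0 N)
  refine ⟨⟨_, h3⟩, tendsto_nhds_unique h1 ?_⟩
  refine ((Complex.continuous_ofReal.tendsto _).comp h2).congr fun N => ?_
  simp

/-- The `L²` law of large numbers for squared blocks: the centred square lies in `nonzeroSpan`, and
its translates are evaluated along an arithmetic progression. -/
theorem exists_integral_sum_sq_block_le (hA : ExpandsBy A q) (hμ : BandLimited μ)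
    (hp : ∀ x, (p x : ℂ) = trigPoly c F x) {n : ℕ} {r : ℝ}
    (hr : (r : ℂ) = ∑ a ∈ Finset.range n, ∑ b ∈ Finset.range n, resonance A c F a b) (k : ℕ) {m : ℕ}
    (hm : 0 < m) :
    ∃ C, ∀ J : ℕ, ∫ x, (∑ j ∈ Finset.range J,
      ((∑ a ∈ Finset.range n, p (A ^ (k + j * m + a) *ᵥ x)) ^ 2 - r)) ^ 2 ∂μ ≤ C * J := by
  have hmem := sq_block_sub_mem_nonzeroSpan (A := A) hp n
  rw [← hr] at hmem
  obtain ⟨C, -, hC⟩ := exists_integral_norm_sum_sq_le hA hμ hmem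
  refine ⟨C, fun J => ?_⟩
  have hinj : Function.Injective fun j => k + j * m := fun i j hij => by
    have : i * m = j * m := by simpa using hij
    exact Nat.eq_of_mul_eq_mul_right hm this
  have h1 := hC ((Finset.range J).image fun j => k + j * m)
  rw [Finset.card_image_of_injective _ hinj, Finset.card_range] at h1
  refine le_trans (le_of_eq ?_) h1
  congr 1
  ext x
  rw [Finset.sum_image fun i _ j _ hij => hinj hij]
  simp only [Matrix.mulVec_mulVec, ← pow_add]
  simp only [← Complex.ofReal_sub, ← Complex.ofReal_sum, Complex.norm_real, Real.norm_eq_abs, sq_abs, add_comm _ (k + _)]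

end RealTrigPoly
-- Central limit theorem for trigonometric polynomials by blocks and gaps
section TrigCLT

variable {d : ℕ} {A : Matrix (Fin d) (Fin d) ℝ} {q : ℝ} {μ : Measure (Fin d → ℝ)}
  [IsFiniteMeasure μ] {c : (Fin d → ℤ) → ℂ} {F : Finset (Fin d → ℤ)} {p : (Fin d → ℝ) → ℝ}

theorem continuous_normalizedSum (hp : Continuous p) (N : ℕ) : Continuous (normalizedSum A p N) := by
  unfold normalizedSum
  exact continuous_const.mul (continuous_finsetSum _ fun k _ => hp.comp (continuous_mulVec _))

theorem normalizedSum_eq_range (N : ℕ) (x : Fin d → ℝ) :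
    normalizedSum A p N x = (1 / √(N : ℝ)) * ∑ k ∈ Finset.range N, p (A ^ (k + 1) *ᵥ x) := by
  rw [normalizedSum, Finset.sum_bij' (fun k _ => k - 1) (fun k _ => k + 1)]
  · intro k hk; simp only [Finset.mem_Icc, Finset.mem_range] at *; omega
  · intro k hk; simp only [Finset.mem_Icc, Finset.mem_range] at *; omega
  · intro k hk; simp only [Finset.mem_Icc] at hk; omega
  · intro k _; simp
  · intro k hk
    simp only [Finset.mem_Icc] at hk
    rw [Nat.sub_add_cancel hk.1]

theorem tendsto_integral_normalizedSum_sq (hA : ExpandsBy A q) (hF : 0 ∉ F) (hμ : BandLimited μ)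
    (hp : ∀ x, (p x : ℂ) = trigPoly c F x) {v : ℝ≥0} (hv : polyVariance A c F = ((v : ℝ) : ℂ)) :
    Tendsto (fun N => ∫ x, normalizedSum A p N x ^ 2 ∂μ) atTop (𝓝 (μ.real Set.univ * v)) := by
  have h1 := tendsto_integral_mean hA hF hμ (c := c)
  rw [hv, ← Complex.ofReal_mul] at h1
  have h2 := (Complex.continuous_re.tendsto _).comp h1
  rw [Complex.ofReal_re] at h2
  refine h2.congr fun N => ?_
  have h3 : ∀ x, ((normalizedSum A p N x ^ 2 : ℝ) : ℂ) = (N : ℂ)⁻¹ * ∑ a ∈ Finset.range N,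
      ∑ b ∈ Finset.range N, trigPoly c F (A ^ (a + 1) *ᵥ x) * trigPoly c F (A ^ (b + 1) *ᵥ x) := by
    intro x
    rw [← Finset.sum_mul_sum, normalizedSum_eq_range, mul_pow, div_pow, Real.sq_sqrt
      (Nat.cast_nonneg _)]
    push_cast
    simp only [hp]
    ring
  have h4 : ((∫ x, normalizedSum A p N x ^ 2 ∂μ : ℝ) : ℂ) = (N : ℂ)⁻¹ * ∑ a ∈ Finset.range N,
      ∑ b ∈ Finset.range N,
        ∫ x, trigPoly c F (A ^ (a + 1) *ᵥ x) * trigPoly c F (A ^ (b + 1) *ᵥ x) ∂μ := by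
    rw [← integral_complex_ofReal]
    simp only [h3]
    rw [integral_const_mul, integral_finsetSum]
    · congr 1
      exact Finset.sum_congr rfl fun a _ => integral_finsetSum _ fun b _ =>
        (BddCont.trigPoly_mul _ _).integrable μ
    · exact fun a _ => integrable_finsetSum _ fun b _ => (BddCont.trigPoly_mul _ _).integrable μ
  simp only [Function.comp]
  rw [← h4, Complex.ofReal_re]

/-- The indices in the first `J` blocks of length `n`, with period `m`, starting at `k`. -/
def blockIndices (k m n J : ℕ) : Finset ℕ :=
  (Finset.range J ×ˢ Finset.range n).image fun i => k + i.1 * m + i.2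

theorem blockIndices_injOn {k m n J : ℕ} (hnm : n ≤ m) :
    Set.InjOn (fun i : ℕ × ℕ => k + i.1 * m + i.2)
      (Finset.range J ×ˢ Finset.range n : Finset (ℕ × ℕ)) := by
  rintro ⟨j, a⟩ h1 ⟨j', a'⟩ h2 h
  simp only [Finset.coe_product, Finset.coe_range, Set.mem_prod, Set.mem_Iio] at h1 h2 h
  have hm : 0 < m := by omega
  have h3 : (a + j * m) / m = (a' + j' * m) / m := by congr 1; omega
  rw [Nat.add_mul_div_right _ _ hm, Nat.add_mul_div_right _ _ hm, Nat.div_eq_of_lt (by omega),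
    Nat.div_eq_of_lt (by omega), zero_add, zero_add] at h3
  subst h3
  simp only [Prod.mk.injEq, true_and]
  omega

theorem sum_blockIndices {k m n J : ℕ} (hnm : n ≤ m) (w : ℕ → ℝ) :
    ∑ i ∈ blockIndices k m n J, w i =
      ∑ j ∈ Finset.range J, ∑ a ∈ Finset.range n, w (k + j * m + a) := by
  rw [blockIndices, Finset.sum_image (blockIndices_injOn hnm), Finset.sum_product]

theorem card_blockIndices {k m n J : ℕ} (hnm : n ≤ m) : (blockIndices k m n J).card = J * n := by
  rw [blockIndices, Finset.card_image_of_injOn (blockIndices_injOn hnm), Finset.card_product,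
    Finset.card_range, Finset.card_range]

/-- The number of blocks is the number of full periods that fit after `k`; for `N < k` truncated
subtraction gives none. -/
theorem blockIndices_subset {k m n N : ℕ} (hk : 0 < k) (hnm : n ≤ m) :
    blockIndices k m n ((N - k) / m) ⊆ Finset.Icc 1 N := by
  intro i hi
  simp only [blockIndices, Finset.mem_image, Finset.mem_product, Finset.mem_range] at hi
  obtain ⟨⟨j, a⟩, ⟨hj, ha⟩, rfl⟩ := hi
  have h1 : (j + 1) * m ≤ (N - k) / m * m := Nat.mul_le_mul_right m hj
  have h2 := Nat.div_mul_le_self (N - k) m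
  rw [add_mul, one_mul] at h1
  rw [Finset.mem_Icc]
  simp only at ha ⊢
  omega

/-- What is left out: indices before `k`, an incomplete last period, and `g` indices per full
period. -/
theorem card_sdiff_blockIndices_le {k n g N : ℕ} (hk : 0 < k) (hn : 0 < n) :
    ((Finset.Icc 1 N \ blockIndices k (n + g) n ((N - k) / (n + g))).card : ℝ) ≤
      k + (n + g) + g * (N / (n + g)) := by
  set J := (N - k) / (n + g) with hJ
  have h1 := Finset.card_sdiff_add_card_eq_card
    (blockIndices_subset (N := N) hk (Nat.le_add_right n g))
  rw [card_blockIndices (Nat.le_add_right n g), Nat.card_Icc, ← hJ] at h1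
  have hpos : 0 < n + g := by omega
  have h2 : J * (n + g) ≤ N - k := Nat.div_mul_le_self _ _
  have h3 : N - k < J * (n + g) + (n + g) := Nat.lt_div_mul_add hpos
  have h4 : (Finset.Icc 1 N \ blockIndices k (n + g) n J).card ≤ k + (n + g) + g * J := by
    have h5 : J * (n + g) = J * n + g * J := by ring
    omega
  have h6 : (J : ℝ) ≤ N / (n + g) := by
    rw [le_div_iff₀ (by exact_mod_cast hpos)]
    exact_mod_cast h2.trans (Nat.sub_le _ _)
  calc ((Finset.Icc 1 N \ blockIndices k (n + g) n J).card : ℝ) ≤ k + (n + g) + g * J := by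
        exact_mod_cast h4
    _ ≤ _ := by gcongr

theorem tendsto_nat_sub_div_div (k : ℕ) {m : ℕ} (hm : 0 < m) :
    Tendsto (fun N : ℕ => (((N - k) / m : ℕ) : ℝ) / N) atTop (𝓝 (1 / m)) := by
  have hm' : (0 : ℝ) < m := by exact_mod_cast hm
  have h1 : Tendsto (fun N : ℕ => 1 / (m : ℝ) - ((k + m : ℝ) / m) / N) atTop (𝓝 (1 / m - 0)) :=
    tendsto_const_nhds.sub (tendsto_const_div_atTop_nhds_zero_nat _)
  rw [sub_zero] at h1
  refine tendsto_of_tendsto_of_tendsto_of_le_of_le' h1 tendsto_const_nhds ?_ ?_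
  · filter_upwards [eventually_gt_atTop 0] with N hN
    have hN' : (0 : ℝ) < N := by exact_mod_cast hN
    have h2 : N ≤ (N - k) / m * m + (k + m) := by
      have := Nat.lt_div_mul_add (a := N - k) hm
      omega
    have h3 : (N : ℝ) ≤ ((N - k) / m : ℕ) * m + (k + m) := by exact_mod_cast h2
    rw [div_sub_div _ _ hm'.ne' hN'.ne', div_le_div_iff₀ (by positivity) hN']
    have h4 : (1 * (N : ℝ) - m * ((k + m) / m)) = N - (k + m) := by field_simp
    rw [h4]
    nlinarith
  · filter_upwards [eventually_gt_atTop 0] with N hN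
    have hN' : (0 : ℝ) < N := by exact_mod_cast hN
    rw [div_le_div_iff₀ hN' hm', one_mul]
    exact_mod_cast (Nat.div_mul_le_self _ _).trans (Nat.sub_le _ _)

/-- An instance of `tendsto_integral_exp_sum` with `s = t/√N`, for which `s² J → t²/(n+g)`. The
product integrals are exact because the blocks start at `k`, where `q^k` already beats the frequency
`ζ`. -/
theorem tendsto_integral_blocks (hA : ExpandsBy A q) (hF : 0 ∉ F) (hμ : BandLimited μ)
    (hp : ∀ x, (p x : ℂ) = trigPoly c F x) {g : ℕ} (hg : ∀ ξ ∈ F, euclNorm (toRow ξ) + 1 ≤ q ^ g)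
    {n : ℕ} (hn : 0 < n) {r : ℝ} (hr0 : 0 ≤ r)
    (hr : (r : ℂ) = ∑ a ∈ Finset.range n, ∑ b ∈ Finset.range n, resonance A c F a b)
    {ζ : Fin d → ℝ} {k : ℕ} (hk : 1 / 2 + euclNorm ζ ≤ q ^ k) (t : ℝ) :
    Tendsto (fun N : ℕ => ∫ x, expo ζ x * Complex.exp (((t / √(N : ℝ) *
      ∑ j ∈ Finset.range ((N - k) / (n + g)), ∑ a ∈ Finset.range n,
        p (A ^ (k + j * (n + g) + a) *ᵥ x) : ℝ) : ℂ) * Complex.I) ∂μ) atTop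
      (𝓝 ((∫ x, expo ζ x ∂μ) * (Real.exp (-(t ^ 2 * (1 / (n + g : ℕ)) * r / 2)) : ℝ))) := by
  have hm : 0 < n + g := by omega
  have hpc := continuous_of_eq_trigPoly hp
  obtain ⟨B, hB⟩ := exists_abs_le_of_eq_trigPoly hp
  obtain ⟨C, hC⟩ := exists_integral_sum_sq_block_le hA hμ hp hr k hm
  refine tendsto_integral_exp_sum
    (Y := fun j x => ∑ a ∈ Finset.range n, p (A ^ (k + j * (n + g) + a) *ᵥ x)) (B := n * B)
    (s := fun N => t / √(N : ℝ)) (J := fun N => (N - k) / (n + g)) (C := C)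
    ?_ ?_ (continuous_expo ζ).measurable (fun x => (norm_expo ζ x).le) ?_ hr0 hC ?_ ?_
  · exact fun j => (continuous_finsetSum _ fun a _ =>
      hpc.comp (continuous_mulVec _)).measurable
  · intro j x
    refine (Finset.abs_sum_le_sum_abs _ _).trans ((Finset.sum_le_sum fun a _ => hB _).trans ?_)
    simp
  · intro J s
    have h1 := prod_block_sub_one_mem_highSpan (c := c) hA hF hg le_rfl (s * Complex.I) J k (n := n)
    have h2 := integral_expo_mul_eq_zero hA hμ hk h1
    have h3 := ((BddCont.expo ζ).mul (bddCont_of_mem_highSpan h1)).integrable μ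
    have h4 := integral_add h3 ((BddCont.expo ζ).integrable μ)
    simp only [Pi.mul_apply] at h4
    rw [h2, zero_add] at h4
    rw [← h4]
    congr 1
    ext x
    rw [mul_sub, mul_one, sub_add_cancel]
    congr 1
    refine Finset.prod_congr rfl fun j _ => ?_
    push_cast
    simp only [hp]
    ring
  · exact tendsto_const_nhds.div_atTop
      (Real.tendsto_sqrt_atTop.comp tendsto_natCast_atTop_atTop)
  · refine ((tendsto_nat_sub_div_div k hm).const_mul (t ^ 2)).congr fun N => ?_
    rw [div_pow, Real.sq_sqrt (Nat.cast_nonneg _)]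
    ring

/-- Since `θ ↦ e^{iθ}` is 1-Lipschitz, the error is at most `|t|` times the `L¹` norm of the
discarded sum, which the `L²` bound controls through the number of discarded indices. -/
theorem norm_integral_sub_blocks_le (hp : ∀ x, (p x : ℂ) = trigPoly c F x) {C : ℝ} (hC0 : 0 ≤ C)
    (hC : ∀ E : Finset ℕ, ∫ x, ‖∑ k ∈ E, trigPoly c F ((A ^ k) *ᵥ x)‖ ^ 2 ∂μ ≤ C * E.card)
    (g : ℕ) {n : ℕ} (hn : 0 < n) {ζ : Fin d → ℝ} {k : ℕ} (hk : 0 < k) (t : ℝ) (N : ℕ) :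
    ‖(∫ x, expo ζ x * Complex.exp (((t * normalizedSum A p N x : ℝ) : ℂ) * Complex.I) ∂μ) -
      ∫ x, expo ζ x * Complex.exp (((t / √(N : ℝ) *
      ∑ j ∈ Finset.range ((N - k) / (n + g)), ∑ a ∈ Finset.range n,
        p (A ^ (k + j * (n + g) + a) *ᵥ x) : ℝ) : ℂ) * Complex.I) ∂μ‖ ≤
      |t| * (√(μ.real Set.univ) * √(C * ((k + (n + g)) / N + g / (n + g)))) := by
  have hpc := continuous_of_eq_trigPoly hp
  set B := blockIndices k (n + g) n ((N - k) / (n + g)) with hBdef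
  set E := Finset.Icc 1 N \ B with hE
  have hsum : ∀ x, normalizedSum A p N x = (1 / √(N : ℝ)) * ∑ i ∈ E, p (A ^ i *ᵥ x) +
      1 / √(N : ℝ) * ∑ j ∈ Finset.range ((N - k) / (n + g)), ∑ a ∈ Finset.range n,
        p (A ^ (k + j * (n + g) + a) *ᵥ x) := by
    intro x
    rw [normalizedSum, ← mul_add, ← sum_blockIndices (Nat.le_add_right n g)
      (fun i => p (A ^ i *ᵥ x)), hE, Finset.sum_sdiff
      (blockIndices_subset hk (Nat.le_add_right n g))]
  have hint : ∀ θ : (Fin d → ℝ) → ℝ, Continuous θ →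
      Integrable (fun x => expo ζ x * Complex.exp ((θ x : ℂ) * Complex.I)) μ := fun θ hθ => by
    refine BddCont.integrable ((BddCont.expo ζ).mul ⟨by fun_prop, 1, fun x => ?_⟩) μ
    rw [Complex.norm_exp_ofReal_mul_I]
  have hcE : Continuous fun x => ∑ i ∈ E, p (A ^ i *ᵥ x) :=
    continuous_finsetSum _ fun k _ => hpc.comp (continuous_mulVec _)
  have hL2 : MemLp (fun x => ∑ i ∈ E, trigPoly c F (A ^ i *ᵥ x)) 2 μ :=
    (BddCont.sum fun i _ => (BddCont.trigPoly c F).comp_mulVec _).memLp μ 2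
  rw [← integral_sub]
  rotate_left
  · exact hint _ ((continuous_normalizedSum hpc N).const_mul t)
  · exact hint _ (continuous_const.mul (continuous_finsetSum _ fun j _ =>
      continuous_finsetSum _ fun a _ => hpc.comp (continuous_mulVec _)))
  have h1 : ∀ x, ‖expo ζ x * Complex.exp (((t * normalizedSum A p N x : ℝ) : ℂ) * Complex.I) -
      expo ζ x * Complex.exp (((t / √(N : ℝ) *
      ∑ j ∈ Finset.range ((N - k) / (n + g)), ∑ a ∈ Finset.range n,
        p (A ^ (k + j * (n + g) + a) *ᵥ x) : ℝ) : ℂ) * Complex.I)‖ ≤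
      |t| * (1 / √(N : ℝ)) * ‖∑ i ∈ E, trigPoly c F (A ^ i *ᵥ x)‖ := by
    intro x
    rw [← mul_sub, norm_mul, norm_expo, one_mul]
    refine (norm_exp_mul_I_sub_le _ _).trans (le_of_eq ?_)
    rw [hsum x]
    simp only [← hp, ← Complex.ofReal_sum, Complex.norm_real, Real.norm_eq_abs]
    rw [← abs_of_nonneg (by positivity : (0 : ℝ) ≤ 1 / √(N : ℝ)), ← abs_mul, ← abs_mul,
      abs_of_nonneg (by positivity : (0 : ℝ) ≤ 1 / √(N : ℝ))]
    congr 1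
    ring
  refine (norm_integral_le_of_norm_le ((hL2.integrable (by norm_num)).norm.const_mul _)
    (ae_of_all _ h1)).trans ?_
  rw [integral_const_mul, mul_assoc]
  refine mul_le_mul_of_nonneg_left ?_ (abs_nonneg t)
  have h2 := integral_norm_le_sqrt_mul_sqrt hL2
  have h3 : √(∫ x, ‖∑ i ∈ E, trigPoly c F (A ^ i *ᵥ x)‖ ^ 2 ∂μ) ≤ √(C * E.card) :=
    Real.sqrt_le_sqrt (hC E)
  have h4 : 1 / √(N : ℝ) * √(C * E.card) ≤ √(C * ((k + (n + g)) / N + g / (n + g))) := by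
    rw [one_div, ← Real.sqrt_inv, ← Real.sqrt_mul (by positivity)]
    refine Real.sqrt_le_sqrt ?_
    rw [mul_left_comm]
    refine mul_le_mul_of_nonneg_left ?_ hC0
    rcases Nat.eq_zero_or_pos N with rfl | hN
    · simp; positivity
    · have hN' : (0 : ℝ) < N := by exact_mod_cast hN
      rw [inv_mul_le_iff₀ hN']
      refine (card_sdiff_blockIndices_le hk hn).trans (le_of_eq ?_)
      have : (0 : ℝ) < n + g := by positivity
      field_simp
  calc 1 / √(N : ℝ) * ∫ x, ‖∑ i ∈ E, trigPoly c F (A ^ i *ᵥ x)‖ ∂μ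
      ≤ 1 / √(N : ℝ) * (√(μ.real Set.univ) * √(C * E.card)) := by
        refine mul_le_mul_of_nonneg_left (h2.trans ?_) (by positivity)
        exact mul_le_mul_of_nonneg_left h3 (Real.sqrt_nonneg _)
    _ = √(μ.real Set.univ) * (1 / √(N : ℝ) * √(C * E.card)) := by ring
    _ ≤ _ := mul_le_mul_of_nonneg_left h4 (Real.sqrt_nonneg _)

/-- The gap `g` and the start `k` are fixed, and `N → ∞` for each block length `n`; then `n → ∞`.
The block variance per index `r_n/(n+g)` tends to `v`, and the gap error is governed by `g/(n+g) →
0`. -/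
theorem tendsto_charFun_trigPoly (hA : ExpandsBy A q) (hF : 0 ∉ F) (hμ : BandLimited μ)
    (hp : ∀ x, (p x : ℂ) = trigPoly c F x) {v : ℝ≥0} (hv : polyVariance A c F = ((v : ℝ) : ℂ))
    (ζ : Fin d → ℝ) (t : ℝ) :
    Tendsto (fun N => ∫ x, expo ζ x *
      Complex.exp (((t * normalizedSum A p N x : ℝ) : ℂ) * Complex.I) ∂μ) atTop
      (𝓝 ((∫ x, expo ζ x ∂μ) * (Real.exp (-(v * t ^ 2 / 2)) : ℝ))) := by
  rcases eq_or_ne μ 0 with rfl | hμ0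
  · simp
  obtain ⟨C, hC0, hC⟩ := exists_integral_norm_sum_sq_le hA hμ (trigPoly_mem_nonzeroSpan (c := c) hF)
  obtain ⟨g, hg⟩ : ∃ g : ℕ, ∀ ξ ∈ F, euclNorm (toRow ξ) + 1 ≤ q ^ g := by
    obtain ⟨g, hg⟩ := (eventually_le_pow_mul hA.1 (∑ ξ ∈ F, euclNorm (toRow ξ) + 1) one_pos).exists
    refine ⟨g, fun ξ hξ => ?_⟩
    have := Finset.single_le_sum (f := fun ξ : Fin d → ℤ => euclNorm (toRow ξ))
      (fun _ _ => euclNorm_nonneg _) hξ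
    linarith
  obtain ⟨k, hk, hk0⟩ := ((eventually_le_pow_mul hA.1 (1 / 2 + euclNorm ζ) one_pos).and
    (eventually_gt_atTop 0)).exists
  rw [mul_one] at hk
  choose r hr0 hr using exists_block_mean (A := A) hA hμ hμ0 hp
  have hrv : Tendsto (fun n : ℕ => (n : ℝ)⁻¹ * r n) atTop (𝓝 v) := by
    have h1 := tendsto_resonance_mean (c := c) hA hF
    rw [hv] at h1
    simp only [← hr] at h1
    refine ((Complex.continuous_re.tendsto _).comp h1).congr fun N => ?_
    simp only [Function.comp]
    rw [← Complex.ofReal_natCast, ← Complex.ofReal_inv, ← Complex.ofReal_mul, Complex.ofReal_re]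
  have hng : Tendsto (fun n : ℕ => (n : ℝ) / (n + g)) atTop (𝓝 1) :=
    tendsto_natCast_div_add_atTop (g : ℝ)
  have hlim1 : Tendsto (fun n : ℕ => (∫ x, expo ζ x ∂μ) *
      ((Real.exp (-(t ^ 2 * (1 / (n + g : ℕ)) * r n / 2)) : ℝ) : ℂ)) atTop
      (𝓝 ((∫ x, expo ζ x ∂μ) * (Real.exp (-(v * t ^ 2 / 2)) : ℝ))) := by
    refine Tendsto.const_mul _ ((Complex.continuous_ofReal.tendsto _).comp
      ((Real.continuous_exp.tendsto _).comp (Tendsto.neg ?_)))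
    have h1 := ((hng.mul hrv).mul_const (t ^ 2)).div_const 2
    rw [one_mul] at h1
    refine h1.congr' ?_
    filter_upwards [eventually_gt_atTop 0] with n hn
    have hn' : (0 : ℝ) < n := by exact_mod_cast hn
    have : (0 : ℝ) < n + g := by positivity
    push_cast
    field_simp
  have hlim2 : Tendsto (fun n : ℕ => |t| * (√(μ.real Set.univ) * √(C * (g / (n + g))))) atTop
      (𝓝 0) := by
    have h1 : Tendsto (fun n : ℕ => (g : ℝ) / (n + g)) atTop (𝓝 0) :=
      tendsto_const_nhds.div_atTop (tendsto_atTop_add_const_right _ _ tendsto_natCast_atTop_atTop)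
    have h2 := (((Real.continuous_sqrt.tendsto _).comp (h1.const_mul C)).const_mul
      √(μ.real Set.univ)).const_mul |t|
    simpa using h2
  refine tendsto_of_approx fun ε hε => ?_
  obtain ⟨n, h1, h2, hn⟩ := ((Metric.tendsto_nhds.1 hlim1 ε hε).and
    ((hlim2.eventually (eventually_lt_nhds hε)).and (eventually_gt_atTop 0))).exists
  refine ⟨_, _, tendsto_integral_blocks hA hF hμ hp hg hn (hr0 n) (hr n) hk t, h1.le, ?_⟩
  have hlim3 : Tendsto (fun N : ℕ => |t| * (√(μ.real Set.univ) *
      √(C * (((k : ℝ) + (n + g)) / N + g / (n + g))))) atTop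
      (𝓝 (|t| * (√(μ.real Set.univ) * √(C * (0 + g / (n + g)))))) :=
    (((Real.continuous_sqrt.tendsto _).comp (((tendsto_const_div_atTop_nhds_zero_nat _).add_const
      _).const_mul C)).const_mul _).const_mul _
  rw [zero_add] at hlim3
  filter_upwards [hlim3.eventually (eventually_lt_nhds h2)] with N hN
  rw [dist_eq_norm]
  exact (norm_integral_sub_blocks_le hp hC0 hC g hn hk0 t N).trans hN.le

end TrigCLT

/-! ### Construction of the band-limited measure -/

section Weight

open scoped FourierTransform SchwartzMap

variable {d : ℕ}

theorem fourier_compSubConst (ψ : 𝓢(EuclideanSpace ℝ (Fin d), ℂ)) (a y : EuclideanSpace ℝ (Fin d)) :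
    𝓕 (ψ.compSubConstCLM ℂ a) y =
      Complex.exp (((-(2 * Real.pi * inner ℝ a y) : ℝ) : ℂ) * Complex.I) * 𝓕 ψ y := by
  rw [SchwartzMap.fourier_coe, SchwartzMap.fourier_coe, Real.fourier_eq', Real.fourier_eq',
    ← integral_const_mul, ← integral_add_right_eq_self _ a]
  congr 1
  ext x
  rw [SchwartzMap.compSubConstCLM_apply, add_sub_cancel_right, smul_eq_mul, smul_eq_mul,
    ← mul_assoc, ← Complex.exp_add, inner_add_left]
  congr 2
  push_cast
  ring

/-- By Parseval the integral is the autocorrelation of `ψ` at `a`, which vanishes when `ψ` and its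
translate have no common support. -/
theorem integral_exp_mul_norm_sq_fourier_eq_zero (ψ : 𝓢(EuclideanSpace ℝ (Fin d), ℂ))
    {a : EuclideanSpace ℝ (Fin d)} (h : ∀ x, ψ x = 0 ∨ ψ (x - a) = 0) :
    ∫ y, Complex.exp (((-(2 * Real.pi * inner ℝ a y) : ℝ) : ℂ) * Complex.I) *
      ((‖𝓕 ψ y‖ ^ 2 : ℝ) : ℂ) = 0 := by
  have h1 := SchwartzMap.integral_inner_fourier_fourier ψ (ψ.compSubConstCLM ℂ a)
  have h2 : ∀ x, inner ℂ (ψ x) (ψ.compSubConstCLM ℂ a x) = 0 := by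
    intro x
    rw [SchwartzMap.compSubConstCLM_apply]
    rcases h x with h | h <;> simp [h]
  simp only [h2, integral_zero, fourier_compSubConst] at h1
  rw [← h1]
  congr 1
  ext y
  rw [RCLike.inner_apply, mul_assoc (Complex.exp _) (𝓕 ψ y), Complex.mul_conj, Complex.normSq_eq_norm_sq]

/-- A nonnegative bump function as a Schwartz function. -/
theorem exists_schwartz_bump {δ : ℝ} (hδ : 0 < δ) :
    ∃ ψ : 𝓢(EuclideanSpace ℝ (Fin d), ℂ), ∃ u : EuclideanSpace ℝ (Fin d) → ℝ,
      (∀ x, ψ x = u x) ∧ (∀ x, 0 ≤ u x) ∧ (∀ x, δ ≤ ‖x‖ → u x = 0) ∧ Integrable u ∧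
        0 < ∫ x, u x := by
  let b : ContDiffBump (0 : EuclideanSpace ℝ (Fin d)) := ⟨δ / 2, δ, by positivity, by linarith⟩
  have h1 : HasCompactSupport fun x => (b x : ℂ) :=
    b.hasCompactSupport.comp_left (g := fun r : ℝ => (r : ℂ)) Complex.ofReal_zero
  refine ⟨h1.toSchwartzMap (Complex.ofRealCLM.contDiff.comp b.contDiff), b, fun x => rfl,
    fun x => b.nonneg, fun x hx => ?_, b.integrable, b.integral_pos⟩
  exact b.zero_of_le_dist (by simpa using hx)

/-- On the support of `u` the phase is at most `1` in modulus, so its cosine is at least `1/2` and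
the real part of the transform is bounded below. -/
theorem half_integral_le_norm_fourier {ψ : 𝓢(EuclideanSpace ℝ (Fin d), ℂ)}
    {u : EuclideanSpace ℝ (Fin d) → ℝ} {δ R : ℝ} (hψ : ∀ x, ψ x = u x) (hu : ∀ x, 0 ≤ u x)
    (hδ : ∀ x, δ ≤ ‖x‖ → u x = 0) (hui : Integrable u)
    (hR : 2 * Real.pi * (δ * R) ≤ 1) {y : EuclideanSpace ℝ (Fin d)} (hy : ‖y‖ ≤ R) :
    1 / 2 * ∫ x, u x ≤ ‖𝓕 ψ y‖ := by
  refine le_trans ?_ (Complex.re_le_norm _)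
  rw [SchwartzMap.fourier_coe, Real.fourier_eq']
  have hint : Integrable fun x => Complex.exp (((-2 * Real.pi * inner ℝ x y : ℝ) : ℂ) * Complex.I)
      • ψ x := by
    refine Integrable.mono' hui ?_ (ae_of_all _ fun x => ?_)
    · have := ψ.continuous
      refine Continuous.aestronglyMeasurable ?_
      fun_prop
    · rw [norm_smul, Complex.norm_exp_ofReal_mul_I, one_mul, hψ, Complex.norm_real,
        Real.norm_of_nonneg (hu x)]
  rw [← RCLike.re_eq_complex_re, ← integral_re hint, ← integral_const_mul]
  refine integral_mono (hui.const_mul _) hint.re fun x => ?_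
  simp only [hψ, smul_eq_mul]
  change _ ≤ Complex.re _
  rw [Complex.re_mul_ofReal, Complex.exp_ofReal_mul_I_re]
  rcases le_or_gt δ ‖x‖ with hx | hx
  · simp [hδ x hx]
  · refine mul_le_mul_of_nonneg_right ?_ (hu x)
    have h1 : |-2 * Real.pi * inner ℝ x y| ≤ 1 := by
      rw [abs_mul, show |-2 * Real.pi| = 2 * Real.pi by
        rw [abs_mul, abs_of_pos Real.pi_pos]; norm_num]
      refine le_trans ?_ hR
      refine mul_le_mul_of_nonneg_left ?_ (by positivity)
      exact (abs_real_inner_le_norm x y).trans (mul_le_mul hx.le hy (norm_nonneg _)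
        ((norm_nonneg _).trans hx.le))
    have h2 := Real.one_sub_sq_div_two_le_cos (x := -2 * Real.pi * inner ℝ x y)
    have h3 : (-2 * Real.pi * inner ℝ x y) ^ 2 ≤ 1 := by
      rw [← sq_abs]; exact pow_le_one₀ (abs_nonneg _) h1
    linarith

/-- The density is `‖𝓕 ψ‖²` scaled to be at least `1` on the ball of radius `R`; its spectrum lies
in the difference set of the support of `ψ`. -/
theorem exists_bandLimited (d : ℕ) (R : ℝ) :
    ∃ μ : Measure (Fin d → ℝ), IsFiniteMeasure μ ∧ BandLimited μ ∧ μ ≠ 0 ∧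
      ∀ Γ : Set (Fin d → ℝ), (∀ x ∈ Γ, euclNorm x ≤ R) → volume.restrict Γ ≤ μ := by
  -- With `R ≥ 1` the measure dominates Lebesgue measure on the unit ball, which shows that it is
  -- nonzero.
  wlog hR1 : 1 ≤ R generalizing R
  · obtain ⟨μ, h1, h2, h3, h4⟩ := this 1 le_rfl
    exact ⟨μ, h1, h2, h3, fun Γ hΓ => h4 Γ fun x hx => (hΓ x hx).trans (by linarith)⟩
  have hR0 : 0 ≤ R := zero_le_one.trans hR1
  -- Two requirements: `2δ ≤ 1/2`, so that translates by vectors of norm at least `1/2` separate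
  -- supports, and `δR ≤ 1/8`, so that `2πδR ≤ 1`.
  set δ : ℝ := 1 / (8 * (R + 1)) with hδdef
  have hδ0 : 0 < δ := by positivity
  have hδ4 : δ ≤ 1 / 4 := by
    rw [hδdef]; gcongr; linarith
  have hδR : 2 * Real.pi * (δ * R) ≤ 1 := by
    have h1 : δ * R ≤ 1 / 8 := by
      rw [hδdef, div_mul_eq_mul_div, div_le_div_iff₀ (by positivity) (by norm_num)]; linarith
    nlinarith [Real.pi_lt_four, Real.pi_pos]
  obtain ⟨ψ, u, hψ, hu, huδ, hui, hupos⟩ := exists_schwartz_bump (d := d) hδ0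
  set m : ℝ := 1 / 2 * ∫ x, u x with hm
  have hm0 : 0 < m := by positivity
  set w : EuclideanSpace ℝ (Fin d) → ℝ := fun y => (m ^ 2)⁻¹ * ‖𝓕 ψ y‖ ^ 2 with hw
  have hw0 : ∀ y, 0 ≤ w y := fun y => by positivity
  have hwc : Continuous w := by have := (𝓕 ψ).continuous; fun_prop
  have hwi : Integrable w := by
    have := ((𝓕 ψ).memLp 2 (volume : Measure (EuclideanSpace ℝ (Fin d)))).integrable_norm_pow
      (by norm_num)
    exact this.const_mul _
  have hw1 : ∀ y, ‖y‖ ≤ R → 1 ≤ w y := fun y hy => by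
    have h1 := half_integral_le_norm_fourier hψ hu huδ hui hδR hy
    rw [hw]
    simp only
    rw [← div_eq_inv_mul, one_le_div (by positivity)]
    exact pow_le_pow_left₀ hm0.le h1 2
  set w' : (Fin d → ℝ) → ℝ := fun x => w (WithLp.toLp 2 x) with hw'
  have hvp := PiLp.volume_preserving_toLp (Fin d)
  have hemb : MeasurableEmbedding (WithLp.toLp 2 : (Fin d → ℝ) → EuclideanSpace ℝ (Fin d)) :=
    (MeasurableEquiv.toLp 2 (Fin d → ℝ)).measurableEmbedding
  have hw'i : Integrable w' := (hvp.integrable_comp_emb hemb).2 hwi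
  have hw'm : Measurable w' := (hwc.measurable).comp (WithLp.measurable_toLp 2 _)
  have hdens : ∀ Γ : Set (Fin d → ℝ), (∀ x ∈ Γ, euclNorm x ≤ R) →
      volume.restrict Γ ≤ volume.withDensity fun x => ENNReal.ofReal (w' x) := by
    intro Γ hΓ
    have hs : MeasurableSet {x : Fin d → ℝ | 1 ≤ w' x} := measurableSet_le measurable_const hw'm
    have h1 : (volume.restrict Γ) ≤ volume.restrict {x : Fin d → ℝ | 1 ≤ w' x} :=
      Measure.restrict_mono (fun x hx => hw1 _ (hΓ x hx)) le_rfl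
    refine h1.trans ?_
    rw [← withDensity_indicator_one hs]
    refine withDensity_mono (ae_of_all _ fun x => ?_)
    by_cases hx : x ∈ {x : Fin d → ℝ | 1 ≤ w' x}
    · rw [Set.indicator_of_mem hx, Pi.one_apply, ENNReal.one_le_ofReal]; exact hx
    · rw [Set.indicator_of_notMem hx]; simp
  refine ⟨volume.withDensity fun x => ENNReal.ofReal (w' x),
    isFiniteMeasure_withDensity_ofReal hw'i.2, ?_, ?_, hdens⟩
  · intro η hη
    rw [integral_withDensity_eq_integral_toReal_smul hw'm.ennreal_ofReal
      (ae_of_all _ fun x => ENNReal.ofReal_lt_top)]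
    have h1 := integral_exp_mul_norm_sq_fourier_eq_zero ψ (a := WithLp.toLp 2 (-η)) (fun x => by
      by_contra! hx
      rw [hψ, hψ] at hx
      have h2 : ‖x‖ < δ := by
        by_contra! h; exact hx.1 (by rw [huδ x h]; simp)
      have h3 : ‖x - WithLp.toLp 2 (-η)‖ < δ := by
        by_contra! h; exact hx.2 (by rw [huδ _ h]; simp)
      have h4 := norm_sub_le x (x - WithLp.toLp 2 (-η))
      rw [sub_sub_cancel] at h4
      change euclNorm (-η) ≤ _ at h4
      rw [euclNorm_neg] at h4
      linarith)
    rw [← hvp.integral_comp hemb] at h1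
    have h5 : ∀ x, (ENNReal.ofReal (w' x)).toReal • expo η x = (((m ^ 2)⁻¹ : ℝ) : ℂ) *
        (Complex.exp (((-(2 * Real.pi * inner ℝ (WithLp.toLp 2 (-η)) (WithLp.toLp 2 x)) : ℝ) : ℂ) *
          Complex.I) * ((‖𝓕 ψ (WithLp.toLp 2 x)‖ ^ 2 : ℝ) : ℂ)) := by
      intro x
      rw [ENNReal.toReal_ofReal (hw0 _), Complex.real_smul, expo_eq]
      have h6 : inner ℝ (WithLp.toLp 2 (-η)) (WithLp.toLp 2 x) = -(η ⬝ᵥ x) := by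
        simp [PiLp.inner_apply, dotProduct, mul_comm]
      rw [h6]
      simp only [hw]
      push_cast
      ring_nf
    simp only [h5]
    rw [integral_const_mul, h1, mul_zero]
  · intro h0
    have h1 := hdens (WithLp.toLp 2 ⁻¹' Metric.ball 0 1) (fun x hx => by
      have : euclNorm x < 1 := by simpa [euclNorm] using hx
      linarith) Set.univ
    have h2 : IsOpen ((WithLp.toLp 2 : (Fin d → ℝ) → EuclideanSpace ℝ (Fin d)) ⁻¹'
        Metric.ball 0 1) := Metric.isOpen_ball.preimage (PiLp.continuous_toLp 2 _)
    rw [h0, Measure.restrict_apply_univ] at h1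
    exact (h2.measure_pos volume ⟨0, by simp⟩).not_ge (by simpa using h1)

end Weight

/-! ### Fourier coefficients on the unit cube -/

theorem integral_norm_sq_eq {Ω E : Type*} [MeasurableSpace Ω] [NormedAddCommGroup E] {μ : Measure Ω}
    {g : Ω → E} (hg : MemLp g 2 μ) : ∫ x, ‖g x‖ ^ 2 ∂μ = (eLpNorm g 2 μ).toReal ^ 2 := by
  have h0 : 0 ≤ ∫ x, ‖g x‖ ^ 2 ∂μ := integral_nonneg fun x => sq_nonneg _
  rw [hg.eLpNorm_eq_integral_rpow_norm (by norm_num) (by norm_num)]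
  simp only [ENNReal.toReal_ofNat, Real.rpow_ofNat]
  rw [ENNReal.toReal_ofReal (by positivity), ← Real.rpow_natCast, ← Real.rpow_mul h0]
  norm_num

section Fourier

variable {d : ℕ}

theorem character_eq_expo (ξ : Fin d → ℤ) : character ξ = expo (toRow ξ) := rfl

instance : IsProbabilityMeasure ((volume : Measure (Fin d → ℝ)).restrict (unitCube d)) := by
  refine ⟨?_⟩
  rw [Measure.restrict_apply_univ, unitCube, Real.volume_pi_Ico]
  simp

theorem measurableSet_unitCube : MeasurableSet (unitCube d) :=
  MeasurableSet.univ_pi fun _ => measurableSet_Ico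

theorem integral_Ico_exp (n : ℤ) :
    ∫ x in Set.Ico (0 : ℝ) 1, Complex.exp (2 * Real.pi * Complex.I * n * x) =
      if n = 0 then 1 else 0 := by
  split_ifs with h
  · simp [h]
  · rw [integral_Ico_eq_integral_Ioc, ← intervalIntegral.integral_of_le zero_le_one,
      integral_exp_mul_complex]
    · have : Complex.exp (2 * Real.pi * Complex.I * n) = 1 := by
        rw [mul_comm]; exact Complex.exp_int_mul_two_pi_mul_I n
      simp [this]
    · simp [Real.pi_ne_zero, h]

theorem integral_character (ξ : Fin d → ℤ) :
    ∫ x in unitCube d, character ξ x = if ξ = 0 then 1 else 0 := by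
  have h1 : ∀ x : Fin d → ℝ, character ξ x =
      ∏ i, Complex.exp (2 * Real.pi * Complex.I * ξ i * x i) := by
    intro x
    rw [character, ← Complex.exp_sum]
    congr 1
    simp only [dotProduct, toRow]
    push_cast
    rw [Finset.mul_sum]
    exact Finset.sum_congr rfl fun i _ => by ring
  simp only [h1]
  rw [unitCube, volume_pi, Measure.restrict_pi_pi,
    integral_fintype_prod_eq_prod (fun i (y : ℝ) => Complex.exp (2 * Real.pi * Complex.I * ξ i * y))]
  simp only [integral_Ico_exp]
  split_ifs with h
  · simp [h]
  · obtain ⟨i, hi⟩ := Function.ne_iff.1 h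
    exact Finset.prod_eq_zero (Finset.mem_univ i) (if_neg hi)

theorem character_mul_conj (ξ ξ' : Fin d → ℤ) (x : Fin d → ℝ) :
    character ξ x * (starRingEnd ℂ) (character ξ' x) = character (ξ - ξ') x := by
  rw [character_eq_expo, character_eq_expo, character_eq_expo, ← expo_neg, ← expo_add, toRow_sub,
    sub_eq_add_neg]

theorem integral_character_mul_conj (ξ ξ' : Fin d → ℤ) :
    ∫ x in unitCube d, character ξ x * (starRingEnd ℂ) (character ξ' x) =
      if ξ = ξ' then 1 else 0 := by
  simp only [character_mul_conj, integral_character, sub_eq_zero]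

variable {f : (Fin d → ℝ) → ℝ}

theorem fourierCoef_eq (ξ : Fin d → ℤ) :
    fourierCoef f ξ = ∫ x in unitCube d, (f x : ℂ) * (starRingEnd ℂ) (character ξ x) := by
  rw [fourierCoef]
  simp only [character_eq_expo, toRow_neg, expo_neg]

theorem conj_fourierCoef (ξ : Fin d → ℤ) :
    (starRingEnd ℂ) (fourierCoef f ξ) = fourierCoef f (-ξ) := by
  rw [fourierCoef_eq, ← integral_conj, fourierCoef]
  simp

theorem fourierCoef_zero (hf : ∫ x in unitCube d, f x = 0) : fourierCoef f 0 = 0 := by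
  rw [fourierCoef_eq]
  simp only [character_eq_expo, toRow_zero, expo_zero, map_one, mul_one]
  rw [integral_complex_ofReal, hf, Complex.ofReal_zero]

theorem partialSum_eq_trigPoly (a : ℕ) :
    partialSum f a = trigPoly (fourierCoef f) (freqBox d a) := rfl

theorem memLp_ofReal (hf : MemLp f 2 (volume.restrict (unitCube d))) :
    MemLp (fun x => (f x : ℂ)) 2 (volume.restrict (unitCube d)) := hf.ofReal

/-- Pythagoras for the orthonormal characters: both cross terms and the square of the polynomial
integrate to the same sum. -/
theorem integral_norm_sub_trigPoly_sq (hf : MemLp f 2 (volume.restrict (unitCube d)))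
    (F : Finset (Fin d → ℤ)) :
    ∫ x in unitCube d, ‖(f x : ℂ) - trigPoly (fourierCoef f) F x‖ ^ 2 =
      (∫ x in unitCube d, f x ^ 2) - ∑ ξ ∈ F, ‖fourierCoef f ξ‖ ^ 2 := by
  set ν := (volume : Measure (Fin d → ℝ)).restrict (unitCube d)
  set P := trigPoly (fourierCoef f) F with hP
  have hfi : Integrable (fun x => (f x : ℂ)) ν := (memLp_ofReal hf).integrable (by norm_num)
  have hPb : BddCont P := BddCont.trigPoly _ F
  have hconj : ∀ {h : (Fin d → ℝ) → ℂ}, BddCont h → BddCont (fun x => (starRingEnd ℂ) (h x)) :=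
    fun hh => ⟨Complex.continuous_conj.comp hh.1, hh.2.imp fun _ hC x => by simpa using hC x⟩
  have hmul : ∀ {h : (Fin d → ℝ) → ℂ}, BddCont h → Integrable (fun x => (f x : ℂ) * h x) ν :=
    fun {h} hh => hfi.mul_bdd (c := hh.2.choose) hh.1.aestronglyMeasurable
      (ae_of_all _ hh.2.choose_spec)
  have h1 : ∫ x, (f x : ℂ) * (starRingEnd ℂ) (P x) ∂ν = ∑ ξ ∈ F, ((‖fourierCoef f ξ‖ ^ 2 : ℝ) : ℂ) := by
    have : ∀ x, (f x : ℂ) * (starRingEnd ℂ) (P x) = ∑ ξ ∈ F, (starRingEnd ℂ) (fourierCoef f ξ) *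
        ((f x : ℂ) * (starRingEnd ℂ) (character ξ x)) := by
      intro x
      rw [hP, trigPoly, map_sum, Finset.mul_sum]
      exact Finset.sum_congr rfl fun ξ _ => by rw [map_mul, character_eq_expo]; ring
    simp only [this]
    rw [integral_finsetSum _ fun ξ _ => (hmul (h := fun x => (starRingEnd ℂ) (character ξ x))
      (hconj (BddCont.expo (toRow ξ)))).const_mul _]
    refine Finset.sum_congr rfl fun ξ _ => ?_
    rw [integral_const_mul, ← fourierCoef_eq, mul_comm, Complex.mul_conj, Complex.normSq_eq_norm_sq]
  have h2 : ∫ x, P x * (f x : ℂ) ∂ν = ∑ ξ ∈ F, ((‖fourierCoef f ξ‖ ^ 2 : ℝ) : ℂ) := by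
    have h3 := congrArg (starRingEnd ℂ) h1
    rw [← integral_conj, map_sum] at h3
    simpa [mul_comm] using h3
  have h4 : ∫ x, P x * (starRingEnd ℂ) (P x) ∂ν = ∑ ξ ∈ F, ((‖fourierCoef f ξ‖ ^ 2 : ℝ) : ℂ) := by
    have : ∀ x, P x * (starRingEnd ℂ) (P x) = ∑ ξ ∈ F, ∑ ξ' ∈ F,
        fourierCoef f ξ * (starRingEnd ℂ) (fourierCoef f ξ') *
        (character ξ x * (starRingEnd ℂ) (character ξ' x)) := by
      intro x
      rw [hP, trigPoly, map_sum, Finset.sum_mul_sum]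
      exact Finset.sum_congr rfl fun ξ _ => Finset.sum_congr rfl fun ξ' _ => by
        rw [map_mul, character_eq_expo, character_eq_expo]; ring
    simp only [this]
    have hi : ∀ ξ ξ' : Fin d → ℤ, Integrable (fun x => fourierCoef f ξ *
        (starRingEnd ℂ) (fourierCoef f ξ') *
        (character ξ x * (starRingEnd ℂ) (character ξ' x))) ν := fun ξ ξ' =>
      (((BddCont.expo _).mul (hconj (BddCont.expo _))).integrable ν).const_mul _
    rw [integral_finsetSum _ fun ξ _ => integrable_finsetSum _ fun ξ' _ => hi ξ ξ']
    refine Finset.sum_congr rfl fun ξ hξ => ?_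
    rw [integral_finsetSum _ fun ξ' _ => hi ξ ξ']
    simp only [integral_const_mul]
    simp only [ν, integral_character_mul_conj, mul_ite, mul_one, mul_zero, Finset.sum_ite_eq, hξ,
      if_true]
    rw [Complex.mul_conj, Complex.normSq_eq_norm_sq]
  have h5 : ∀ x, ((‖(f x : ℂ) - P x‖ ^ 2 : ℝ) : ℂ) = (((f x ^ 2 : ℝ) : ℂ) -
      (f x : ℂ) * (starRingEnd ℂ) (P x)) - (P x * (f x : ℂ) - P x * (starRingEnd ℂ) (P x)) := by
    intro x
    rw [← Complex.normSq_eq_norm_sq, ← Complex.mul_conj, map_sub, Complex.conj_ofReal]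
    push_cast
    ring
  have hPf : Integrable (fun x => P x * (f x : ℂ)) ν := by simpa only [mul_comm] using hmul hPb
  have hf2 : Integrable (fun x => ((f x ^ 2 : ℝ) : ℂ)) ν := hf.integrable_sq.ofReal
  have h6 : ((∫ x, ‖(f x : ℂ) - P x‖ ^ 2 ∂ν : ℝ) : ℂ) =
      (((∫ x, f x ^ 2 ∂ν) - ∑ ξ ∈ F, ‖fourierCoef f ξ‖ ^ 2 : ℝ) : ℂ) := by
    rw [← integral_complex_ofReal]
    simp only [h5]
    have hfP := hmul (hconj hPb)
    have hPP : Integrable (fun x => P x * (starRingEnd ℂ) (P x)) ν :=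
      (hPb.mul (hconj hPb)).integrable ν
    have e1 := integral_sub (hf2.sub hfP) (hPf.sub hPP)
    simp only [Pi.sub_apply] at e1
    rw [e1, integral_sub hf2 hfP, integral_sub hPf hPP, h1, h2, h4, integral_complex_ofReal]
    push_cast
    ring
  exact_mod_cast h6

theorem sum_norm_fourierCoef_sq_le (hf : MemLp f 2 (volume.restrict (unitCube d)))
    (F : Finset (Fin d → ℤ)) :
    ∑ ξ ∈ F, ‖fourierCoef f ξ‖ ^ 2 ≤ ∫ x in unitCube d, f x ^ 2 := by
  have h1 := integral_norm_sub_trigPoly_sq hf F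
  have h2 : 0 ≤ ∫ x in unitCube d, ‖(f x : ℂ) - trigPoly (fourierCoef f) F x‖ ^ 2 :=
    integral_nonneg fun x => sq_nonneg _
  linarith

theorem memLp_sub_partialSum (hf : MemLp f 2 (volume.restrict (unitCube d))) (a : ℕ) :
    MemLp (fun x => (f x : ℂ) - partialSum f a x) 2 (volume.restrict (unitCube d)) :=
  (memLp_ofReal hf).sub ((BddCont.trigPoly (fourierCoef f) (freqBox d a)).memLp _ 2)

/-- Bessel's inequality on the union with the box, minus the exact contribution of the box. -/
theorem sum_norm_fourierCoef_sq_le_partialSumError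
    (hf : MemLp f 2 (volume.restrict (unitCube d))) (a : ℕ) {F : Finset (Fin d → ℤ)}
    (hF : Disjoint F (freqBox d a)) :
    ∑ ξ ∈ F, ‖fourierCoef f ξ‖ ^ 2 ≤ (partialSumError f a).toReal ^ 2 := by
  have h1 := sum_norm_fourierCoef_sq_le hf (F ∪ freqBox d a)
  rw [Finset.sum_union hF] at h1
  have h2 := integral_norm_sub_trigPoly_sq hf (freqBox d a)
  rw [partialSumError, ← integral_norm_sq_eq (memLp_sub_partialSum hf a), partialSum_eq_trigPoly,
    h2]
  linarith

theorem mem_freqBox {a : ℕ} {ξ : Fin d → ℤ} : ξ ∈ freqBox d a ↔ ξ ≠ 0 ∧ ∀ i, |ξ i| ≤ a := by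
  simp [freqBox, Fintype.mem_piFinset, abs_le]

theorem zero_notMem_freqBox (a : ℕ) : (0 : Fin d → ℤ) ∉ freqBox d a := by simp [freqBox]

/-- The box is symmetric under `ξ ↦ -ξ` and `f` is real, so the partial sum is invariant under
conjugation. -/
theorem ofReal_re_partialSum (a : ℕ) (x : Fin d → ℝ) :
    ((partialSum f a x).re : ℂ) = partialSum f a x := by
  rw [← Complex.conj_eq_iff_re, partialSum, map_sum]
  refine Finset.sum_bij' (fun ξ _ => -ξ) (fun ξ _ => -ξ) ?_ ?_ ?_ ?_ ?_
  · intro ξ hξ; simpa [mem_freqBox] using hξ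
  · intro ξ hξ; simpa [mem_freqBox] using hξ
  · intro ξ _; simp
  · intro ξ _; simp
  · intro ξ _
    rw [map_mul, conj_fourierCoef, character_eq_expo, character_eq_expo, toRow_neg, expo_neg]

theorem euclNorm_le_of_mem_freqBox {a : ℕ} {ξ : Fin d → ℤ} (hξ : ξ ∈ freqBox d a) :
    euclNorm (toRow ξ) ≤ d * a := by
  have h1 : euclNorm (toRow ξ) ^ 2 ≤ (d * a : ℝ) ^ 2 := by
    rw [euclNorm_sq, dotProduct]
    have h2 : ∀ i ∈ (Finset.univ : Finset (Fin d)), toRow ξ i * toRow ξ i ≤ (a : ℝ) ^ 2 := by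
      intro i _
      have h3 : |toRow ξ i| ≤ a := by
        rw [toRow, ← Int.cast_abs]; exact_mod_cast (mem_freqBox.1 hξ).2 i
      rw [← sq, ← sq_abs]
      exact pow_le_pow_left₀ (abs_nonneg _) h3 2
    refine (Finset.sum_le_sum h2).trans ?_
    simp only [Finset.sum_const, Finset.card_univ, Fintype.card_fin, nsmul_eq_mul, mul_pow]
    rcases Nat.eq_zero_or_pos d with hd | hd
    · simp [hd]
    · have : (1 : ℝ) ≤ d := by exact_mod_cast hd
      have : (d : ℝ) ≤ d ^ 2 := by nlinarith
      gcongr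
  exact le_of_sq_le_sq h1 (by positivity)

end Fourier

/-! ### Coupled frequencies and summable tails -/

section Coupling

variable {d : ℕ} {A : Matrix (Fin d) (Fin d) ℝ} {q : ℝ}

theorem euclNorm_smul (r : ℝ) (v : Fin d → ℝ) : euclNorm (r • v) = |r| * euclNorm v := by
  simp [euclNorm, norm_smul]

open Classical in
-- Two coupled pairs satisfy `‖(ξ - η) + ε(ξ' - η')A^l‖ < 1`. If they agree in one coordinate,
-- integrality (and expansion) forces agreement in the other, so the relation is a partial matching
-- and Cauchy–Schwarz applies. Moreover `‖ξ‖ ≥ ‖ξ'A^l‖ - 1/2 ≥ q^l - 1/2`, so the first factor is a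
-- tail. The sign `ε = 1` serves the variance series, `ε = -1` the correlations with a conjugate.
theorem sum_coupled_le (hA : ExpandsBy A q) {a : (Fin d → ℤ) → ℝ} (ha0 : a 0 = 0) {ε : ℝ}
    (hε : |ε| = 1) {l : ℕ} {T : ℝ} (hT0 : 0 ≤ T)
    (hT : ∀ G : Finset (Fin d → ℤ), (∀ ξ ∈ G, q ^ l - 1 / 2 ≤ euclNorm (toRow ξ)) →
      ∑ ξ ∈ G, a ξ ^ 2 ≤ T ^ 2) (F F' : Finset (Fin d → ℤ)) :
    ∑ i ∈ F ×ˢ F', (if euclNorm (toRow i.1 + ε • (toRow i.2 ᵥ* A ^ l)) < 1 / 2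
      then a i.1 * a i.2 else 0) ≤ T * √(∑ ξ ∈ F', a ξ ^ 2) := by
  -- Pairs with `ξ' = 0` carry no weight as `a 0 = 0`; removing them gives `‖ξ'‖ ≥ 1`.
  set R := (F ×ˢ F').filter fun i =>
    euclNorm (toRow i.1 + ε • (toRow i.2 ᵥ* A ^ l)) < 1 / 2 ∧ i.2 ≠ 0 with hR
  have hmem : ∀ i ∈ R, euclNorm (toRow i.1 + ε • (toRow i.2 ᵥ* A ^ l)) < 1 / 2 := fun i hi =>
    ((Finset.mem_filter.1 hi).2).1
  have h1 : ∑ i ∈ F ×ˢ F', (if euclNorm (toRow i.1 + ε • (toRow i.2 ᵥ* A ^ l)) < 1 / 2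
      then a i.1 * a i.2 else 0) = ∑ i ∈ R, a i.1 * a i.2 := by
    rw [hR, Finset.sum_filter]
    refine Finset.sum_congr rfl fun i _ => ?_
    by_cases h2 : i.2 = 0
    · simp [h2, ha0]
    · simp [h2]
  have hsub : ∀ i ∈ R, ∀ j ∈ R, euclNorm ((toRow i.1 - toRow j.1) +
      ε • ((toRow i.2 - toRow j.2) ᵥ* A ^ l)) < 1 := by
    intro i hi j hj
    have h2 := euclNorm_sub_le (toRow i.1 + ε • (toRow i.2 ᵥ* A ^ l))
      (toRow j.1 + ε • (toRow j.2 ᵥ* A ^ l))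
    have h3 : (toRow i.1 + ε • (toRow i.2 ᵥ* A ^ l)) - (toRow j.1 + ε • (toRow j.2 ᵥ* A ^ l)) =
        (toRow i.1 - toRow j.1) + ε • ((toRow i.2 - toRow j.2) ᵥ* A ^ l) := by
      rw [Matrix.sub_vecMul, smul_sub]; abel
    rw [h3] at h2
    linarith [hmem i hi, hmem j hj]
  have hfst : Set.InjOn (Prod.fst : (Fin d → ℤ) × (Fin d → ℤ) → _) R := by
    intro i hi j hj hij
    refine Prod.ext hij (eq_of_euclNorm_toRow_sub_lt_one ?_)
    have h2 := hsub i hi j hj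
    rw [hij, sub_self, zero_add, euclNorm_smul, hε, one_mul] at h2
    exact (hA.le_vecMul_pow _ _).trans_lt h2
  have hsnd : Set.InjOn (Prod.snd : (Fin d → ℤ) × (Fin d → ℤ) → _) R := by
    intro i hi j hj hij
    refine Prod.ext (eq_of_euclNorm_toRow_sub_lt_one ?_) hij
    have h2 := hsub i hi j hj
    rwa [hij, sub_self, Matrix.zero_vecMul, smul_zero, add_zero] at h2
  rw [h1]
  refine (Real.sum_mul_le_sqrt_mul_sqrt R (fun i => a i.1) (fun i => a i.2)).trans ?_
  have h4 : √(∑ i ∈ R, a i.1 ^ 2) ≤ T := by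
    rw [← Finset.sum_image (f := fun ξ => a ξ ^ 2) hfst, Real.sqrt_le_left hT0]
    refine hT _ fun ξ hξ => ?_
    obtain ⟨i, hi, rfl⟩ := Finset.mem_image.1 hξ
    have h5 := le_euclNorm_add (toRow i.1 + ε • (toRow i.2 ᵥ* A ^ l)) (-toRow i.1)
    rw [add_assoc, add_comm (ε • _), ← add_assoc, add_neg_cancel, zero_add, euclNorm_neg,
      euclNorm_smul, hε, one_mul] at h5
    have h6 := hA.vecMul_pow (toRow i.2) l
    have h7 : q ^ l ≤ q ^ l * euclNorm (toRow i.2) := le_mul_of_one_le_right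
      (by have := hA.1; positivity) (one_le_euclNorm_toRow (Finset.mem_filter.1 hi).2.2)
    have h8 := le_euclNorm_add (toRow i.1 + ε • (toRow i.2 ᵥ* A ^ l)) (-(ε • (toRow i.2 ᵥ* A ^ l)))
    rw [euclNorm_neg, euclNorm_smul, hε, one_mul, add_neg_cancel_right] at h8
    linarith [hmem i hi]
  have h5 : √(∑ i ∈ R, a i.2 ^ 2) ≤ √(∑ ξ ∈ F', a ξ ^ 2) := by
    rw [← Finset.sum_image (f := fun ξ => a ξ ^ 2) hsnd]
    refine Real.sqrt_le_sqrt (Finset.sum_le_sum_of_subset_of_nonneg ?_ fun _ _ _ => sq_nonneg _)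
    intro ξ hξ
    obtain ⟨i, hi, rfl⟩ := Finset.mem_image.1 hξ
    exact (Finset.mem_product.1 (Finset.mem_filter.1 hi).1).2
  exact mul_le_mul h4 h5 (Real.sqrt_nonneg _) hT0

theorem summable_comp_div {τ : ℕ → ℝ} (hτ0 : ∀ m, 0 ≤ τ m) (hτ : Summable τ) {s : ℕ} (hs : 0 < s) :
    Summable fun l : ℕ => τ (l / s) := by
  have : NeZero s := ⟨hs.ne'⟩
  have h1 : Summable fun x : ℕ × Fin s => τ x.1 * (1 : ℝ) :=
    hτ.mul_of_nonneg (g := fun _ : Fin s => (1 : ℝ)) (Summable.of_finite) hτ0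
      (fun _ => zero_le_one)
  have h2 := (Nat.divModEquiv s).summable_iff.2 h1
  refine h2.congr fun l => ?_
  simp [Nat.divModEquiv]

/-- With `q^s ≥ 2`, a frequency of norm at least `q^l - 1/2` lies outside the box of size about
`2^(l/s)`. Each dyadic error is thus used for `s` consecutive lags, which preserves summability. -/
theorem exists_tail_bound (hq : 1 < q) {a : (Fin d → ℤ) → ℝ} {τ : ℕ → ℝ} (hτ0 : ∀ m, 0 ≤ τ m)
    (hτ : Summable τ)
    (hτa : ∀ (m : ℕ) (G : Finset (Fin d → ℤ)), Disjoint G (freqBox d (2 ^ m)) →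
      ∑ ξ ∈ G, a ξ ^ 2 ≤ τ m ^ 2) {K : ℝ} (hK0 : 0 ≤ K)
    (hK : ∀ G : Finset (Fin d → ℤ), ∑ ξ ∈ G, a ξ ^ 2 ≤ K ^ 2) :
    ∃ u : ℕ → ℝ, Summable u ∧ (∀ l, 0 ≤ u l) ∧ ∀ (l : ℕ) (G : Finset (Fin d → ℤ)),
      (∀ ξ ∈ G, q ^ l - 1 / 2 ≤ euclNorm (toRow ξ)) → ∑ ξ ∈ G, a ξ ^ 2 ≤ u l ^ 2 := by
  obtain ⟨s, hs, hs0⟩ := ((eventually_le_pow_mul hq 2 one_pos).and (eventually_gt_atTop 0)).exists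
  rw [mul_one] at hs
  -- Shrinking the box by `2^m₀ ≥ 4(d + 1)` absorbs the factor `d` between coordinate size and
  -- Euclidean norm, and the `1/2`. The finitely many lags below `s * m₀` use the total bound `K`.
  obtain ⟨m₀, hm₀⟩ := (eventually_le_pow_mul (one_lt_two (α := ℝ)) (4 * (d + 1)) one_pos).exists
  rw [mul_one] at hm₀
  refine ⟨fun l => if l < s * m₀ then K else τ (l / s - m₀), ?_, fun l => ?_, fun l G hG => ?_⟩
  · rw [← summable_nat_add_iff (s * m₀)]
    refine (summable_comp_div hτ0 hτ hs0).congr fun l => ?_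
    rw [if_neg (by omega), Nat.add_mul_div_left _ _ hs0, Nat.add_sub_cancel]
  · dsimp only
    split_ifs
    exacts [hK0, hτ0 _]
  · dsimp only
    split_ifs with hl
    · exact hK G
    · refine hτa _ G (Finset.disjoint_left.2 fun ξ hξ hbox => ?_)
      have h1 := euclNorm_le_of_mem_freqBox hbox
      have h2 := hG ξ hξ
      have h3 : m₀ ≤ l / s := by
        rw [Nat.le_div_iff_mul_le hs0, mul_comm]; exact not_lt.1 hl
      have h4 : (2 : ℝ) ^ (l / s) ≤ q ^ l := by
        calc (2 : ℝ) ^ (l / s) ≤ (q ^ s) ^ (l / s) := pow_le_pow_left₀ (by norm_num) hs _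
          _ = q ^ (s * (l / s)) := (pow_mul _ _ _).symm
          _ ≤ q ^ l := pow_le_pow_right₀ hq.le (Nat.mul_div_le _ _)
      have h5 : (2 : ℝ) ^ (l / s) = 2 ^ m₀ * 2 ^ (l / s - m₀) := by
        rw [← pow_add, Nat.add_sub_of_le h3]
      have h6 : (1 : ℝ) ≤ 2 ^ (l / s - m₀) := one_le_pow₀ (by norm_num)
      have h7 : 4 * ((d : ℝ) + 1) * 2 ^ (l / s - m₀) ≤ q ^ l := by
        refine le_trans ?_ h4
        rw [h5]
        gcongr
      push_cast at h1
      have hd : (0 : ℝ) ≤ d := Nat.cast_nonneg _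
      nlinarith

end Coupling

/-- Fourier coefficients `c` whose squared tails over indices coupled at lag `l` are at most
`(u l)²`. -/
structure CoupledTails {d : ℕ} (q : ℝ) (c : (Fin d → ℤ) → ℂ) (u : ℕ → ℝ) (K : ℝ) : Prop where
  coef_zero : c 0 = 0
  summable : Summable u
  nonneg : ∀ l, 0 ≤ u l
  tail : ∀ (l : ℕ) (G : Finset (Fin d → ℤ)), (∀ ξ ∈ G, q ^ l - 1 / 2 ≤ euclNorm (toRow ξ)) →
    ∑ ξ ∈ G, ‖c ξ‖ ^ 2 ≤ u l ^ 2
  bound_nonneg : 0 ≤ K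
  bound : ∀ G : Finset (Fin d → ℤ), ∑ ξ ∈ G, ‖c ξ‖ ^ 2 ≤ K ^ 2

/-! ### Uniform `L²` bound and absolute convergence of the variance series -/

section Consequences

variable {d : ℕ} {A : Matrix (Fin d) (Fin d) ℝ} {q : ℝ} {μ : Measure (Fin d → ℝ)}
  [IsFiniteMeasure μ] {c : (Fin d → ℤ) → ℂ} {u : ℕ → ℝ} {K : ℝ}

/-- Pairs that are not coupled at lag `l` integrate to zero under `μ`. Unlike the bound for a single
polynomial, the constant involves `F` only through its coefficient norm, and so becomes small for
remote frequencies. -/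
theorem CoupledTails.integral_norm_sum_sq_le (hc : CoupledTails q c u K) (hA : ExpandsBy A q)
    (hμ : BandLimited μ) (F : Finset (Fin d → ℤ)) (E : Finset ℕ) :
    ∫ x, ‖∑ k ∈ E, trigPoly c F ((A ^ k) *ᵥ x)‖ ^ 2 ∂μ ≤
      2 * (μ.real Set.univ * √(∑ ξ ∈ F, ‖c ξ‖ ^ 2) * ∑' l, u l) * E.card := by
  classical
  rw [← tsum_mul_left]
  refine RieszRaikov.integral_norm_sum_sq_le (fun k => (BddCont.trigPoly c F).comp_mulVec _)
    (hc.summable.mul_left _) (fun k l => ?_) E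
  have h1 : ∀ x, trigPoly c F (A ^ k *ᵥ x) * (starRingEnd ℂ) (trigPoly c F (A ^ (k + l) *ᵥ x)) =
      ∑ i ∈ F ×ˢ F, c i.1 * (starRingEnd ℂ) (c i.2) *
        expo ((toRow i.1 + (-1 : ℝ) • (toRow i.2 ᵥ* A ^ l)) ᵥ* A ^ k) x := by
    intro x
    rw [trigPoly_mulVec, trigPoly_mulVec, map_sum, Finset.sum_mul_sum, ← Finset.sum_product']
    refine Finset.sum_congr rfl fun i _ => ?_
    rw [map_mul, ← expo_neg, neg_one_smul, ← Matrix.neg_vecMul, ← Matrix.neg_vecMul,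
      ← vecMul_pow_add_split, expo_add]
    ring
  simp only [h1]
  rw [integral_finsetSum _ fun i _ => ((BddCont.expo _).integrable μ).const_mul _]
  have h2 : ∀ i ∈ F ×ˢ F, ‖∫ x, c i.1 * (starRingEnd ℂ) (c i.2) *
      expo ((toRow i.1 + (-1 : ℝ) • (toRow i.2 ᵥ* A ^ l)) ᵥ* A ^ k) x ∂μ‖ ≤
      μ.real Set.univ * (if euclNorm (toRow i.1 + (-1 : ℝ) • (toRow i.2 ᵥ* A ^ l)) < 1 / 2
      then ‖c i.1‖ * ‖c i.2‖ else 0) := by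
    intro i _
    rw [integral_const_mul, norm_mul, norm_mul, Complex.norm_conj]
    split_ifs with h
    · rw [mul_comm]
      exact mul_le_mul_of_nonneg_right (norm_integral_expo_le _) (by positivity)
    · rw [hμ _ ((not_lt.1 h).trans (hA.le_vecMul_pow _ _))]
      simp
  refine (norm_sum_le_of_le _ h2).trans ?_
  rw [← Finset.mul_sum, mul_assoc]
  refine mul_le_mul_of_nonneg_left ?_ (by positivity)
  rw [mul_comm]
  exact sum_coupled_le hA (a := fun ξ => ‖c ξ‖) (by simp [hc.coef_zero]) (by simp) (hc.nonneg l)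
    (hc.tail l) F F

open Classical in
/-- The term of the variance series for general coefficients. -/
noncomputable def coefVarianceTerm (A : Matrix (Fin d) (Fin d) ℝ) (c : (Fin d → ℤ) → ℂ)
    (p : ℕ × (Fin d → ℤ) × (Fin d → ℤ)) : ℂ :=
  (if p.1 = 0 then 1 else 2) *
    if toRow p.2.1 + toRow p.2.2 ᵥ* A ^ p.1 = 0 then c p.2.1 * c p.2.2 else 0

/-- An exact resonance is a coupled pair, so lag `l` contributes at most `2 u_l K`. -/
theorem CoupledTails.summable_coefVarianceTerm (hc : CoupledTails q c u K) (hA : ExpandsBy A q) :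
    Summable fun p => ‖coefVarianceTerm A c p‖ := by
  classical
  refine summable_of_sum_le (c := ∑' l, 2 * (u l * K)) (fun p => norm_nonneg _) fun S => ?_
  set L := S.image Prod.fst
  set F := S.image fun p => p.2.1
  set F' := S.image fun p => p.2.2
  have hS : S ⊆ L ×ˢ (F ×ˢ F') := by
    intro p hp
    simp only [Finset.mem_product]
    exact ⟨Finset.mem_image_of_mem _ hp, Finset.mem_image_of_mem (fun p => p.2.1) hp,
      Finset.mem_image_of_mem (fun p => p.2.2) hp⟩
  refine (Finset.sum_le_sum_of_subset_of_nonneg hS fun _ _ _ => norm_nonneg _).trans ?_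
  rw [Finset.sum_product]
  have h1 : ∀ l ∈ L, ∑ i ∈ F ×ˢ F', ‖coefVarianceTerm A c (l, i)‖ ≤ 2 * (u l * K) := by
    intro l _
    have h2 := sum_coupled_le hA (a := fun ξ => ‖c ξ‖) (by simp [hc.coef_zero])
      (ε := 1) (by simp) (hc.nonneg l) (hc.tail l) F F'
    have h3 : √(∑ ξ ∈ F', ‖c ξ‖ ^ 2) ≤ K := by
      rw [Real.sqrt_le_left hc.bound_nonneg]; exact hc.bound F'
    have h4 := h2.trans (mul_le_mul_of_nonneg_left h3 (hc.nonneg l))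
    refine le_trans ?_ (mul_le_mul_of_nonneg_left h4 zero_le_two)
    rw [Finset.mul_sum]
    refine Finset.sum_le_sum fun i _ => ?_
    rw [coefVarianceTerm, norm_mul]
    refine mul_le_mul (by split_ifs <;> simp) ?_ (norm_nonneg _) zero_le_two
    rw [one_smul]
    split_ifs with h5 h6 h6
    · rw [norm_mul]
    · simp only at h5
      rw [h5, euclNorm_zero] at h6
      norm_num at h6
    · simp only [norm_zero]; positivity
    · simp
  refine (Finset.sum_le_sum h1).trans ?_
  exact ((hc.summable.mul_right K).mul_left 2).sum_le_tsum _ fun l _ =>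
    mul_nonneg zero_le_two (mul_nonneg (hc.nonneg l) hc.bound_nonneg)

open Classical in
theorem polyVariance_eq_tsum (hs : Summable fun p => ‖coefVarianceTerm A c p‖)
    (F : Finset (Fin d → ℤ)) :
    polyVariance A c F = ∑' p, if p.2.1 ∈ F ∧ p.2.2 ∈ F then coefVarianceTerm A c p else 0 := by
  have h1 : Summable fun p : ℕ × (Fin d → ℤ) × (Fin d → ℤ) =>
      if p.2.1 ∈ F ∧ p.2.2 ∈ F then coefVarianceTerm A c p else 0 := by
    refine Summable.of_norm_bounded hs fun p => ?_
    split_ifs <;> simp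
  rw [h1.tsum_prod, polyVariance]
  refine tsum_congr fun l => ?_
  rw [tsum_eq_sum (s := F ×ˢ F) fun i hi => if_neg (by simpa using hi), resonance, Finset.mul_sum]
  refine Finset.sum_congr rfl fun i hi => ?_
  rw [if_pos (show (l, i).2.1 ∈ F ∧ (l, i).2.2 ∈ F by simpa using hi), coefVarianceTerm, pow_zero, Matrix.vecMul_one]

/-- Dominated convergence: every nonzero frequency eventually enters the boxes, and the zero
frequency contributes nothing. -/
theorem tendsto_polyVariance (hs : Summable fun p => ‖coefVarianceTerm A c p‖) (h0 : c 0 = 0) :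
    Tendsto (fun m : ℕ => polyVariance A c (freqBox d (2 ^ m))) atTop
      (𝓝 (∑' p, coefVarianceTerm A c p)) := by
  classical
  simp only [polyVariance_eq_tsum hs]
  refine tendsto_tsum_of_dominated_convergence hs (fun p => ?_)
    (Eventually.of_forall fun m p => by split_ifs <;> simp)
  refine tendsto_const_nhds.congr' ?_
  have hev : ∀ ξ : Fin d → ℤ, ξ ≠ 0 → ∀ᶠ m : ℕ in atTop, ξ ∈ freqBox d (2 ^ m) := by
    intro ξ hξ
    have h1 : ∀ i, ∀ᶠ m : ℕ in atTop, |ξ i| ≤ ((2 ^ m : ℕ) : ℤ) := fun i => by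
      have h2 := (tendsto_pow_atTop_atTop_of_one_lt (one_lt_two (α := ℤ))).eventually_ge_atTop |ξ i|
      simpa using h2
    filter_upwards [eventually_all.2 h1] with m hm
    exact mem_freqBox.2 ⟨hξ, hm⟩
  by_cases hp : p.2.1 = 0 ∨ p.2.2 = 0
  · have : coefVarianceTerm A c p = 0 := by
      rcases hp with h | h <;> simp [coefVarianceTerm, h, h0]
    simp [this]
  · push Not at hp
    filter_upwards [hev _ hp.1, hev _ hp.2] with m h1 h2
    rw [if_pos ⟨h1, h2⟩]

end Consequences

/-! ### Periodic functions composed with a linear map -/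

section Periodic

variable {d : ℕ}

theorem apply_add_toRow {β : Type*} {f : (Fin d → ℝ) → β}
    (hf : ∀ (i : Fin d) (x : Fin d → ℝ), f (x + Pi.single i 1) = f x) (v : Fin d → ℤ)
    (x : Fin d → ℝ) : f (x + toRow v) = f x := by
  have h1 : ∀ i (n : ℤ), Function.Periodic f (n • Pi.single i (1 : ℝ)) := fun i n =>
    Function.Periodic.zsmul (hf i) n
  have h2 : ∀ s : Finset (Fin d), Function.Periodic f (∑ i ∈ s, v i • Pi.single i (1 : ℝ)) := by
    intro s
    classical
    induction s using Finset.induction_on with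
    | empty => intro x; simp
    | insert i s hi ih => rw [Finset.sum_insert hi]; exact (h1 i (v i)).add_period ih
  have h3 : toRow v = ∑ i, v i • Pi.single i (1 : ℝ) := by
    ext j
    simp [toRow, Finset.sum_apply, Pi.single_apply]
  rw [h3]
  exact h2 _ x

theorem expo_toRow_add_toRow (ξ v : Fin d → ℤ) (x : Fin d → ℝ) :
    expo (toRow ξ) (x + toRow v) = expo (toRow ξ) x := by
  have h1 : toRow ξ ⬝ᵥ toRow v = ((∑ i, ξ i * v i : ℤ) : ℝ) := by
    simp [dotProduct, toRow]
  rw [expo, expo, dotProduct_add, h1, Complex.ofReal_add, mul_add, Complex.exp_add,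
    Complex.ofReal_intCast, mul_comm (2 * (Real.pi : ℂ) * Complex.I) ((_ : ℤ) : ℂ),
    Complex.exp_int_mul_two_pi_mul_I, mul_one]

theorem partialSum_add_toRow (f : (Fin d → ℝ) → ℝ) (a : ℕ) (v : Fin d → ℤ) (x : Fin d → ℝ) :
    partialSum f a (x + toRow v) = partialSum f a x := by
  simp only [partialSum_eq_trigPoly, trigPoly, expo_toRow_add_toRow]

/-- The translate of the unit cube by an integer vector. -/
def cubeAt (v : Fin d → ℤ) : Set (Fin d → ℝ) := (fun x => x - toRow v) ⁻¹' unitCube d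

theorem measurableSet_cubeAt (v : Fin d → ℤ) : MeasurableSet (cubeAt v) :=
  measurableSet_unitCube.preimage (measurable_id.sub_const _)

theorem mem_cubeAt_floor (x : Fin d → ℝ) : x ∈ cubeAt fun i => ⌊x i⌋ := by
  simp only [cubeAt, unitCube, Set.mem_preimage, Set.mem_univ_pi, Pi.sub_apply, toRow, Set.mem_Ico]
  exact fun i => ⟨Int.fract_nonneg _, Int.fract_lt_one _⟩

theorem iUnion_cubeAt : ⋃ v : Fin d → ℤ, cubeAt v = Set.univ :=
  Set.eq_univ_of_forall fun x => Set.mem_iUnion.2 ⟨_, mem_cubeAt_floor x⟩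

theorem setLIntegral_cubeAt {g : (Fin d → ℝ) → ℝ≥0∞}
    (hg : ∀ (v : Fin d → ℤ) x, g (x + toRow v) = g x) (v : Fin d → ℤ) :
    ∫⁻ x in cubeAt v, g x = ∫⁻ x in unitCube d, g x := by
  have h1 := (measurePreserving_sub_right (volume : Measure (Fin d → ℝ))
    (toRow v)).setLIntegral_comp_preimage_emb (measurableEmbedding_subRight _) g (unitCube d)
  rw [← h1]
  refine setLIntegral_congr_fun (measurableSet_cubeAt v) fun x _ => ?_
  rw [← hg v (x - toRow v), sub_add_cancel]

theorem aestronglyMeasurable_of_periodic {f : (Fin d → ℝ) → ℝ}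
    (hf : ∀ (v : Fin d → ℤ) x, f (x + toRow v) = f x)
    (hfm : AEStronglyMeasurable f (volume.restrict (unitCube d))) :
    AEStronglyMeasurable f volume := by
  rw [← Measure.restrict_univ (μ := (volume : Measure (Fin d → ℝ))), ← iUnion_cubeAt,
    aestronglyMeasurable_iUnion_iff]
  intro v
  have h1 := hfm.comp_measurePreserving ((measurePreserving_sub_right
    (volume : Measure (Fin d → ℝ)) (toRow v)).restrict_preimage measurableSet_unitCube)
  refine h1.congr (ae_of_all _ fun x => ?_)
  simp only [Function.comp]
  rw [← hf v (x - toRow v), sub_add_cancel]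

theorem exists_subset_biUnion_cubeAt {S : Set (Fin d → ℝ)} (hS : Bornology.IsBounded S) :
    ∃ V : Finset (Fin d → ℤ), S ⊆ ⋃ v ∈ V, cubeAt v := by
  obtain ⟨r, hr⟩ := hS.subset_closedBall 0
  obtain ⟨n, hn⟩ := exists_nat_ge r
  refine ⟨Fintype.piFinset fun _ => Finset.Icc (-(n : ℤ)) n, fun x hx => ?_⟩
  refine Set.mem_biUnion (x := fun i => ⌊x i⌋) ?_ (mem_cubeAt_floor x)
  have h1 : ‖x‖ ≤ n := by simpa using (hr hx : x ∈ Metric.closedBall 0 r) |> fun h => (by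
    simpa using h : ‖x‖ ≤ r).trans hn
  simp only [Finset.mem_coe, Fintype.mem_piFinset, Finset.mem_Icc]
  intro i
  have h2 := abs_le.1 ((norm_le_pi_norm x i).trans h1)
  refine ⟨Int.le_floor.2 (by push_cast; exact h2.1), ?_⟩
  have : ((⌊x i⌋ : ℤ) : ℝ) ≤ n := (Int.floor_le _).trans h2.2
  exact_mod_cast this

/-- Change variables and cover the bounded image of `Γ` by finitely many unit cubes, each carrying
the same integral. The constant depends on `M`. -/
theorem exists_setLIntegral_comp_le {M : Matrix (Fin d) (Fin d) ℝ} (hM : M.det ≠ 0)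
    {Γ : Set (Fin d → ℝ)} (hΓ : Bornology.IsBounded Γ) :
    ∃ C : ℝ≥0∞, C ≠ ∞ ∧ ∀ g : (Fin d → ℝ) → ℝ≥0∞,
      (∀ (v : Fin d → ℤ) x, g (x + toRow v) = g x) →
      ∫⁻ x in Γ, g (M *ᵥ x) ≤ C * ∫⁻ x in unitCube d, g x := by
  have hbd : Bornology.IsBounded ((fun x => M *ᵥ x) '' Γ) := by
    have : LipschitzWith _ (LinearMap.toContinuousLinearMap (Matrix.toLin' M)) :=
      (LinearMap.toContinuousLinearMap (Matrix.toLin' M)).lipschitz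
    exact this.isBounded_image hΓ
  obtain ⟨V, hV⟩ := exists_subset_biUnion_cubeAt hbd
  refine ⟨ENNReal.ofReal |M.det⁻¹| * V.card, ENNReal.mul_ne_top ENNReal.ofReal_ne_top
    (ENNReal.natCast_ne_top _), fun g hg => ?_⟩
  have hemb : MeasurableEmbedding (Matrix.toLin' M) := by
    have hinj : Function.Injective (Matrix.toLin' M) := by
      have := Matrix.mulVec_injective_iff_isUnit.2 ((Matrix.isUnit_iff_isUnit_det M).2
        (isUnit_iff_ne_zero.2 hM))
      exact this
    exact (LinearMap.continuous_of_finiteDimensional _).measurableEmbedding hinj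
  have hB : MeasurableSet (⋃ v ∈ V, cubeAt v) :=
    V.measurableSet_biUnion fun v _ => measurableSet_cubeAt v
  calc ∫⁻ x in Γ, g (M *ᵥ x)
      ≤ ∫⁻ x in Matrix.toLin' M ⁻¹' (⋃ v ∈ V, cubeAt v), g (Matrix.toLin' M x) :=
        lintegral_mono_set fun x hx => hV ⟨x, hx, rfl⟩
    _ = ∫⁻ y in ⋃ v ∈ V, cubeAt v, g y ∂(Measure.map (Matrix.toLin' M) volume) := by
        rw [hemb.restrict_map, hemb.lintegral_map]
    _ = ENNReal.ofReal |M.det⁻¹| * ∫⁻ y in ⋃ v ∈ V, cubeAt v, g y := by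
        rw [Real.map_matrix_volume_pi_eq_smul_volume_pi hM, Measure.restrict_smul,
          lintegral_smul_measure, smul_eq_mul]
    _ ≤ ENNReal.ofReal |M.det⁻¹| * ∑ v ∈ V, ∫⁻ y in cubeAt v, g y := by
        gcongr
        have hsub : ⋃ v ∈ V, cubeAt v = ⋃ v : V, cubeAt (v : Fin d → ℤ) := by ext; simp
        rw [hsub]
        refine (lintegral_iUnion_le _ _).trans (le_of_eq ?_)
        rw [tsum_fintype]
        exact Finset.sum_coe_sort V fun v => ∫⁻ y in cubeAt v, g y
    _ = _ := by
        simp only [setLIntegral_cubeAt hg, Finset.sum_const, nsmul_eq_mul]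
        ring

theorem exists_eLpNorm_comp_le {M : Matrix (Fin d) (Fin d) ℝ} (hM : M.det ≠ 0)
    {Γ : Set (Fin d → ℝ)} (hΓ : Bornology.IsBounded Γ) :
    ∃ C : ℝ≥0∞, C ≠ ∞ ∧ ∀ g : (Fin d → ℝ) → ℝ,
      (∀ (v : Fin d → ℤ) x, g (x + toRow v) = g x) →
      eLpNorm (fun x => g (M *ᵥ x)) 2 (volume.restrict Γ) ≤
        C * eLpNorm g 2 (volume.restrict (unitCube d)) := by
  obtain ⟨C, hC, h⟩ := exists_setLIntegral_comp_le hM hΓ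
  refine ⟨C ^ (1 / 2 : ℝ), ENNReal.rpow_ne_top_of_nonneg (by norm_num) hC, fun g hg => ?_⟩
  rw [eLpNorm_eq_lintegral_rpow_enorm_toReal (by norm_num) (by norm_num),
    eLpNorm_eq_lintegral_rpow_enorm_toReal (by norm_num) (by norm_num)]
  simp only [ENNReal.toReal_ofNat]
  rw [← ENNReal.mul_rpow_of_nonneg _ _ (by norm_num : (0 : ℝ) ≤ 1 / 2)]
  exact ENNReal.rpow_le_rpow (h (fun x => ‖g x‖ₑ ^ (2 : ℝ)) fun v x => by rw [hg]) (by norm_num)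

theorem aestronglyMeasurable_comp_mulVec {M : Matrix (Fin d) (Fin d) ℝ} (hM : M.det ≠ 0)
    {f : (Fin d → ℝ) → ℝ} (hf : AEStronglyMeasurable f volume) :
    AEStronglyMeasurable (fun x => f (M *ᵥ x)) volume := by
  have h1 := MeasureTheory.Measure.LinearMap.quasiMeasurePreserving (volume : Measure (Fin d → ℝ)) (Matrix.toLin' M)
    (by rwa [LinearMap.det_toLin'])
  exact hf.comp_quasiMeasurePreserving h1

end Periodic

/-! ### Approximation by dyadic partial sums, uniformly in `N` -/

section Approximation

variable {d : ℕ} {A : Matrix (Fin d) (Fin d) ℝ} {q : ℝ} {f : (Fin d → ℝ) → ℝ}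

/-- The real-valued partial sum over the box of side `2^m`. -/
noncomputable def dyadicSum (f : (Fin d → ℝ) → ℝ) (m : ℕ) (x : Fin d → ℝ) : ℝ :=
  (partialSum f (2 ^ m) x).re

theorem ofReal_dyadicSum (m : ℕ) (x : Fin d → ℝ) :
    (dyadicSum f m x : ℂ) = trigPoly (fourierCoef f) (freqBox d (2 ^ m)) x :=
  ofReal_re_partialSum _ x

theorem normalizedSum_sub (g h : (Fin d → ℝ) → ℝ) (N : ℕ) :
    normalizedSum A (fun x => g x - h x) N = normalizedSum A g N - normalizedSum A h N := by
  ext x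
  simp only [normalizedSum, Pi.sub_apply, Finset.sum_sub_distrib, mul_sub]

theorem eLpNorm_sub_dyadicSum (m : ℕ) :
    eLpNorm (fun x => f x - dyadicSum f m x) 2 (volume.restrict (unitCube d)) =
      partialSumError f (2 ^ m) := by
  refine eLpNorm_congr_norm_ae (ae_of_all _ fun x => ?_)
  rw [← ofReal_re_partialSum, ← Complex.ofReal_sub, Complex.norm_real]
  rfl

/-- A crude bound whose constant depends on `N`; it gives finiteness of moments and continuity in
`L²` for each fixed `N`. -/
theorem exists_eLpNorm_normalizedSum_le (hA : ExpandsBy A q) {Γ : Set (Fin d → ℝ)}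
    (hΓ : Bornology.IsBounded Γ) (N : ℕ) :
    ∃ C : ℝ≥0∞, C ≠ ∞ ∧ ∀ g : (Fin d → ℝ) → ℝ,
      (∀ (v : Fin d → ℤ) x, g (x + toRow v) = g x) → AEStronglyMeasurable g volume →
      AEStronglyMeasurable (normalizedSum A g N) (volume.restrict Γ) ∧
      eLpNorm (normalizedSum A g N) 2 (volume.restrict Γ) ≤
        C * eLpNorm g 2 (volume.restrict (unitCube d)) := by
  have hdet : ∀ k : ℕ, (A ^ k).det ≠ 0 := fun k => by
    rw [Matrix.det_pow]; exact pow_ne_zero _ hA.isUnit_det.ne_zero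
  choose C hC hCle using fun k : ℕ => exists_eLpNorm_comp_le (hdet k) hΓ
  refine ⟨‖1 / √(N : ℝ)‖ₑ * ∑ k ∈ Finset.Icc 1 N, C k, ENNReal.mul_ne_top enorm_ne_top
    (ENNReal.sum_ne_top.2 fun k _ => hC k), fun g hg hgm => ?_⟩
  have hm : ∀ k, AEStronglyMeasurable (fun x => g (A ^ k *ᵥ x)) (volume.restrict Γ) := fun k =>
    (aestronglyMeasurable_comp_mulVec (hdet k) hgm).restrict
  have heq : normalizedSum A g N = (1 / √(N : ℝ)) •
      ∑ k ∈ Finset.Icc 1 N, (fun x => g (A ^ k *ᵥ x)) := by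
    ext x; simp [normalizedSum]
  rw [heq]
  refine ⟨(Finset.aestronglyMeasurable_sum _ fun k _ => hm k).const_smul _, ?_⟩
  rw [eLpNorm_const_smul, mul_assoc]
  gcongr
  refine (eLpNorm_sum_le (fun k _ => hm k) (by norm_num)).trans ?_
  rw [Finset.sum_mul]
  exact Finset.sum_le_sum fun k _ => hCle k g hg

theorem continuous_dyadicSum (m : ℕ) : Continuous (dyadicSum f m) :=
  continuous_of_eq_trigPoly (ofReal_dyadicSum m)

theorem dyadicSum_add_toRow (m : ℕ) (v : Fin d → ℤ) (x : Fin d → ℝ) :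
    dyadicSum f m (x + toRow v) = dyadicSum f m x := by
  rw [dyadicSum, dyadicSum, partialSum_add_toRow]

variable {μ : Measure (Fin d → ℝ)} [IsFiniteMeasure μ] {u : ℕ → ℝ} {K : ℝ}

theorem freqBox_mono {a b : ℕ} (h : a ≤ b) : freqBox d a ⊆ freqBox d b := by
  intro ξ hξ
  rw [mem_freqBox] at hξ ⊢
  exact ⟨hξ.1, fun i => (hξ.2 i).trans (by exact_mod_cast h)⟩

/-- The difference has its spectrum outside the box of size `2^m`, so its coefficient norm is at
most the error of `f_{2^m}`. The bound is free of both `N` and `m'`. -/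
theorem eLpNorm_normalizedSum_dyadicSum_sub_le (hc : CoupledTails q (fourierCoef f) u K)
    (hA : ExpandsBy A q) (hμ : BandLimited μ)
    (hf : MemLp f 2 (volume.restrict (unitCube d))) {m m' : ℕ} (hm : m ≤ m') (N : ℕ) :
    eLpNorm (normalizedSum A (dyadicSum f m') N - normalizedSum A (dyadicSum f m) N) 2 μ ≤
      ENNReal.ofReal √(2 * (μ.real Set.univ * (partialSumError f (2 ^ m)).toReal * ∑' l, u l)) := by
  set D := freqBox d (2 ^ m') \ freqBox d (2 ^ m) with hD
  have hbox := freqBox_mono (d := d) (Nat.pow_le_pow_right (n := 2) (by norm_num) hm)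
  set τ := (partialSumError f (2 ^ m)).toReal
  set S := normalizedSum A (dyadicSum f m') N - normalizedSum A (dyadicSum f m) N with hS
  have hpt : ∀ x, ‖S x‖ ^ 2 =
      (N : ℝ)⁻¹ * ‖∑ k ∈ Finset.Icc 1 N, trigPoly (fourierCoef f) D (A ^ k *ᵥ x)‖ ^ 2 := by
    intro x
    have h1 : ((S x : ℝ) : ℂ) = ((1 / √(N : ℝ) : ℝ) : ℂ) *
        ∑ k ∈ Finset.Icc 1 N, trigPoly (fourierCoef f) D (A ^ k *ᵥ x) := by
      rw [hS, ← normalizedSum_sub, normalizedSum, Complex.ofReal_mul, Complex.ofReal_sum]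
      congr 1
      refine Finset.sum_congr rfl fun k _ => ?_
      rw [Complex.ofReal_sub, ofReal_dyadicSum, ofReal_dyadicSum, trigPoly, trigPoly, trigPoly, hD,
        ← Finset.sum_sdiff hbox, add_sub_cancel_right]
    rw [← Complex.norm_real, h1, norm_mul, mul_pow, Complex.norm_real, Real.norm_eq_abs, sq_abs,
      div_pow, Real.sq_sqrt (Nat.cast_nonneg _), one_pow, one_div]
  have hU : 0 ≤ ∑' l, u l := tsum_nonneg hc.nonneg
  have hSc : Continuous S := (continuous_normalizedSum (continuous_dyadicSum m') N).sub
    (continuous_normalizedSum (continuous_dyadicSum m) N)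
  obtain ⟨B, hB⟩ := (BddCont.sum (s := Finset.Icc 1 N)
    fun k _ => (BddCont.trigPoly (fourierCoef f) D).comp_mulVec (A ^ k)).2
  have hSL : MemLp S 2 μ := by
    refine MemLp.of_bound hSc.aestronglyMeasurable √((N : ℝ)⁻¹ * B ^ 2) (ae_of_all _ fun x => ?_)
    refine Real.le_sqrt_of_sq_le ?_
    rw [hpt]
    exact mul_le_mul_of_nonneg_left (pow_le_pow_left₀ (norm_nonneg _) (hB x) 2) (by positivity)
  have hDτ : √(∑ ξ ∈ D, ‖fourierCoef f ξ‖ ^ 2) ≤ τ := by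
    rw [Real.sqrt_le_left ENNReal.toReal_nonneg]
    exact sum_norm_fourierCoef_sq_le_partialSumError hf _ Finset.sdiff_disjoint
  have hint : ∫ x, ‖S x‖ ^ 2 ∂μ ≤ 2 * (μ.real Set.univ * τ * ∑' l, u l) := by
    simp only [hpt]
    rw [integral_const_mul]
    have h1 := hc.integral_norm_sum_sq_le hA hμ D (Finset.Icc 1 N)
    rw [Nat.card_Icc, Nat.add_sub_cancel] at h1
    rcases Nat.eq_zero_or_pos N with rfl | hN
    · simp only [Nat.cast_zero, inv_zero, zero_mul]
      have : 0 ≤ τ := ENNReal.toReal_nonneg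
      positivity
    · have hN' : (0 : ℝ) < N := by exact_mod_cast hN
      rw [inv_mul_le_iff₀ hN', mul_comm (N : ℝ)]
      refine h1.trans ?_
      gcongr
  rw [← ENNReal.ofReal_toReal hSL.eLpNorm_ne_top]
  refine ENNReal.ofReal_le_ofReal (Real.le_sqrt_of_sq_le ?_)
  rw [← integral_norm_sq_eq hSL]
  exact hint

/-- For fixed `N` let `m' → ∞`: the crude bound makes the difference between `f` and `f_{2^m'}`
negligible, and the polynomial estimate survives in the limit. -/
theorem eLpNorm_normalizedSum_sub_dyadicSum_le (hc : CoupledTails q (fourierCoef f) u K)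
    (hA : ExpandsBy A q) (hμ : BandLimited μ)
    (hper : ∀ (v : Fin d → ℤ) x, f (x + toRow v) = f x)
    (hf : MemLp f 2 (volume.restrict (unitCube d)))
    (herr : Tendsto (fun m => partialSumError f (2 ^ m)) atTop (𝓝 0))
    {Γ : Set (Fin d → ℝ)} (hΓ : Bornology.IsBounded Γ) (hΓμ : volume.restrict Γ ≤ μ) (m N : ℕ) :
    eLpNorm (normalizedSum A f N - normalizedSum A (dyadicSum f m) N) 2 (volume.restrict Γ) ≤
      ENNReal.ofReal √(2 * (μ.real Set.univ * (partialSumError f (2 ^ m)).toReal * ∑' l, u l)) := by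
  obtain ⟨C, hC, h⟩ := exists_eLpNorm_normalizedSum_le hA hΓ N
  have hfm := aestronglyMeasurable_of_periodic hper hf.1
  set κ := ENNReal.ofReal √(2 * (μ.real Set.univ * (partialSumError f (2 ^ m)).toReal * ∑' l, u l))
  have hlim : Tendsto (fun m' => C * partialSumError f (2 ^ m') + κ) atTop (𝓝 (C * 0 + κ)) :=
    (ENNReal.Tendsto.const_mul herr (Or.inr hC)).add_const κ
  rw [mul_zero, zero_add] at hlim
  refine ge_of_tendsto hlim ?_
  filter_upwards [eventually_ge_atTop m] with m' hm'
  have hd := h (fun x => f x - dyadicSum f m' x)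
    (fun v x => by rw [hper, dyadicSum_add_toRow])
    (hfm.sub (continuous_dyadicSum m').aestronglyMeasurable)
  rw [eLpNorm_sub_dyadicSum, normalizedSum_sub] at hd
  have hS : normalizedSum A f N - normalizedSum A (dyadicSum f m) N =
      (normalizedSum A f N - normalizedSum A (dyadicSum f m') N) +
      (normalizedSum A (dyadicSum f m') N - normalizedSum A (dyadicSum f m) N) := by abel
  rw [hS]
  have hcont : Continuous (normalizedSum A (dyadicSum f m') N - normalizedSum A (dyadicSum f m) N) :=
    (continuous_normalizedSum (continuous_dyadicSum m') N).sub
    (continuous_normalizedSum (continuous_dyadicSum m) N)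
  refine (eLpNorm_add_le hd.1 hcont.aestronglyMeasurable (by norm_num)).trans ?_
  exact add_le_add hd.2 ((eLpNorm_mono_measure _ hΓμ).trans
    (eLpNorm_normalizedSum_dyadicSum_sub_le hc hA hμ hf hm' N))

theorem memLp_normalizedSum (hA : ExpandsBy A q)
    (hper : ∀ (v : Fin d → ℤ) x, f (x + toRow v) = f x)
    (hf : MemLp f 2 (volume.restrict (unitCube d))) {Γ : Set (Fin d → ℝ)}
    (hΓ : Bornology.IsBounded Γ) (N : ℕ) :
    MemLp (normalizedSum A f N) 2 (volume.restrict Γ) := by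
  obtain ⟨C, hC, h⟩ := exists_eLpNorm_normalizedSum_le hA hΓ N
  obtain ⟨h1, h2⟩ := h f hper (aestronglyMeasurable_of_periodic hper hf.1)
  exact ⟨h1, h2.trans_lt (ENNReal.mul_lt_top hC.lt_top hf.2)⟩

end Approximation

/-! ### Limits under smaller measures and under `L²` approximation -/

section CharFun

variable {d : ℕ} {μ ν : Measure (Fin d → ℝ)} [IsFiniteMeasure μ]

/-- Cosine and sine are bounded continuous test functions, and the limits recombine to the Gaussian
characteristic function. -/
theorem tendsto_charFun_of_le (hν : ν ≤ μ) {X : ℕ → (Fin d → ℝ) → ℝ} (hX : ∀ N, Measurable (X N))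
    {v : ℝ≥0}
    (h : ∀ (ζ : Fin d → ℝ) (t : ℝ), Tendsto (fun N => ∫ x, expo ζ x *
      Complex.exp (((t * X N x : ℝ) : ℂ) * Complex.I) ∂μ) atTop
      (𝓝 ((∫ x, expo ζ x ∂μ) * (Real.exp (-(v * t ^ 2 / 2)) : ℝ)))) (t : ℝ) :
    Tendsto (fun N => ∫ x, Complex.exp (((t * X N x : ℝ) : ℂ) * Complex.I) ∂ν) atTop
      (𝓝 (ν.real Set.univ * (Real.exp (-(v * t ^ 2 / 2)) : ℝ))) := by
  have : IsFiniteMeasure ν := isFiniteMeasure_of_le μ hν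
  have key : ∀ {Ω : Type} [MeasurableSpace Ω] (ρ : Measure Ω) [IsFiniteMeasure ρ] (Y : Ω → ℝ),
      Measurable Y → ∫ x, Complex.exp (((t * Y x : ℝ) : ℂ) * Complex.I) ∂ρ =
        ((∫ x, Real.cos (t * Y x) ∂ρ : ℝ) : ℂ) + ((∫ x, Real.sin (t * Y x) ∂ρ : ℝ) : ℂ) * Complex.I := by
    intro Ω _ ρ _ Y hY
    have hc : Integrable (fun x => Real.cos (t * Y x)) ρ :=
      Integrable.of_bound (by fun_prop) 1 (ae_of_all _ fun x => Real.abs_cos_le_one _)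
    have hs : Integrable (fun x => Real.sin (t * Y x)) ρ :=
      Integrable.of_bound (by fun_prop) 1 (ae_of_all _ fun x => Real.abs_sin_le_one _)
    rw [← integral_complex_ofReal, ← integral_complex_ofReal, ← integral_mul_const,
      ← integral_add hc.ofReal (hs.ofReal.mul_const _)]
    refine integral_congr_ae (ae_of_all _ fun x => ?_)
    simp only [Complex.exp_mul_I, Complex.ofReal_cos, Complex.ofReal_sin]
  let gc : BoundedContinuousFunction ℝ ℝ := BoundedContinuousFunction.ofNormedAddCommGroup
    (fun z => Real.cos (t * z)) (by fun_prop) 1 fun z => Real.abs_cos_le_one _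
  let gs : BoundedContinuousFunction ℝ ℝ := BoundedContinuousFunction.ofNormedAddCommGroup
    (fun z => Real.sin (t * z)) (by fun_prop) 1 fun z => Real.abs_sin_le_one _
  have h1 := (Complex.continuous_ofReal.tendsto _).comp (tendsto_integral_of_le hν hX h gc)
  have h2 := (Complex.continuous_ofReal.tendsto _).comp (tendsto_integral_of_le hν hX h gs)
  have h3 := h1.add (h2.mul_const Complex.I)
  have h4 : charFun (gaussianReal 0 v) t = (Real.exp (-(v * t ^ 2 / 2)) : ℝ) := by
    rw [charFun_gaussianReal]
    push_cast
    congr 1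
    ring
  have h5 := key (gaussianReal 0 v) id measurable_id
  have h6 : ∫ x, Complex.exp (((t * id x : ℝ) : ℂ) * Complex.I) ∂(gaussianReal 0 v) =
      (Real.exp (-(v * t ^ 2 / 2)) : ℝ) := by
    rw [← h4, charFun_apply]
    refine integral_congr_ae (ae_of_all _ fun x => ?_)
    simp
  rw [← h6, h5, mul_add, ← mul_assoc, ← Complex.ofReal_mul, ← Complex.ofReal_mul]
  exact h3.congr fun N => (key ν (X N) (hX N)).symm

end CharFun

section Limits

variable {Ω : Type*} [MeasurableSpace Ω] {ν : Measure Ω}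
  {X : ℕ → Ω → ℝ} {Y : ℕ → ℕ → Ω → ℝ} {κ : ℕ → ℝ} {v : ℕ → ℝ≥0} {w : ℝ≥0}

/-- The error `κ m` does not depend on `N`, which permits interchanging the limits in `m` and `N`.
-/
theorem tendsto_charFun_of_approx [IsFiniteMeasure ν] (hX : ∀ N, MemLp (X N) 2 ν) (hY : ∀ m N, MemLp (Y m N) 2 ν)
    (hκ0 : ∀ m, 0 ≤ κ m) (hκ : Tendsto κ atTop (𝓝 0))
    (hXY : ∀ m N, eLpNorm (X N - Y m N) 2 ν ≤ ENNReal.ofReal (κ m))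
    (hv : Tendsto v atTop (𝓝 w)) (t : ℝ)
    (h : ∀ m, Tendsto (fun N => ∫ x, Complex.exp (((t * Y m N x : ℝ) : ℂ) * Complex.I) ∂ν) atTop
      (𝓝 (ν.real Set.univ * (Real.exp (-(v m * t ^ 2 / 2)) : ℝ)))) :
    Tendsto (fun N => ∫ x, Complex.exp (((t * X N x : ℝ) : ℂ) * Complex.I) ∂ν) atTop
      (𝓝 (ν.real Set.univ * (Real.exp (-(w * t ^ 2 / 2)) : ℝ))) := by
  have hlim : Tendsto (fun m => (ν.real Set.univ : ℂ) * (Real.exp (-(v m * t ^ 2 / 2)) : ℝ)) atTop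
      (𝓝 (ν.real Set.univ * (Real.exp (-(w * t ^ 2 / 2)) : ℝ))) := by
    have hcont : Continuous fun z : ℝ≥0 =>
        (ν.real Set.univ : ℂ) * (Real.exp (-(z * t ^ 2 / 2)) : ℝ) := by fun_prop
    exact (hcont.tendsto w).comp hv
  have hκ' : Tendsto (fun m => |t| * (√(ν.real Set.univ) * κ m)) atTop (𝓝 0) := by
    simpa using (hκ.const_mul (√(ν.real Set.univ))).const_mul |t|
  refine tendsto_of_approx fun ε hε => ?_
  obtain ⟨m, hm1, hm2⟩ := ((hκ'.eventually (gt_mem_nhds hε)).and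
    (Metric.tendsto_nhds.1 hlim ε hε)).exists
  refine ⟨_, _, h m, hm2.le, Eventually.of_forall fun N => ?_⟩
  have hint : ∀ {Z : Ω → ℝ}, MemLp Z 2 ν →
      Integrable (fun x => Complex.exp (((t * Z x : ℝ) : ℂ) * Complex.I)) ν := by
    intro Z hZ
    refine Integrable.of_bound ?_ 1 (ae_of_all _ fun x => (Complex.norm_exp_ofReal_mul_I _).le)
    have hc : Continuous fun z : ℝ => Complex.exp (((t * z : ℝ) : ℂ) * Complex.I) := by fun_prop
    exact hc.comp_aestronglyMeasurable hZ.1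
  have hD : MemLp (X N - Y m N) 2 ν := (hX N).sub (hY m N)
  rw [dist_eq_norm, ← integral_sub (hint (hX N)) (hint (hY m N))]
  refine (norm_integral_le_integral_norm _).trans (le_trans ?_ hm1.le)
  calc ∫ x, ‖Complex.exp (((t * X N x : ℝ) : ℂ) * Complex.I) -
        Complex.exp (((t * Y m N x : ℝ) : ℂ) * Complex.I)‖ ∂ν
      ≤ ∫ x, |t| * ‖(X N - Y m N) x‖ ∂ν := by
        refine integral_mono ((hint (hX N)).sub (hint (hY m N))).norm
          ((hD.integrable (by norm_num)).norm.const_mul _) fun x => ?_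
        refine (norm_exp_mul_I_sub_le _ _).trans_eq ?_
        rw [← mul_sub, abs_mul]; rfl
    _ = |t| * ∫ x, ‖(X N - Y m N) x‖ ∂ν := integral_const_mul _ _
    _ ≤ |t| * (√(ν.real Set.univ) * κ m) := by
        gcongr
        refine (integral_norm_le_sqrt_mul_sqrt hD).trans ?_
        gcongr
        rw [integral_norm_sq_eq hD, Real.sqrt_sq ENNReal.toReal_nonneg]
        exact ENNReal.toReal_le_of_le_ofReal (hκ0 m) (hXY m N)

theorem tendsto_integral_sq_of_approx (hX : ∀ N, MemLp (X N) 2 ν)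
    (hY : ∀ m N, MemLp (Y m N) 2 ν) (hκ0 : ∀ m, 0 ≤ κ m) (hκ : Tendsto κ atTop (𝓝 0))
    (hXY : ∀ m N, eLpNorm (X N - Y m N) 2 ν ≤ ENNReal.ofReal (κ m))
    (hv : Tendsto v atTop (𝓝 w))
    (h : ∀ m, Tendsto (fun N => ∫ x, Y m N x ^ 2 ∂ν) atTop (𝓝 (ν.real Set.univ * v m))) :
    Tendsto (fun N => ∫ x, X N x ^ 2 ∂ν) atTop (𝓝 (ν.real Set.univ * w)) := by
  have hsq : ∀ {Z : Ω → ℝ}, MemLp Z 2 ν → ∫ x, Z x ^ 2 ∂ν = (eLpNorm Z 2 ν).toReal ^ 2 := by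
    intro Z hZ
    rw [← integral_norm_sq_eq hZ]
    simp
  have hlim : Tendsto (fun m => √(ν.real Set.univ * v m)) atTop (𝓝 √(ν.real Set.univ * w)) := by
    have hcont : Continuous fun z : ℝ≥0 => √(ν.real Set.univ * z) := by fun_prop
    exact (hcont.tendsto w).comp hv
  have hnorm : Tendsto (fun N => (eLpNorm (X N) 2 ν).toReal) atTop (𝓝 √(ν.real Set.univ * w)) := by
    refine tendsto_of_approx fun ε hε => ?_
    obtain ⟨m, hm1, hm2⟩ := ((hκ.eventually (gt_mem_nhds hε)).and
      (Metric.tendsto_nhds.1 hlim ε hε)).exists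
    refine ⟨fun N => (eLpNorm (Y m N) 2 ν).toReal, _, ?_, hm2.le, Eventually.of_forall fun N => ?_⟩
    · refine ((Real.continuous_sqrt.tendsto _).comp (h m)).congr fun N => ?_
      rw [Function.comp, hsq (hY m N), Real.sqrt_sq ENNReal.toReal_nonneg]
    · have hD : MemLp (X N - Y m N) 2 ν := (hX N).sub (hY m N)
      have hb : (eLpNorm (X N - Y m N) 2 ν).toReal ≤ ε :=
        (ENNReal.toReal_le_of_le_ofReal (hκ0 m) (hXY m N)).trans hm1.le
      have tri : ∀ {Z W : Ω → ℝ}, MemLp Z 2 ν → MemLp W 2 ν →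
          (eLpNorm (Z + W) 2 ν).toReal ≤ (eLpNorm Z 2 ν).toReal + (eLpNorm W 2 ν).toReal := by
        intro Z W hZ hW
        rw [← ENNReal.toReal_add hZ.eLpNorm_ne_top hW.eLpNorm_ne_top]
        exact ENNReal.toReal_mono (ENNReal.add_ne_top.2 ⟨hZ.eLpNorm_ne_top, hW.eLpNorm_ne_top⟩)
          (eLpNorm_add_le hZ.1 hW.1 (by norm_num))
      have h1 := tri hD (hY m N)
      have hD' : MemLp (Y m N - X N) 2 ν := (hY m N).sub (hX N)
      have h2 := tri hD' (hX N)
      rw [sub_add_cancel] at h1 h2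
      rw [eLpNorm_sub_comm] at h2
      rw [Real.dist_eq, abs_le]
      constructor <;> linarith
  have h1 := hnorm.pow 2
  rw [Real.sq_sqrt (by positivity)] at h1
  exact h1.congr fun N => (hsq (hX N)).symm

end Limits

/-! ### Assembly of the theorem -/

section Main

variable {d : ℕ} {A : Matrix (Fin d) (Fin d) ℝ} {q : ℝ} {f : (Fin d → ℝ) → ℝ}

theorem tendsto_partialSumError (h : ∑' m : ℕ, partialSumError f (2 ^ (m + 1)) < ∞) :
    Tendsto (fun m : ℕ => partialSumError f (2 ^ m)) atTop (𝓝 0) :=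
  (tendsto_add_atTop_iff_nat 1).1 (ENNReal.tendsto_atTop_zero_of_tsum_ne_top h.ne)

theorem exists_coupledTails (hq : 1 < q) (hf : MemLp f 2 (volume.restrict (unitCube d)))
    (hf0 : ∫ x in unitCube d, f x = 0)
    (h : ∑' m : ℕ, partialSumError f (2 ^ (m + 1)) < ∞) :
    ∃ u K, CoupledTails q (fourierCoef f) u K := by
  have hK : ∀ G : Finset (Fin d → ℤ),
      ∑ ξ ∈ G, ‖fourierCoef f ξ‖ ^ 2 ≤ √(∫ x in unitCube d, f x ^ 2) ^ 2 := fun G => by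
    rw [Real.sq_sqrt (integral_nonneg fun x => sq_nonneg _)]
    exact sum_norm_fourierCoef_sq_le hf G
  obtain ⟨u, hu, hu0, hut⟩ := exists_tail_bound hq (a := fun ξ => ‖fourierCoef f ξ‖)
    (τ := fun m => (partialSumError f (2 ^ m)).toReal) (fun m => ENNReal.toReal_nonneg)
    ((summable_nat_add_iff 1).1 (ENNReal.summable_toReal h.ne))
    (fun m G hG => sum_norm_fourierCoef_sq_le_partialSumError hf _ hG) (Real.sqrt_nonneg _) hK
  exact ⟨u, _, fourierCoef_zero hf0, hu, hu0, hut, Real.sqrt_nonneg _, hK⟩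

/-- Each polynomial variance is a nonnegative real, and so is the limit of these variances. Any
nonzero band-limited measure suffices to see the positivity. -/
theorem exists_tendsto_variance (hA : ExpandsBy A q)
    (hs : Summable fun p => ‖varianceTerm A f p‖) (h0 : fourierCoef f 0 = 0) :
    ∃ (v : ℕ → ℝ≥0) (w : ℝ≥0),
      (∀ m, polyVariance A (fourierCoef f) (freqBox d (2 ^ m)) = ((v m : ℝ) : ℂ)) ∧
      limitVariance A f = ((w : ℝ) : ℂ) ∧ Tendsto v atTop (𝓝 w) := by
  obtain ⟨μ, hfin, hμ, hμ0, -⟩ := exists_bandLimited d 1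
  choose v hv using fun m : ℕ => exists_polyVariance_eq (A := A) hA hμ hμ0
    (zero_notMem_freqBox (2 ^ m)) (ofReal_dyadicSum (f := f) m)
  have h1 : Tendsto (fun m => ((v m : ℝ) : ℂ)) atTop (𝓝 (limitVariance A f)) :=
    (tendsto_polyVariance hs h0).congr hv
  have hre : Tendsto (fun m => (v m : ℝ)) atTop (𝓝 (limitVariance A f).re) :=
    ((Complex.continuous_re.tendsto _).comp h1).congr fun m => Complex.ofReal_re _
  have hw : 0 ≤ (limitVariance A f).re := ge_of_tendsto' hre fun m => (v m).2
  have h2 : limitVariance A f = (((limitVariance A f).re : ℝ) : ℂ) :=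
    tendsto_nhds_unique h1 ((Complex.continuous_ofReal.tendsto _).comp hre)
  exact ⟨v, ⟨_, hw⟩, hv, h2, NNReal.tendsto_coe.1 hre⟩

theorem exists_bandLimited_of_isBounded {Γ : Set (Fin d → ℝ)} (hΓ : Bornology.IsBounded Γ) :
    ∃ μ : Measure (Fin d → ℝ), IsFiniteMeasure μ ∧ BandLimited μ ∧ volume.restrict Γ ≤ μ := by
  obtain ⟨R, hR⟩ := ((PiLp.lipschitzWith_toLp 2 (fun _ : Fin d => ℝ)).isBounded_image
    hΓ).exists_norm_le
  obtain ⟨μ, hfin, hμ, -, hle⟩ := exists_bandLimited d R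
  exact ⟨μ, hfin, hμ, hle Γ fun x hx => hR _ (Set.mem_image_of_mem _ hx)⟩

end Main

end RieszRaikov

open RieszRaikov

theorem theorem1 {d : ℕ} (A : Matrix (Fin d) (Fin d) ℝ) (hA : RieszRaikov.IsExpanding A)
    (f : (Fin d → ℝ) → ℝ)
    (hf_periodic : ∀ (i : Fin d) (x : Fin d → ℝ), f (x + Pi.single i 1) = f x)
    (hf_L2 : MemLp f 2 (volume.restrict (RieszRaikov.unitCube d)))
    (hf_mean : ∫ x in RieszRaikov.unitCube d, f x = 0)
    (hf_sum : ∑' m : ℕ, RieszRaikov.partialSumError f (2 ^ (m + 1)) < ∞) :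
    -- the series defining the limiting variance converges absolutely,
    Summable (fun p => ‖RieszRaikov.varianceTerm A f p‖) ∧
    -- its sum `v` is a nonnegative real number,
    ∃ v : ℝ≥0, RieszRaikov.limitVariance A f = ((v : ℝ) : ℂ) ∧
      ∀ Γ : Set (Fin d → ℝ), NullMeasurableSet Γ volume → Bornology.IsBounded Γ →
        -- the second moments are finite and converge,
        (∀ N : ℕ, IntegrableOn (fun x => RieszRaikov.normalizedSum A f N x ^ 2) Γ volume) ∧
        Tendsto (fun N : ℕ => ∫ x in Γ, RieszRaikov.normalizedSum A f N x ^ 2) atTop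
          (𝓝 (volume.real Γ * (v : ℝ))) ∧
        -- and the central limit theorem holds.
        ∀ t : ℝ, (t ≠ 0 ∨ 0 < v) →
          Tendsto
            (fun N : ℕ => volume.real {x ∈ Γ | RieszRaikov.normalizedSum A f N x ≤ t}) atTop
            (𝓝 (volume.real Γ * cdf (gaussianReal 0 v) t)) := by
  obtain ⟨q, hA⟩ := hA
  replace hA : ExpandsBy A q := hA
  have hper := apply_add_toRow hf_periodic
  obtain ⟨u, K, hc⟩ := exists_coupledTails hA.1 hf_L2 hf_mean hf_sum
  have herr := tendsto_partialSumError hf_sum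
  have hs : Summable fun p => ‖varianceTerm A f p‖ := hc.summable_coefVarianceTerm hA
  obtain ⟨v, w, hv, hw, hvw⟩ := exists_tendsto_variance hA hs hc.coef_zero
  refine ⟨hs, w, hw, fun Γ hΓm hΓ => ?_⟩
  obtain ⟨μ, hfin, hμ, hΓμ⟩ := exists_bandLimited_of_isBounded hΓ
  have hνfin : IsFiniteMeasure (volume.restrict Γ) := isFiniteMeasure_of_le μ hΓμ
  have hX := memLp_normalizedSum hA hper hf_L2 hΓ
  have hXY := eLpNorm_normalizedSum_sub_dyadicSum_le hc hA hμ hper hf_L2 herr hΓ hΓμ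
  set κ : ℕ → ℝ := fun m =>
    √(2 * (μ.real Set.univ * (partialSumError f (2 ^ m)).toReal * ∑' l, u l)) with hκdef
  have hκ : Tendsto κ atTop (𝓝 0) := by
    have h1 := (ENNReal.tendsto_toReal ENNReal.zero_ne_top).comp herr
    have h2 := (Real.continuous_sqrt.tendsto _).comp
      (((h1.const_mul (μ.real Set.univ)).mul_const (∑' l, u l)).const_mul 2)
    simp only [ENNReal.toReal_zero, mul_zero, zero_mul, Real.sqrt_zero] at h2
    exact h2
  have hcont : ∀ m N, Continuous (normalizedSum A (dyadicSum f m) N) := fun m =>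
    continuous_normalizedSum (continuous_dyadicSum m)
  have hbdd : ∀ m N, ∃ B, ∀ x, ‖normalizedSum A (dyadicSum f m) N x‖ ≤ B := by
    intro m N
    obtain ⟨B, hB⟩ := exists_abs_le_of_eq_trigPoly (ofReal_dyadicSum (f := f) m)
    refine ⟨|1 / √(N : ℝ)| * ∑ k ∈ Finset.Icc 1 N, B, fun x => ?_⟩
    rw [normalizedSum, norm_mul, Real.norm_eq_abs]
    gcongr
    exact norm_sum_le_of_le _ fun k _ => hB _
  -- Stated for every finite measure because it is needed both under `μ` and under Lebesgue measure
  -- on `Γ`.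
  have hYmem : ∀ (ρ : Measure (Fin d → ℝ)) [IsFiniteMeasure ρ] (m N : ℕ),
      MemLp (normalizedSum A (dyadicSum f m) N) 2 ρ := by
    intro ρ _ m N
    obtain ⟨B, hB⟩ := hbdd m N
    exact MemLp.of_bound (hcont m N).aestronglyMeasurable B (ae_of_all _ hB)
  have hchar := fun m => tendsto_charFun_trigPoly hA (zero_notMem_freqBox (2 ^ m)) hμ
    (ofReal_dyadicSum (f := f) m) (hv m)
  have hmeas : ∀ m N, Measurable (normalizedSum A (dyadicSum f m) N) := fun m N =>
    (hcont m N).measurable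
  have huniv : (volume.restrict Γ).real Set.univ = volume.real Γ := by
    simp [measureReal_def]
  have hcharX := fun t => tendsto_charFun_of_approx hX (hYmem _) (fun m => Real.sqrt_nonneg _) hκ
    hXY hvw t fun m => tendsto_charFun_of_le hΓμ (hmeas m) (hchar m) t
  refine ⟨fun N => (hX N).integrable_sq, ?_, fun t ht => ?_⟩
  · rw [← huniv]
    exact tendsto_integral_sq_of_approx hX (hYmem _) (fun m => Real.sqrt_nonneg _) hκ hXY hvw
      fun m => tendsto_integral_sq_of_le hΓμ (hmeas m) (hchar m)
        (fun N => (hYmem μ m N).integrable_sq)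
        (tendsto_integral_normalizedSum_sq hA (zero_notMem_freqBox (2 ^ m)) hμ
          (ofReal_dyadicSum (f := f) m) (hv m))
  · have h1 := tendsto_measureReal_le_of_tendsto_charFun (fun N => (hX N).1.aemeasurable) hcharX ht
    rw [huniv] at h1
    refine h1.congr fun N => ?_
    rw [measureReal_def, measureReal_def, Measure.restrict_apply₀' hΓm, Set.inter_comm]
    rfl
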